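/- **Definitions.** Let $C[0,1]$ be the space of real continuous functions on $[0,1]$ with the sup norm $\|\cdot\|$ and its Borel $\sigma$-algebra, and write $\langle y\rangle=y-\lfloor y\rfloor$. - For $f,g\in C[0,1]$ let $\mathsf{cr}(f,g)=\{x\in[0,1]:\langle f(x)\rangle=\langle g(x)\rangle\}$. For finite sets $A,B\subseteq[0,1]$ write $A\sim_\epsilon B$ if $|A|=|B|$ and, for every $i$, the $i$-th smallest elements of $A$ and of $B$ are at distance less than $\epsilon$. - A set $\mathcal F\subseteq C[0,1]$ is *transverse* if the sets $\mathsf{cr}(f,g)$ belonging to different unordered pairs $\{f,g\}$ of distinct elements of $\mathcal F$ are disjoint and, for all distinct $f,g\in\mathcal F$, the set $\mathsf{cr}(f,g)$ is finite, contains neither $0$ nor $1$, and contains no local extremum of $f-g$. - A set $V\subseteq C[0,1]$ is *smoothly dense* if it is dense and transverse, each of its elements is Lipschitz, and for every finite $\mathcal F\subset V$, every $f\in C[0,1]\setminus\mathcal F$ such that $\mathcal F\cup\{f\}$ is transverse, and every $\epsilon>0$, there is $g\in V$ such that $\|f-g\|<\epsilon$ and $\mathsf{cr}(f,h)\sim_\epsilon\mathsf{cr}(g,h)$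 for all $h\in\mathcal F$. - For a countable set $V\subseteq C[0,1]$ and $p\in(0,1)$, $\mathrm{LARG}(V,p)$ is the random graph with vertex set $V$ in which each pair of distinct $u,v\in V$ with $\|u-v\|<1$ is joined independently with probability $p$, and no other pairs are joined. - $\mathbb P_{\mathrm{poly}}$ is the law on $C[0,1]$ of $t\mapsto a_0+a_1t+\dots+a_nt^n$, where $n$ is Poisson with mean $1$, the $a_i$ are standard normal, and all these variables are independent. - $\mathbb P_{\mathsf{PL}}$ is the law on $C[0,1]$ of the piecewise linear function whose graph consists of the line segments joining consecutive points among $(0,y_0),(\hat x_1,y_1),\dots,(\hat x_n,y_n),(1,y_{n+1})$, where $n$ is Poisson with mean $1$, $\hat x_1<\dots<\hat x_n$ is the increasing rearrangement of $x_1,\dots,x_n$, the $x_i$ are uniform on $[0,1]$, the $y_i$ are standard normal, and all these variables are independent. **Statement.** There is a countably infinite graph $GR(\mathrm{SD})$, unique up to isomorphism, such that for every countable smoothly dense set $V\subseteq C[0,1]$ and every $p\in(0,1)$, $\mathrm{LARG}(V,p)$ is almost surely isomorphic to $GR(\mathrm{SD})$. Moreover, let $\mathbb P$ be $\mathbb P_{\mathrm{poly}}$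 or $\mathbb P_{\mathsf{PL}}$. Then for $\mathbb P^{\mathbb N}$-almost every sequence $(f_n)_{n\in\mathbb N}$ in $C[0,1]$, with $V=\{f_n:n\in\mathbb N\}$, the following holds: for every $p\in(0,1)$, a graph sampled from $\mathrm{LARG}(V,p)$ is almost surely isomorphic to $GR(\mathrm{SD})$. -/

import Mathlib

open MeasureTheory ProbabilityTheory unitInterval

noncomputable section

namespace SmoothRado

/-! ### Crossings, transverse sets and smoothly dense sets in `C[0,1]` -/

/-- The set of points at which `f` and `g` cross, that is, have the same fractional part. -/
def cr (f g : C(I, ℝ)) : Set I := {x | Int.fract (f x) = Int.fract (g x)}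

/-- `A ∼_ε B`: the sets `A` and `B` are finite of the same cardinality and, when both are listed in
increasing order, corresponding elements are within `ε` of each other. -/
def SimWithin (ε : ℝ) (A B : Set I) : Prop :=
  ∃ (n : ℕ) (a b : Fin n → I), StrictMono a ∧ StrictMono b ∧ Set.range a = A ∧ Set.range b = B ∧
    ∀ i, dist (a i) (b i) < ε

/-- Transverse sets of continuous functions; "pairs" are unordered pairs of distinct elements. -/
structure IsTransverse (F : Set C(I, ℝ)) : Prop where
  disjoint_cr : ∀ f ∈ F, ∀ g ∈ F, ∀ h ∈ F, ∀ k ∈ F, f ≠ g → h ≠ k → s(f, g) ≠ s(h, k) →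
    Disjoint (cr f g) (cr h k)
  finite_cr : ∀ f ∈ F, ∀ g ∈ F, f ≠ g → (cr f g).Finite
  zero_notMem : ∀ f ∈ F, ∀ g ∈ F, f ≠ g → 0 ∉ cr f g
  one_notMem : ∀ f ∈ F, ∀ g ∈ F, f ≠ g → 1 ∉ cr f g
  not_isLocalExtr : ∀ f ∈ F, ∀ g ∈ F, f ≠ g → ∀ t ∈ cr f g, ¬ IsLocalExtr (⇑(f - g)) t

/-- Smoothly dense subsets of `C[0,1]`. In the last clause `f` is a function outside `F`
(otherwise `cr f f` would be all of `[0,1]`). -/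
structure IsSmoothlyDense (V : Set C(I, ℝ)) : Prop where
  dense : Dense V
  transverse : IsTransverse V
  lipschitz : ∀ f ∈ V, ∃ K : NNReal, LipschitzWith K f
  approx : ∀ F : Finset C(I, ℝ), (F : Set C(I, ℝ)) ⊆ V → ∀ f : C(I, ℝ), f ∉ F →
    IsTransverse (insert f (F : Set C(I, ℝ))) → ∀ ε : ℝ, 0 < ε →
      ∃ g ∈ V, ‖f - g‖ < ε ∧ ∀ h ∈ F, SimWithin ε (cr f h) (cr g h)

/-! ### Local area random graphs -/

/-- The graph on `V` joining all pairs of distinct points at distance less than `1`. -/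
def unitDistGraph {X : Type*} [NormedAddCommGroup X] (V : Set X) : SimpleGraph V where
  Adj u v := u ≠ v ∧ ‖(u : X) - v‖ < 1
  symm := ⟨fun _ _ h => ⟨h.1.symm, by rw [norm_sub_rev]; exact h.2⟩⟩
  loopless := ⟨fun _ h => h.1 rfl⟩

/-- The law of `LARG(V, p)`: the random graph on `V` in which every pair of distinct points at
distance less than `1` is an edge with probability `p`, independently, and there is no other
edge. -/
def LARG {X : Type*} [NormedAddCommGroup X] (V : Set X) (p : I) : Measure (SimpleGraph V) :=
  (setBernoulli (unitDistGraph V).edgeSet p).map SimpleGraph.fromEdgeSet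

instance {X : Type*} [NormedAddCommGroup X] (V : Set X) (p : I) :
    IsProbabilityMeasure (LARG V p) :=
  Measure.isProbabilityMeasure_map SimpleGraph.measurable_fromEdgeSet.aemeasurable

/-- For every `p ∈ (0,1)`, `LARG(V, p)` is almost surely isomorphic to `R`. -/
def LARGAlmostSurelyIso (V : Set C(I, ℝ)) (R : SimpleGraph ℕ) : Prop :=
  ∀ p : I, 0 < p → p < 1 → ∀ᵐ G ∂(LARG V p), Nonempty (G ≃g R)

/-- The property that defines the isomorphism type `GR(SD)`: the graph `R` is almost surely
isomorphic to `LARG(V, p)` for all countable smoothly dense `V` and all `p ∈ (0,1)`. -/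
def IsGRSD (R : SimpleGraph ℕ) : Prop :=
  ∀ V : Set C(I, ℝ), V.Countable → IsSmoothlyDense V → LARGAlmostSurelyIso V R

/-! ### The Borel σ-algebra of `C[0,1]` -/

instance : MeasurableSpace C(I, ℝ) := borel _

instance : BorelSpace C(I, ℝ) := ⟨rfl⟩

theorem measurable_of_eval {Ω : Type*} [MeasurableSpace Ω] {Φ : Ω → C(I, ℝ)}
    (h : ∀ t, Measurable fun ω => Φ ω t) : Measurable Φ := by
  have hd : ∀ (g : C(I, ℝ)) (r : ℝ), 0 ≤ r →
      MeasurableSet (Φ ⁻¹' Metric.closedBall g r) := by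
    intro g r hr
    have : Φ ⁻¹' Metric.closedBall g r
        = ⋂ n : ℕ, {ω | dist (Φ ω (TopologicalSpace.denseSeq I n))
            (g (TopologicalSpace.denseSeq I n)) ≤ r} := by
      ext ω
      simp only [Set.mem_preimage, Metric.mem_closedBall, Set.mem_iInter, Set.mem_ofPred_eq]
      rw [ContinuousMap.dist_le hr]
      refine ⟨fun H n => H _, fun H t => ?_⟩
      have hc : IsClosed {t : I | dist (Φ ω t) (g t) ≤ r} :=
        isClosed_le (by fun_prop) continuous_const
      have := (TopologicalSpace.denseRange_denseSeq I).closure_range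
      have h2 : closure (Set.range (TopologicalSpace.denseSeq I))
          ⊆ {t : I | dist (Φ ω t) (g t) ≤ r} := by
        apply closure_minimal _ hc
        rintro _ ⟨n, rfl⟩
        exact H n
      exact h2 (by rw [this]; trivial)
    rw [this]
    exact MeasurableSet.iInter fun n =>
      measurableSet_le ((h _).dist measurable_const) measurable_const
  refine measurable_of_isOpen fun s hs => ?_
  choose! r hr hrs using fun (g : C(I, ℝ)) (hg : g ∈ s) =>
    Metric.nhds_basis_closedBall.mem_iff.1 (hs.mem_nhds hg)
  obtain ⟨T, hTs, hTc, hT⟩ := TopologicalSpace.countable_cover_nhdsWithin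
    (s := s) (f := fun g => Metric.closedBall g (r g))
    (fun g hg => mem_nhdsWithin_of_mem_nhds (Metric.closedBall_mem_nhds g (hr g hg)))
  have : s = ⋃ g ∈ T, Metric.closedBall g (r g) :=
    Set.Subset.antisymm hT (Set.iUnion₂_subset fun g hg => hrs g (hTs hg))
  rw [this, Set.preimage_iUnion₂]
  exact MeasurableSet.biUnion hTc fun g hg => hd g _ (hr g (hTs hg)).le

/-! ### Random polynomials -/

/-- The polynomial function `a₀ + a₁ t + ⋯ + aₙ tⁿ` on `[0,1]`. -/
def polyMap (q : ℕ × (ℕ → ℝ)) : C(I, ℝ) :=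
  ⟨fun t => ∑ i ∈ Finset.range (q.1 + 1), q.2 i * (t : ℝ) ^ i, by fun_prop⟩

theorem measurable_polyMap : Measurable polyMap := by
  refine measurable_of_eval fun t => measurable_from_prod_countable_right fun n => ?_
  simp only [polyMap, ContinuousMap.coe_mk]
  fun_prop

/-- The random polynomial measure: the degree bound is Poisson with mean `1` and the coefficients
are independent standard normal variables. -/
def polyMeasure : Measure C(I, ℝ) :=
  ((poissonMeasure 1).prod (Measure.infinitePi fun _ : ℕ => gaussianReal 0 1)).map polyMap

instance : IsProbabilityMeasure polyMeasure :=
  Measure.isProbabilityMeasure_map measurable_polyMap.aemeasurable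

/-! ### Random piecewise linear functions -/

/-- The first coordinates `0 = x̂₀ ≤ x̂₁ ≤ ⋯ ≤ x̂ₙ ≤ x̂ₙ₊₁ = 1` of the change points, where
`x̂₁, …, x̂ₙ` are `x₁, …, xₙ` in increasing order. -/
def changePoint (n : ℕ) (x : ℕ → I) : Fin (n + 2) → ℝ :=
  let z : Fin n → I := fun i => x (i + 1)
  Fin.cons 0 (Fin.snoc (fun i => (z (Tuple.sort z i) : ℝ)) 1)

/-- The function on `[0,1]` whose graph consists of the line segments joining consecutive points
`(x̂ᵢ, yᵢ)`, `i = 0, …, n + 1`. (The `i`-th summand vanishes up to `x̂ᵢ`, is linear from `x̂ᵢ` to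
`x̂ᵢ₊₁`, and equals `yᵢ₊₁ - yᵢ` from there on. The formula is used only for distinct `x̂ᵢ`, that is,
for almost all parameters.) -/
def plMap (q : ℕ × (ℕ → I) × (ℕ → ℝ)) : C(I, ℝ) :=
  ⟨fun t => q.2.2 0 + ∑ i : Fin (q.1 + 1), (q.2.2 (i + 1) - q.2.2 i) *
      max 0 (min 1 (((t : ℝ) - changePoint q.1 q.2.1 i.castSucc) /
        (changePoint q.1 q.2.1 i.succ - changePoint q.1 q.2.1 i.castSucc))), by fun_prop⟩

theorem measurable_changePoint (n : ℕ) (j : Fin (n + 2)) :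
    Measurable fun x : ℕ → I => changePoint n x j := by
  let _ : MeasurableSpace (Equiv.Perm (Fin n)) := ⊤
  have hs : Measurable fun x : ℕ → I => Tuple.sort fun i : Fin n => x (i + 1) := by
    refine measurable_to_countable' fun τ => ?_
    have : (fun x : ℕ → I => Tuple.sort fun i : Fin n => x (i + 1)) ⁻¹' {τ}
        = {x | (∀ i j : Fin n, i ≤ j → x (τ i + 1) ≤ x (τ j + 1)) ∧
            ∀ i j : Fin n, i < j → x (τ i + 1) = x (τ j + 1) → τ i < τ j} := by
      ext x
      simp only [Set.mem_preimage, Set.mem_singleton_iff, Set.mem_ofPred_eq]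
      rw [eq_comm, Tuple.eq_sort_iff]
      rfl
    rw [this]
    simp only [Set.ofPred_and, Set.ofPred_forall]
    refine MeasurableSet.inter ?_ ?_
    · exact .iInter fun i => .iInter fun j => .iInter fun _ =>
        measurableSet_le (by fun_prop) (by fun_prop)
    · refine .iInter fun i => .iInter fun j => .iInter fun _ => ?_
      exact (measurableSet_eq_fun (by fun_prop) (by fun_prop)).imp (MeasurableSet.const _)
  refine Fin.cases ?_ (fun j => Fin.lastCases ?_ (fun j => ?_) j) j
  · simp [changePoint]
  · simp [changePoint]
  · have h2 : Measurable fun q : (ℕ → I) × Equiv.Perm (Fin n) => ((q.1 (q.2 j + 1) : I) : ℝ) :=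
      measurable_from_prod_countable_left fun τ =>
        measurable_subtype_coe.comp (measurable_pi_apply (τ j + 1 : ℕ))
    have h3 := h2.comp (measurable_id.prodMk hs)
    simp only [changePoint, Fin.cons_succ, Fin.snoc_castSucc]
    exact h3

theorem measurable_plMap : Measurable plMap := by
  refine measurable_of_eval fun t => measurable_from_prod_countable_right fun n => ?_
  have h : ∀ j, Measurable fun q : (ℕ → I) × (ℕ → ℝ) => changePoint n q.1 j :=
    fun j => (measurable_changePoint n j).comp measurable_fst
  change Measurable fun q : (ℕ → I) × (ℕ → ℝ) => q.2 0 + ∑ i : Fin (n + 1),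
    (q.2 (i + 1) - q.2 i) * max 0 (min 1 (((t : ℝ) - changePoint n q.1 i.castSucc) /
      (changePoint n q.1 i.succ - changePoint n q.1 i.castSucc)))
  fun_prop

/-- The random piecewise linear measure: the number of interior change points is Poisson with
mean `1`, their first coordinates are independent and uniform on `[0,1]`, and the second
coordinates of all change points are independent standard normal variables. -/
def plMeasure : Measure C(I, ℝ) :=
  ((poissonMeasure 1).prod ((Measure.infinitePi fun _ : ℕ => (volume : Measure I)).prod
    (Measure.infinitePi fun _ : ℕ => gaussianReal 0 1))).map plMap

instance : IsProbabilityMeasure plMeasure :=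
  Measure.isProbabilityMeasure_map measurable_plMap.aemeasurable

end SmoothRado

end

open SmoothRado MeasureTheory

open SmoothRado MeasureTheory

section

open ProbabilityTheory unitInterval Set Filter Topology

/-! ### Crossings and matchings of families of functions -/

/-! All relevant information about a family of functions is contained in the integer parts of their
pairwise differences, up to an increasing reparametrization `θ` of `[0,1]`. The pair `⌊f - g⌋`, `⌊g
- f⌋` tells where `f` and `g` cross, whether a crossing is a local extremum, whether `f = g` and
whether `‖f - g‖ < 1`. Two families are therefore regarded as equivalent when some `θ` matches these
integer parts (`Matches`), and transversality passes from one to the other (`Matches.isTransverse`).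

Isomorphism is proved by back and forth along finite matched families on which adjacency also
agrees. To add a function `f` on one side, `Matches.exists_insert` finds a counterpart in `C[0,1]`
by gluing local choices with a partition of unity. Smooth density replaces it by a member of the
other vertex set: an approximation whose crossings are close enough is matched to the original
function, because a homeomorphism can move the old crossings to the new ones
(`IsTransverse.exists_matches`). There are infinitely many such replacements, and each has the
prescribed adjacencies to the finitely many old vertices with probability bounded below,
independently; so almost surely one of them works (`IsSmoothlyDense.ae_hasExtension`). The resulting
extension property determines the graph up to isomorphism, whatever `V` and `p` are.

For random sequences it remains to show that the sample is almost surely smoothly dense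
(`TranslationQuasiInvariant.ae_isSmoothlyDense`). Quasi-invariance of the law under adding constants
prevents functionals that commute with adding constants, such as point values and suprema, from
having atoms; this gives transversality. For approximation with control of crossings, a target `f`
is first perturbed so that it passes each crossing with a slope larger than the Lipschitz constants
of the finite family. A function that is close to the perturbed target and still steep there crosses
exactly once near each old crossing. Both laws charge such sets of functions: for polynomials one
integrates a polynomial approximation of the derivative of a moving average, for piecewise linear
functions one interpolates at nearly equidistant nodes. -/

theorem mem_cr_iff {f g : C(I, ℝ)} {x : I} : x ∈ cr f g ↔ ∃ k : ℤ, f x - g x = k := by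
  simp only [cr, mem_ofPred_eq, Int.fract_eq_fract]

theorem cr_comm (f g : C(I, ℝ)) : cr f g = cr g f := by
  ext x; simp only [cr, mem_ofPred_eq, eq_comm]

/-- The sum `⌊a⌋ + ⌊-a⌋` is `0` at integers and `-1` elsewhere. Integrality, and hence crossing, is
thus visible in the integer parts of the two opposite differences. -/
theorem exists_int_eq_iff_floor {a : ℝ} : (∃ k : ℤ, a = k) ↔ ⌊a⌋ + ⌊-a⌋ = 0 := by
  constructor
  · rintro ⟨k, rfl⟩
    rw [← Int.cast_neg, Int.floor_intCast, Int.floor_intCast]; ring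
  · intro h
    refine ⟨⌊a⌋, le_antisymm ?_ (Int.floor_le a)⟩
    have h1 := Int.floor_le (-a)
    have h2 : ⌊-a⌋ = -⌊a⌋ := by omega
    rw [h2] at h1
    push_cast at h1
    linarith

theorem mem_cr_iff_floor {f g : C(I, ℝ)} {x : I} :
    x ∈ cr f g ↔ ⌊f x - g x⌋ + ⌊g x - f x⌋ = 0 := by
  rw [mem_cr_iff, exists_int_eq_iff_floor, neg_sub]

/-- By compactness the norm is less than `1` as soon as all values are, and a strict upper bound by
an integer is a condition on the integer part. -/
theorem norm_sub_lt_one_iff {f g : C(I, ℝ)} :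
    ‖f - g‖ < 1 ↔ ∀ x, ⌊f x - g x⌋ ≤ 0 ∧ ⌊g x - f x⌋ ≤ 0 := by
  rw [ContinuousMap.norm_lt_iff _ one_pos]
  refine forall_congr' fun x => ?_
  rw [ContinuousMap.sub_apply, Real.norm_eq_abs, abs_lt, ← Int.lt_add_one_iff,
    ← Int.lt_add_one_iff, Int.floor_lt, Int.floor_lt]
  push_cast
  constructor <;> rintro ⟨h1, h2⟩ <;> constructor <;> linarith

/-- The value at a crossing is an integer, and `k ≤ u x` for an integer `k` only depends on `⌊u x⌋`.
Maxima are treated as minima of the opposite difference. -/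
theorem isLocalExtr_iff_floor {f g : C(I, ℝ)} {t : I} (ht : t ∈ cr f g) :
    IsLocalExtr (⇑(f - g)) t ↔ (∀ᶠ x in 𝓝 t, ⌊f t - g t⌋ ≤ ⌊f x - g x⌋) ∨
      ∀ᶠ x in 𝓝 t, ⌊g t - f t⌋ ≤ ⌊g x - f x⌋ := by
  obtain ⟨k, hk⟩ := mem_cr_iff.1 ht
  have hk' : g t - f t = ((-k : ℤ) : ℝ) := by push_cast; linarith
  unfold IsLocalExtr IsExtrFilter
  refine or_congr (eventually_congr (.of_forall fun x => ?_))
    (eventually_congr (.of_forall fun x => ?_))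
  · rw [Int.le_floor, hk, Int.floor_intCast]
    simp only [ContinuousMap.sub_apply, hk]
  · rw [Int.le_floor, hk', Int.floor_intCast]
    simp only [ContinuousMap.sub_apply, hk]
    push_cast
    constructor <;> intro h <;> linarith

/-- The order isomorphism `θ` of `[0,1]` matches the first components of the pairs in `s` with the
second components: all differences have the same integer parts. -/
def Matches (θ : I ≃o I) (s : Set (C(I, ℝ) × C(I, ℝ))) : Prop :=
  ∀ p ∈ s, ∀ q ∈ s, ∀ x, ⌊p.1 x - q.1 x⌋ = ⌊p.2 (θ x) - q.2 (θ x)⌋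

namespace Matches

variable {θ ψ : I ≃o I} {s : Set (C(I, ℝ) × C(I, ℝ))} {p q : C(I, ℝ) × C(I, ℝ)}

theorem symm (h : Matches θ s) : Matches θ.symm (Prod.swap '' s) := by
  rintro _ ⟨p, hp, rfl⟩ _ ⟨q, hq, rfl⟩ x
  simpa using (h p hp q hq (θ.symm x)).symm

/-- This exchanges an auxiliary counterpart `f'` of `f` for a better one `g`: `ψ` matches `f'` with
`g` and every member of `F` with itself, so the pairs in `s` are undisturbed. -/
theorem insert_trans {f f' g : C(I, ℝ)} {F : Set C(I, ℝ)} (h : Matches θ (insert (f, f') s))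
    (h' : Matches ψ (insert (f', g) ((fun h => (h, h)) '' F))) (hs : ∀ p ∈ s, p.2 ∈ F) :
    Matches (θ.trans ψ) (insert (f, g) s) := by
  have hmem : ∀ p ∈ s, (p.2, p.2) ∈ insert (f', g) ((fun h => (h, h)) '' F) :=
    fun p hp => mem_insert_of_mem _ ⟨_, hs p hp, rfl⟩
  rintro p (rfl | hp) q (rfl | hq) x
  · simp
  · exact (h _ (mem_insert _ _) _ (mem_insert_of_mem _ hq) x).trans
      (h' _ (mem_insert _ _) _ (hmem q hq) (θ x))
  · exact (h _ (mem_insert_of_mem _ hp) _ (mem_insert _ _) x).trans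
      (h' _ (hmem p hp) _ (mem_insert _ _) (θ x))
  · exact (h _ (mem_insert_of_mem _ hp) _ (mem_insert_of_mem _ hq) x).trans
      (h' _ (hmem p hp) _ (hmem q hq) (θ x))

theorem mem_cr (h : Matches θ s) (hp : p ∈ s) (hq : q ∈ s) {x : I} :
    x ∈ cr p.1 q.1 ↔ θ x ∈ cr p.2 q.2 := by
  rw [mem_cr_iff_floor, mem_cr_iff_floor, h p hp q hq, h q hq p hp]

theorem cr_eq (h : Matches θ s) (hp : p ∈ s) (hq : q ∈ s) :
    cr p.2 q.2 = θ '' cr p.1 q.1 := by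
  ext y
  constructor
  · intro hy
    exact ⟨θ.symm y, (h.mem_cr hp hq).2 (by simpa using hy), by simp⟩
  · rintro ⟨x, hx, rfl⟩
    exact (h.mem_cr hp hq).1 hx

theorem norm_sub_lt_one (h : Matches θ s) (hp : p ∈ s) (hq : q ∈ s) :
    ‖p.1 - q.1‖ < 1 ↔ ‖p.2 - q.2‖ < 1 := by
  rw [norm_sub_lt_one_iff, norm_sub_lt_one_iff, θ.surjective.forall (p := fun y =>
    ⌊p.2 y - q.2 y⌋ ≤ 0 ∧ ⌊q.2 y - p.2 y⌋ ≤ 0)]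
  simp only [h p hp q hq, h q hq p hp]

theorem eq_of_floor {f g : C(I, ℝ)} (h : ∀ x, ⌊f x - g x⌋ = 0 ∧ ⌊g x - f x⌋ = 0) : f = g := by
  ext x
  obtain ⟨h1, h2⟩ := h x
  have h1 := Int.floor_le (f x - g x)
  have h2 := Int.floor_le (g x - f x)
  simp_all only [Int.cast_zero]
  linarith

theorem snd_eq_of_fst_eq (h : Matches θ s) (hp : p ∈ s) (hq : q ∈ s) (e : p.1 = q.1) :
    p.2 = q.2 := by
  refine eq_of_floor fun y => ?_
  have h1 := h p hp q hq (θ.symm y)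
  have h2 := h q hq p hp (θ.symm y)
  simp only [e, sub_self, Int.floor_zero, OrderIso.apply_symm_apply] at h1 h2
  exact ⟨h1.symm, h2.symm⟩

theorem fst_eq_iff (h : Matches θ s) (hp : p ∈ s) (hq : q ∈ s) : p.1 = q.1 ↔ p.2 = q.2 :=
  ⟨h.snd_eq_of_fst_eq hp hq, fun e =>
    h.symm.snd_eq_of_fst_eq (mem_image_of_mem _ hp) (mem_image_of_mem _ hq) e⟩

theorem isLocalExtr (h : Matches θ s) (hp : p ∈ s) (hq : q ∈ s) {x : I} (hx : x ∈ cr p.1 q.1)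
    (H : IsLocalExtr (⇑(p.2 - q.2)) (θ x)) : IsLocalExtr (⇑(p.1 - q.1)) x := by
  rw [isLocalExtr_iff_floor ((h.mem_cr hp hq).1 hx), ← h p hp q hq, ← h q hq p hp] at H
  rw [isLocalExtr_iff_floor hx]
  have hθ : Tendsto θ (𝓝 x) (𝓝 (θ x)) := θ.continuous.tendsto x
  refine H.imp (fun H => (hθ.eventually H).mono fun y hy => ?_)
    fun H => (hθ.eventually H).mono fun y hy => ?_
  · rwa [← h p hp q hq] at hy
  · rwa [← h q hq p hp] at hy

/-- Every clause of transversality can be read off from integer parts of differences; the clauses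
about `0` and `1` also use that an increasing bijection fixes the endpoints. -/
theorem isTransverse (h : Matches θ s) (hs : IsTransverse (Prod.fst '' s)) :
    IsTransverse (Prod.snd '' s) where
  disjoint_cr := by
    rintro _ ⟨a, ha, rfl⟩ _ ⟨b, hb, rfl⟩ _ ⟨c, hc, rfl⟩ _ ⟨d, hd, rfl⟩ hab hcd hne
    rw [h.cr_eq ha hb, h.cr_eq hc hd, disjoint_image_iff θ.injective]
    refine hs.disjoint_cr _ (mem_image_of_mem _ ha) _ (mem_image_of_mem _ hb) _
      (mem_image_of_mem _ hc) _ (mem_image_of_mem _ hd) (fun e => hab ((h.fst_eq_iff ha hb).1 e))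
      (fun e => hcd ((h.fst_eq_iff hc hd).1 e)) ?_
    simpa only [ne_eq, Sym2.eq_iff, h.fst_eq_iff ha hc, h.fst_eq_iff hb hd, h.fst_eq_iff ha hd,
      h.fst_eq_iff hb hc] using hne
  finite_cr := by
    rintro _ ⟨a, ha, rfl⟩ _ ⟨b, hb, rfl⟩ hab
    rw [h.cr_eq ha hb]
    exact (hs.finite_cr _ (mem_image_of_mem _ ha) _ (mem_image_of_mem _ hb)
      (fun e => hab ((h.fst_eq_iff ha hb).1 e))).image _
  zero_notMem := by
    rintro _ ⟨a, ha, rfl⟩ _ ⟨b, hb, rfl⟩ hab h0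
    refine hs.zero_notMem _ (mem_image_of_mem _ ha) _ (mem_image_of_mem _ hb)
      (fun e => hab ((h.fst_eq_iff ha hb).1 e)) ((h.mem_cr ha hb).2 ?_)
    have : θ 0 = 0 := θ.map_bot
    rwa [this]
  one_notMem := by
    rintro _ ⟨a, ha, rfl⟩ _ ⟨b, hb, rfl⟩ hab h0
    refine hs.one_notMem _ (mem_image_of_mem _ ha) _ (mem_image_of_mem _ hb)
      (fun e => hab ((h.fst_eq_iff ha hb).1 e)) ((h.mem_cr ha hb).2 ?_)
    have : θ 1 = 1 := θ.map_top
    rwa [this]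
  not_isLocalExtr := by
    rintro _ ⟨a, ha, rfl⟩ _ ⟨b, hb, rfl⟩ hab t ht H
    obtain ⟨x, rfl⟩ := θ.surjective t
    have hx := (h.mem_cr ha hb).2 ht
    exact hs.not_isLocalExtr _ (mem_image_of_mem _ ha) _ (mem_image_of_mem _ hb)
      (fun e => hab ((h.fst_eq_iff ha hb).1 e)) x hx (h.isLocalExtr ha hb hx H)

end Matches

theorem SmoothRado.IsTransverse.mono {F G : Set C(I, ℝ)} (h : IsTransverse G) (hF : F ⊆ G) :
    IsTransverse F where
  disjoint_cr f hf g hg k hk l hl :=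
    h.disjoint_cr f (hF hf) g (hF hg) k (hF hk) l (hF hl)
  finite_cr f hf g hg := h.finite_cr f (hF hf) g (hF hg)
  zero_notMem f hf g hg := h.zero_notMem f (hF hf) g (hF hg)
  one_notMem f hf g hg := h.one_notMem f (hF hf) g (hF hg)
  not_isLocalExtr f hf g hg := h.not_isLocalExtr f (hF hf) g (hF hg)

/-- A continuous function with no integer value between `x` and `y` has constant integer part
there. -/
theorem floor_eq_of_forall_uIcc {u : I → ℝ} (hu : Continuous u) {x y : I}
    (h : ∀ z ∈ uIcc x y, ∀ k : ℤ, u z ≠ k) : ⌊u x⌋ = ⌊u y⌋ := by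
  by_contra hne
  wlog hlt : ⌊u x⌋ < ⌊u y⌋ generalizing x y
  · exact this (by rwa [uIcc_comm]) (Ne.symm hne) (lt_of_le_of_ne (not_lt.1 hlt) (Ne.symm hne))
  have hmem : ((⌊u y⌋ : ℤ) : ℝ) ∈ uIcc (u x) (u y) :=
    mem_uIcc.2 (.inl ⟨(Int.floor_lt.1 hlt).le, Int.floor_le _⟩)
  obtain ⟨z, hz, hzk⟩ := intermediate_value_uIcc hu.continuousOn hmem
  exact h z hz _ hzk

/-! ### Increasing bijections of the unit interval -/

/-- For `p ≤ p'` the bijection is the maximum of the identity and the smaller of the lines through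
`(l, l)`, `(p, p')` and through `(p, p')`, `(r, r)`. The inverse serves when `p' ≤ p`. -/
theorem exists_orderIso_move {l r : ℝ} {p p' : I} (hl0 : 0 ≤ l) (hr1 : r ≤ 1)
    (hlp : l < p) (hpr : (p : ℝ) < r) (hlp' : l < p') (hpr' : (p' : ℝ) < r) :
    ∃ ψ : I ≃o I, ψ p = p' ∧ ∀ x : I, (x : ℝ) ≤ l ∨ r ≤ x → ψ x = x := by
  wlog hpp : p ≤ p' generalizing p p'
  · obtain ⟨ψ, h1, h2⟩ := this hlp' hpr' hlp hpr (le_of_not_ge hpp)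
    refine ⟨ψ.symm, by rw [← h1]; simp, fun x hx => ?_⟩
    conv_lhs => rw [← h2 x hx]
    simp
  have hpp' : (p : ℝ) ≤ p' := hpp
  set A : ℝ := (p' - l) / (p - l) with hA
  set B : ℝ := (r - p') / (r - p) with hB
  have hA1 : 1 ≤ A := by rw [hA, one_le_div (by linarith)]; linarith
  have hB1 : B ≤ 1 := by rw [hB, div_le_one (by linarith)]; linarith
  have hB0 : 0 < B := div_pos (by linarith) (by linarith)
  have hAp : (p - l) * A = p' - l := mul_div_cancel₀ _ (by linarith)
  have hBp : (r - p) * B = r - p' := mul_div_cancel₀ _ (by linarith)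
  let m : ℝ → ℝ := fun x => max x (min (l + (x - l) * A) (r + (x - r) * B))
  have hm_low : ∀ x ≤ l, m x = x := fun x hx =>
    max_eq_left ((min_le_left _ _).trans (by nlinarith))
  have hm_high : ∀ x, r ≤ x → m x = x := fun x hx =>
    max_eq_left ((min_le_right _ _).trans (by nlinarith))
  have hm_mono : StrictMono m := fun x y hxy =>
    max_lt_max hxy (min_lt_min (by nlinarith) (by nlinarith))
  have hm_mem : ∀ x : I, m x ∈ I := fun x =>
    ⟨x.2.1.trans (le_max_left _ _), by
      rw [← hm_high 1 hr1]; exact hm_mono.monotone x.2.2⟩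
  let φ : I → I := fun x => ⟨m x, hm_mem x⟩
  have hφc : Continuous φ := by
    refine Continuous.subtype_mk ?_ _
    simp only [m]; fun_prop
  have hφm : StrictMono φ := fun x y hxy => hm_mono hxy
  have hφs : Function.Surjective φ := fun y =>
    mem_range_of_exists_le_of_exists_ge hφc
      ⟨0, Subtype.coe_le_coe.1 ((hm_low 0 hl0).le.trans y.2.1)⟩
      ⟨1, Subtype.coe_le_coe.1 (y.2.2.trans (hm_high 1 hr1).ge)⟩
  refine ⟨hφm.orderIsoOfSurjective φ hφs, Subtype.ext ?_, fun x hx => Subtype.ext ?_⟩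
  · change m p = p'
    have h1 : l + ((p : ℝ) - l) * A = p' := by linarith
    have h2 : r + ((p : ℝ) - r) * B = p' := by linarith
    simp only [m, h1, h2, min_self, max_eq_right hpp']
  · exact hx.elim (hm_low x) (hm_high x)

/-- Points are moved one at a time, each by a bijection that is the identity at distance at least
`δ` from the point. -/
theorem exists_orderIso_of_separated (P : Finset I) (τ : I → I) {δ : ℝ} (hδ : 0 < δ)
    (hsep : ∀ p ∈ P, ∀ q ∈ P, p ≠ q → 2 * δ ≤ |(p : ℝ) - q|)
    (h0 : ∀ p ∈ P, δ ≤ p) (h1 : ∀ p ∈ P, (p : ℝ) ≤ 1 - δ)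
    (hτ : ∀ p ∈ P, |(τ p : ℝ) - p| < δ) :
    ∃ ψ : I ≃o I, (∀ p ∈ P, ψ p = τ p) ∧ ∀ x : I, (∀ p ∈ P, δ ≤ |(x : ℝ) - p|) → ψ x = x := by
  classical
  induction P using Finset.induction_on with
  | empty => exact ⟨OrderIso.refl _, by simp, fun x _ => rfl⟩
  | insert p P hp ih =>
    simp only [Finset.mem_insert, forall_eq_or_imp] at hsep h0 h1 hτ
    obtain ⟨ψ, hψ1, hψ2⟩ := ih (fun a ha b hb => (hsep.2 a ha).2 b hb) h0.2 h1.2 hτ.2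
    have hτp := abs_lt.1 hτ.1
    obtain ⟨χ, hχ1, hχ2⟩ := exists_orderIso_move (l := p - δ) (r := p + δ) (p := p) (p' := τ p)
      (by linarith) (by linarith) (by linarith) (by linarith) (by linarith) (by linarith)
    have hχ3 : ∀ x : I, δ ≤ |(x : ℝ) - p| → χ x = x := fun x hx => hχ2 x <| by
      rcases le_abs.1 hx with h | h
      · right; linarith
      · left; linarith
    refine ⟨ψ.trans χ, ?_, ?_⟩
    · simp only [Finset.mem_insert, forall_eq_or_imp, OrderIso.trans_apply]
      refine ⟨?_, fun q hq => ?_⟩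
      · rw [hψ2 p fun q hq => ?_, hχ1]
        exact le_trans (by linarith) (hsep.1.2 q hq fun e => hp (e ▸ hq))
      · rw [hψ1 q hq]
        apply hχ3
        -- `τ q` is closer than `δ` to `q`, which is at least `2 * δ` from `p`, so the move around
        -- `p` leaves `τ q` fixed.
        have h2 := (hsep.2 q hq).1 fun e => hp (e ▸ hq)
        have h3 := abs_sub_abs_le_abs_sub ((q : ℝ) - p) (q - τ q)
        have h4 := hτ.2 q hq
        rw [abs_sub_comm] at h4
        have h5 : (q : ℝ) - p - (q - τ q) = τ q - p := by ring
        rw [h5] at h3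
        linarith
    · intro x hx
      simp only [Finset.mem_insert, forall_eq_or_imp] at hx
      rw [OrderIso.trans_apply, hψ2 x hx.2, hχ3 x hx.1]

theorem exists_pos_forall_le {ι : Type*} {S : Set ι} (hS : S.Finite) {f : ι → ℝ}
    (hpos : ∀ s ∈ S, 0 < f s) : ∃ δ > 0, ∀ s ∈ S, δ ≤ f s := by
  rcases S.eq_empty_or_nonempty with rfl | hne
  · exact ⟨1, one_pos, by simp⟩
  · obtain ⟨m, hm, hmin⟩ := Set.exists_min_image S f hS hne
    exact ⟨f m, hpos m hm, hmin⟩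

/-- A finite set of points of `(0,1)` is separated. -/
theorem exists_separation {P : Set I} (hP : P.Finite) (h0 : 0 ∉ P) (h1 : 1 ∉ P) :
    ∃ δ₀ > 0, ∀ δ ≤ δ₀, (∀ p ∈ P, ∀ q ∈ P, p ≠ q → 2 * δ ≤ |(p : ℝ) - q|) ∧
      (∀ p ∈ P, δ ≤ (p : ℝ)) ∧ ∀ p ∈ P, (p : ℝ) ≤ 1 - δ := by
  obtain ⟨d1, hd1, H1⟩ := exists_pos_forall_le hP.offDiag
    (f := fun z : I × I => |(z.1 : ℝ) - z.2|)
    (fun z hz => abs_pos.2 (sub_ne_zero.2 fun e => hz.2.2 (Subtype.ext e)))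
  obtain ⟨d2, hd2, H2⟩ := exists_pos_forall_le hP (f := fun z : I => (z : ℝ)) fun a ha =>
    lt_of_le_of_ne a.2.1 fun e => h0 (by rwa [show (0 : I) = a from Subtype.ext e])
  obtain ⟨d3, hd3, H3⟩ := exists_pos_forall_le hP (f := fun z : I => 1 - (z : ℝ)) fun a ha =>
    sub_pos.2 <| lt_of_le_of_ne a.2.2
      fun e => h1 (by rwa [show (1 : I) = a from Subtype.ext e.symm])
  refine ⟨min (d1 / 2) (min d2 d3), by positivity, fun δ hδ => ?_⟩
  simp only [le_min_iff] at hδ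
  refine ⟨fun p hp q hq hpq => ?_, fun p hp => ?_, fun p hp => ?_⟩
  · have := H1 (p, q) ⟨hp, hq, hpq⟩
    simp only at this
    linarith
  · linarith [H2 p hp]
  · linarith [H3 p hp]

/-! ### Approximations with close crossings are matched -/

theorem exists_dist_int_pos {X : Type*} [TopologicalSpace X] {C : Set X} (hC : IsCompact C)
    {u : X → ℝ} (hu : ContinuousOn u C) (h : ∀ x ∈ C, ∀ k : ℤ, u x ≠ k) :
    ∃ η > 0, ∀ x ∈ C, ∀ k : ℤ, η ≤ |u x - k| := by
  have hne : (range ((↑) : ℤ → ℝ)).Nonempty := range_nonempty _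
  rcases C.eq_empty_or_nonempty with rfl | hCne
  · exact ⟨1, one_pos, by simp⟩
  obtain ⟨x₀, hx₀, hmin⟩ := hC.exists_isMinOn hCne
    ((Metric.continuous_infDist_pt (range ((↑) : ℤ → ℝ))).comp_continuousOn hu)
  refine ⟨_, (Int.isClosedEmbedding_coe_real.isClosed_range.notMem_iff_infDist_pos hne).1
    (fun ⟨k, hk⟩ => h x₀ hx₀ k hk.symm), fun x hx k => ?_⟩
  exact (isMinOn_iff.1 hmin x hx).trans (Metric.infDist_le_dist_of_mem (mem_range_self k))

theorem floor_eq_of_abs_sub_lt {a b η : ℝ} (ha : ∀ k : ℤ, η ≤ |a - k|) (hab : |a - b| < η) :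
    ⌊a⌋ = ⌊b⌋ := by
  have h1 := ha ⌊a⌋
  have h2 := ha (⌊a⌋ + 1)
  have h3 := Int.floor_le a
  have h4 := Int.lt_floor_add_one a
  rw [abs_of_nonneg (by linarith)] at h1
  rw [abs_of_nonpos (by push_cast; linarith)] at h2
  push_cast at h2
  rw [abs_lt] at hab
  exact (Int.floor_eq_iff.2 ⟨by linarith, by linarith⟩).symm

theorem ne_int_of_abs_sub_lt {a b η : ℝ} (ha : ∀ k : ℤ, η ≤ |a - k|) (hab : |a - b| < η) (k : ℤ) :
    b ≠ k := by
  rintro rfl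
  exact absurd hab (not_lt.2 (ha k))

theorem SmoothRado.SimWithin.exists_bijOn {ε : ℝ} {A B : Set I} (h : SimWithin ε A B) :
    ∃ ρ : I → I, BijOn ρ A B ∧ ∀ p ∈ A, |(ρ p : ℝ) - p| < ε := by
  obtain ⟨n, a, b, ha, hb, rfl, rfl, hd⟩ := h
  have hl : ∀ i, Function.extend a b id (a i) = b i := fun i => ha.injective.extend_apply b id i
  refine ⟨Function.extend a b id, ⟨?_, ?_, ?_⟩, ?_⟩
  · rintro _ ⟨i, rfl⟩
    exact ⟨i, (hl i).symm⟩
  · rintro _ ⟨i, rfl⟩ _ ⟨j, rfl⟩ e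
    rw [hl, hl] at e
    rw [hb.injective e]
  · rintro _ ⟨i, rfl⟩
    exact ⟨a i, mem_range_self i, hl i⟩
  · rintro _ ⟨i, rfl⟩
    rw [hl, ← Real.dist_eq, dist_comm]
    exact hd i

/-- Here `u` and `v` stand for the differences `f - h` and `g - h`. The integer parts agree away
from `P`, where `ψ` is the identity, and they stay constant while no integer value is met. Integer
values themselves are identified from the integer parts at neighbouring points. -/
theorem floor_eq_floor_comp {P : Set I} {δ : ℝ} (hδ : 0 < δ)
    (hsep : ∀ p ∈ P, ∀ q ∈ P, p ≠ q → 2 * δ ≤ |(p : ℝ) - q|)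
    (h0 : ∀ p ∈ P, δ ≤ (p : ℝ)) (h1 : ∀ p ∈ P, (p : ℝ) ≤ 1 - δ) {ψ : I ≃o I}
    (hψ : ∀ x : I, (∀ p ∈ P, δ ≤ |(x : ℝ) - p|) → ψ x = x) {u v : I → ℝ}
    (hu : Continuous u) (hv : Continuous v) (hP : ∀ x, (∃ k : ℤ, u x = k) → x ∈ P)
    (huv : ∀ x, (∃ k : ℤ, u x = k) ↔ ∃ k : ℤ, v (ψ x) = k)
    (hext : ∀ x, (∃ k : ℤ, u x = k) → ¬ IsLocalExtr u x)
    (hfar : ∀ x : I, (∀ p ∈ P, δ ≤ |(x : ℝ) - p|) → ⌊u x⌋ = ⌊v x⌋) (x : I) :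
    ⌊u x⌋ = ⌊v (ψ x)⌋ := by
  have hvψ : Continuous (v ∘ ψ) := hv.comp ψ.continuous
  have main : ∀ x, (¬ ∃ k : ℤ, u x = k) → ⌊u x⌋ = ⌊v (ψ x)⌋ := by
    intro x hx
    -- A point near `p ∈ P` is slid away from `p`, on its own side, to the end `p ± δ`; only `p`
    -- itself could carry an integer value on the way.
    obtain ⟨z, hz, hxz⟩ : ∃ z : I, (∀ p ∈ P, δ ≤ |(z : ℝ) - p|) ∧
        ∀ y ∈ uIcc x z, ¬ ∃ k : ℤ, u y = k := by
      by_cases hfx : ∀ p ∈ P, δ ≤ |(x : ℝ) - p|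
      · exact ⟨x, hfx, by simpa using hx⟩
      · push Not at hfx
        obtain ⟨p, hp, hpx⟩ := hfx
        have hnear : ∀ y : I, |(y : ℝ) - p| ≤ δ → (∃ k : ℤ, u y = k) → y = p := by
          intro y hy hk
          by_contra hne
          have := hsep y (hP y hk) p hp hne
          linarith
        have hz : ∀ z : I, |(z : ℝ) - p| = δ → ∀ q ∈ P, δ ≤ |(z : ℝ) - q| := by
          intro z hz q hq
          by_cases e : p = q
          · rw [← e, hz]
          · have h3 := hsep p hp q hq e
            have h4 := abs_sub_le (p : ℝ) z q
            rw [abs_sub_comm (p : ℝ) z] at h4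
            linarith
        have hp0 := h0 p hp
        have hp1 := h1 p hp
        rw [abs_lt] at hpx
        rcases le_total p x with h | h
        · have h' : (p : ℝ) ≤ x := h
          obtain ⟨z, hzp⟩ : ∃ z : I, (z : ℝ) = p + δ :=
            ⟨⟨p + δ, ⟨by linarith, by linarith⟩⟩, rfl⟩
          refine ⟨z, hz _ (by simp [hzp, abs_of_pos hδ]), ?_⟩
          intro y hy hk
          have hxz : x ≤ z := Subtype.coe_le_coe.1 (by linarith)
          rw [uIcc_of_le hxz] at hy
          have hy1 : (x : ℝ) ≤ y := hy.1
          have hy2 : (y : ℝ) ≤ p + δ := hzp ▸ hy.2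
          have := hnear y (by rw [abs_le]; constructor <;> linarith) hk
          subst this
          exact hx (by rwa [le_antisymm hy.1 h])
        · have h' : (x : ℝ) ≤ p := h
          obtain ⟨z, hzp⟩ : ∃ z : I, (z : ℝ) = p - δ :=
            ⟨⟨p - δ, ⟨by linarith, by linarith⟩⟩, rfl⟩
          refine ⟨z, hz _ (by simp [hzp, abs_of_pos hδ]), ?_⟩
          intro y hy hk
          have hxz : z ≤ x := Subtype.coe_le_coe.1 (by linarith)
          rw [uIcc_of_ge hxz] at hy
          have hy1 : (y : ℝ) ≤ x := hy.2
          have hy2 : (p : ℝ) - δ ≤ y := hzp ▸ hy.1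
          have := hnear y (by rw [abs_le]; constructor <;> linarith) hk
          subst this
          exact hx (by rwa [le_antisymm h hy.2])
    calc ⌊u x⌋ = ⌊u z⌋ := floor_eq_of_forall_uIcc hu fun y hy k hk => hxz y hy ⟨k, hk⟩
      _ = ⌊v z⌋ := hfar z hz
      _ = ⌊v (ψ z)⌋ := by rw [hψ z hz]
      _ = ⌊v (ψ x)⌋ := (floor_eq_of_forall_uIcc hvψ fun y hy k hk =>
          hxz y hy ((huv y).2 ⟨k, hk⟩)).symm
  by_cases hx : ∃ k : ℤ, u x = k
  · obtain ⟨k, hk⟩ := hx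
    obtain ⟨k', hk'⟩ := (huv x).1 ⟨k, hk⟩
    -- Since `x` is not an extremum, `u` takes values just below and just above `k` nearby. Integer
    -- parts `k - 1` and `k` must then both lie in `{k' - 1, k'}`, so `k = k'`.
    have hex := hext x ⟨k, hk⟩
    unfold IsLocalExtr IsExtrFilter at hex
    push Not at hex
    have hnear : ∀ {w : I → ℝ} {c : ℝ}, Continuous w → w x = c →
        ∀ᶠ y in 𝓝 x, c - 1 < w y ∧ w y < c + 1 := by
      intro w c hw hc
      exact (hw.tendsto x).eventually (Ioo_mem_nhds (by linarith) (by linarith))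
    have hn := (hnear hu hk).and (hnear hvψ hk')
    obtain ⟨y, hy, hyk, hyk'⟩ := ((not_eventually.1 hex.1).and_eventually hn).exists
    obtain ⟨z, hz, hzk, hzk'⟩ := ((not_eventually.1 hex.2).and_eventually hn).exists
    simp only [Function.comp_apply, hk, not_le] at hy hz hyk' hzk'
    have fl : ∀ {y : I} {a b : ℤ}, ⌊u y⌋ = a → ((a : ℝ) < u y) → u y < a + 1 →
        (b : ℝ) - 1 < v (ψ y) → v (ψ y) < b + 1 → a = b - 1 ∨ a = b := by
      intro y a b ha h1 h2 h3 h4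
      have hy : ¬ ∃ k : ℤ, u y = k := by
        rintro ⟨c, hc⟩
        rw [hc] at h1 h2
        norm_cast at h1 h2
        omega
      rw [main y hy] at ha
      have h5 := Int.floor_le (v (ψ y))
      have h6 := Int.lt_floor_add_one (v (ψ y))
      rw [ha] at h5 h6
      have h7 : a < b + 1 := by exact_mod_cast h5.trans_lt h4
      have h8 : b - 1 < a + 1 := by exact_mod_cast h3.trans h6
      omega
    have c1 := fl (y := y) (a := k - 1) (b := k')
      (Int.floor_eq_iff.2 ⟨by push_cast; linarith, by push_cast; linarith⟩)
      (by push_cast; linarith) (by push_cast; linarith) hyk'.1 hyk'.2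
    have c2 := fl (y := z) (a := k) (b := k')
      (Int.floor_eq_iff.2 ⟨by linarith, by linarith⟩) hz hzk.2 hzk'.1 hzk'.2
    rw [hk, hk', Int.floor_intCast, Int.floor_intCast]
    omega
  · exact main x hx

/-- The bound `ε` is smaller than the separation of all crossings and than the distance of the
differences `f - h` from the integers away from the crossings. The homeomorphism sends crossings of
`f` with `h` to those of `g` with `h` and fixes crossings inside `F`; these demands are compatible
because different pairs have disjoint crossings. -/
theorem SmoothRado.IsTransverse.exists_matches {F : Set C(I, ℝ)} (hF : F.Finite) {f : C(I, ℝ)}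
    (hf : f ∉ F) (hT : IsTransverse (insert f F)) :
    ∃ ε > 0, ∀ g : C(I, ℝ), ‖f - g‖ < ε → (∀ h ∈ F, SimWithin ε (cr f h) (cr g h)) →
      ∃ ψ : I ≃o I, Matches ψ (insert (f, g) ((fun h => (h, h)) '' F)) := by
  classical
  have hne : ∀ h ∈ F, f ≠ h := fun h hh e => hf (e ▸ hh)
  have mf : f ∈ insert f F := mem_insert _ _
  have mF : ∀ h ∈ F, h ∈ insert f F := fun h => mem_insert_of_mem f
  set P : Set I := ⋃ z ∈ (insert f F).offDiag, cr z.1 z.2 with hPdef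
  have hPfin : P.Finite := (hF.insert f).offDiag.biUnion fun z hz =>
    hT.finite_cr _ hz.1 _ hz.2.1 hz.2.2
  have hPmem : ∀ {a b : C(I, ℝ)}, a ∈ insert f F → b ∈ insert f F → a ≠ b → cr a b ⊆ P :=
    fun {a b} ha hb hab => subset_biUnion_of_mem (u := fun z : C(I, ℝ) × C(I, ℝ) => cr z.1 z.2)
      (show (a, b) ∈ (insert f F).offDiag from ⟨ha, hb, hab⟩)
  obtain ⟨δ, hδ, hsep⟩ := exists_separation hPfin
    (by simp only [hPdef, mem_iUnion, not_exists]
        exact fun z hz => hT.zero_notMem _ hz.1 _ hz.2.1 hz.2.2)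
    (by simp only [hPdef, mem_iUnion, not_exists]
        exact fun z hz => hT.one_notMem _ hz.1 _ hz.2.1 hz.2.2)
  obtain ⟨hsep, h0, h1⟩ := hsep δ le_rfl
  set C : Set I := {x | ∀ p ∈ P, δ ≤ |(x : ℝ) - p|} with hC
  have hCc : IsCompact C := by
    apply IsClosed.isCompact
    simp only [hC, ofPred_forall]
    exact isClosed_iInter fun p => isClosed_iInter fun _ =>
      isClosed_le continuous_const (by fun_prop)
  have hCP : ∀ x ∈ C, x ∉ P := fun x hx hxP => by
    have := hx x hxP
    simp only [sub_self, abs_zero] at this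
    linarith
  have hη : ∀ h ∈ F, ∃ η > 0, ∀ x ∈ C, ∀ k : ℤ, η ≤ |f x - h x - k| := fun h hh =>
    exists_dist_int_pos hCc (by fun_prop) fun x hx k hk =>
      hCP x hx (hPmem mf (mF h hh) (hne h hh) (mem_cr_iff.2 ⟨k, hk⟩))
  choose! η hη0 hη using hη
  obtain ⟨ε, hε, hεη⟩ := exists_pos_forall_le hF hη0
  refine ⟨min ε δ, by positivity, fun g hfg hsim => ?_⟩
  choose! ρ hρ hρd using fun h hh => (hsim h hh).exists_bijOn
  -- Disjointness of the crossings makes `h` unique for a given `p`, so the choice is harmless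
  -- (`hτ`).
  let τ : I → I := fun p => if H : ∃ h ∈ F, p ∈ cr f h then ρ H.choose p else p
  have hτ : ∀ h ∈ F, ∀ p ∈ cr f h, τ p = ρ h p := by
    intro h hh p hp
    have H : ∃ h ∈ F, p ∈ cr f h := ⟨h, hh, hp⟩
    have : H.choose = h := by
      by_contra hne'
      refine disjoint_left.1 (hT.disjoint_cr f mf _ (mF _ H.choose_spec.1) f mf h (mF h hh)
        (hne _ H.choose_spec.1) (hne h hh) ?_) H.choose_spec.2 hp
      simp only [ne_eq, Sym2.eq_iff]
      rintro (⟨-, e⟩ | ⟨e, -⟩)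
      · exact hne' e
      · exact hne h hh e
    simp only [τ, dif_pos H, this]
  have hτid : ∀ h₁ ∈ F, ∀ h₂ ∈ F, h₁ ≠ h₂ → ∀ p ∈ cr h₁ h₂, τ p = p := by
    intro h₁ hh₁ h₂ hh₂ h12 p hp
    refine dif_neg ?_
    rintro ⟨h, hh, hph⟩
    refine disjoint_left.1 (hT.disjoint_cr f mf h (mF h hh) h₁ (mF _ hh₁) h₂ (mF _ hh₂)
      (hne h hh) h12 ?_) hph hp
    simp only [ne_eq, Sym2.eq_iff]
    rintro (⟨e, -⟩ | ⟨e, -⟩)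
    · exact hne _ hh₁ e
    · exact hne _ hh₂ e
  obtain ⟨ψ, hψ1, hψ2⟩ := exists_orderIso_of_separated hPfin.toFinset τ hδ
    (by simpa using hsep) (by simpa using h0) (by simpa using h1) (by
      intro p _
      by_cases H : ∃ h ∈ F, p ∈ cr f h
      · obtain ⟨h, hh, hp⟩ := H
        rw [hτ h hh p hp]
        exact (hρd h hh p hp).trans_le (min_le_right _ _)
      · simp only [τ, dif_neg H, sub_self, abs_zero, hδ])
  simp only [hPfin.mem_toFinset] at hψ1 hψ2
  have hcrg : ∀ h ∈ F, ∀ x, x ∈ cr f h ↔ ψ x ∈ cr g h := by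
    intro h hh x
    have hx : ∀ y ∈ cr f h, ψ y = ρ h y := fun y hy => by
      rw [hψ1 y (hPmem mf (mF h hh) (hne h hh) hy), hτ h hh y hy]
    constructor
    · intro h2
      rw [hx x h2]
      exact (hρ h hh).mapsTo h2
    · intro h2
      obtain ⟨y, hy, hyx⟩ := (hρ h hh).surjOn h2
      rw [← hx y hy] at hyx
      rwa [← ψ.injective hyx]
  have hcrF : ∀ h₁ ∈ F, ∀ h₂ ∈ F, h₁ ≠ h₂ → ∀ x, x ∈ cr h₁ h₂ ↔ ψ x ∈ cr h₁ h₂ := by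
    intro h₁ hh₁ h₂ hh₂ h12 x
    have hx : ∀ y ∈ cr h₁ h₂, ψ y = y := fun y hy => by
      rw [hψ1 y (hPmem (mF _ hh₁) (mF _ hh₂) h12 hy), hτid h₁ hh₁ h₂ hh₂ h12 y hy]
    constructor
    · intro h2
      rwa [hx x h2]
    · intro h2
      rwa [← ψ.injective (hx _ h2)]
  have hfar : ∀ h ∈ F, ∀ x ∈ C, ⌊f x - h x⌋ = ⌊g x - h x⌋ ∧ ⌊h x - f x⌋ = ⌊h x - g x⌋ := by
    intro h hh x hx
    have h1 : |f x - g x| < ε := ((f - g).norm_coe_le_norm x).trans_lt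
      (hfg.trans_le (min_le_left _ _))
    have h2 : ∀ k : ℤ, ε ≤ |f x - h x - k| := fun k => (hεη h hh).trans (hη h hh x hx k)
    refine ⟨floor_eq_of_abs_sub_lt h2 (by convert h1 using 2; ring),
      floor_eq_of_abs_sub_lt (fun k => ?_) (b := h x - g x) (by
        rw [abs_sub_comm]; convert h1 using 2; ring)⟩
    have := h2 (-k)
    rw [abs_sub_comm] at this
    convert this using 2
    push_cast; ring
  refine ⟨ψ, ?_⟩
  rintro p hp q hq x
  simp only [mem_insert_iff, mem_image] at hp hq
  rcases hp with rfl | ⟨h₁, hh₁, rfl⟩ <;> rcases hq with rfl | ⟨h₂, hh₂, rfl⟩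
  · simp
  · refine floor_eq_floor_comp hδ hsep h0 h1 hψ2 (u := fun x => f x - h₂ x)
      (v := fun x => g x - h₂ x) (by fun_prop) (by fun_prop) ?_ ?_ ?_ ?_ x
    · exact fun x hx => hPmem mf (mF _ hh₂) (hne _ hh₂) (mem_cr_iff.2 hx)
    · intro x
      rw [← mem_cr_iff, ← mem_cr_iff]
      exact hcrg _ hh₂ x
    · exact fun x hx => hT.not_isLocalExtr f mf _ (mF _ hh₂) (hne _ hh₂) x (mem_cr_iff.2 hx)
    · exact fun x hx => (hfar _ hh₂ x hx).1
  · refine floor_eq_floor_comp hδ hsep h0 h1 hψ2 (u := fun x => h₁ x - f x)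
      (v := fun x => h₁ x - g x) (by fun_prop) (by fun_prop) ?_ ?_ ?_ ?_ x
    · exact fun x hx => hPmem (mF _ hh₁) mf (hne _ hh₁).symm (mem_cr_iff.2 hx)
    · intro x
      rw [← mem_cr_iff, ← mem_cr_iff, cr_comm h₁, cr_comm h₁]
      exact hcrg _ hh₁ x
    · exact fun x hx => hT.not_isLocalExtr _ (mF _ hh₁) f mf (hne _ hh₁).symm x (mem_cr_iff.2 hx)
    · exact fun x hx => (hfar _ hh₁ x hx).2
  · by_cases h12 : h₁ = h₂
    · simp [h12]
    · refine floor_eq_floor_comp hδ hsep h0 h1 hψ2 (u := fun x => h₁ x - h₂ x)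
        (v := fun x => h₁ x - h₂ x) (by fun_prop) (by fun_prop) ?_ ?_ ?_ (fun _ _ => rfl) x
      · exact fun x hx => hPmem (mF _ hh₁) (mF _ hh₂) h12 (mem_cr_iff.2 hx)
      · intro x
        rw [← mem_cr_iff, ← mem_cr_iff]
        exact hcrF _ hh₁ _ hh₂ h12 x
      · exact fun x hx => hT.not_isLocalExtr _ (mF _ hh₁) _ (mF _ hh₂) h12 x (mem_cr_iff.2 hx)

/-! ### Extending a matching by one function -/

theorem eventually_floor_eq {X : Type*} [TopologicalSpace X] {w : X → ℝ} {y₀ : X}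
    (hw : ContinuousAt w y₀) (h : ∀ k : ℤ, w y₀ ≠ k) : ∀ᶠ y in 𝓝 y₀, ⌊w y⌋ = ⌊w y₀⌋ := by
  have h1 : (⌊w y₀⌋ : ℝ) < w y₀ := lt_of_le_of_ne (Int.floor_le _) (h _).symm
  filter_upwards [hw.eventually (Ioo_mem_nhds h1 (Int.lt_floor_add_one _))] with y hy
  exact Int.floor_eq_iff.2 ⟨hy.1.le, hy.2⟩

/-- The admissible values of the new function at a point `y` form an order-convex set, so continuous
local solutions can be glued. At a crossing with a member of the family a local solution copies the
difference to that member; elsewhere a constant will do. -/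
theorem Matches.exists_insert {s : Set (C(I, ℝ) × C(I, ℝ))} {θ : I ≃o I} (hs : s.Finite)
    (hθ : Matches θ s) {f : C(I, ℝ)} (hf : ∀ p ∈ s, f ≠ p.1)
    (hT : IsTransverse (insert f (Prod.fst '' s))) :
    ∃ f' : C(I, ℝ), Matches θ (insert (f, f') s) := by
  classical
  let ok : C(I, ℝ) × C(I, ℝ) → I → ℝ → Prop := fun p y z =>
    ⌊z - p.2 y⌋ = ⌊f (θ.symm y) - p.1 (θ.symm y)⌋ ∧
      ⌊p.2 y - z⌋ = ⌊p.1 (θ.symm y) - f (θ.symm y)⌋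
  have mf : f ∈ insert f (Prod.fst '' s) := mem_insert _ _
  have ms : ∀ p ∈ s, p.1 ∈ insert f (Prod.fst '' s) :=
    fun p hp => mem_insert_of_mem _ (mem_image_of_mem _ hp)
  obtain ⟨f', hf'⟩ := exists_continuous_forall_mem_convex_of_local
    (t := fun y => {z : ℝ | ∀ p ∈ s, ok p y z}) (fun y => by
      refine OrdConnected.convex ⟨fun a ha b hb c hc p hp => ⟨le_antisymm ?_ ?_, le_antisymm ?_ ?_⟩⟩
      · rw [← (hb p hp).1]; exact Int.floor_mono (by linarith [hc.2])
      · rw [← (ha p hp).1]; exact Int.floor_mono (by linarith [hc.1])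
      · rw [← (ha p hp).2]; exact Int.floor_mono (by linarith [hc.1])
      · rw [← (hb p hp).2]; exact Int.floor_mono (by linarith [hc.2])) (fun y₀ => by
      set x₀ := θ.symm y₀ with hx₀
      have hloc : ∀ (g : I → ℝ), Continuous g → ∀ p ∈ s, x₀ ∉ cr f p.1 → ok p y₀ (g y₀) →
          ∀ᶠ y in 𝓝 y₀, ok p y (g y) := by
        intro g hg p hp hx hok
        have hni : ∀ k : ℤ, f x₀ - p.1 x₀ ≠ k := fun k hk => hx (mem_cr_iff.2 ⟨k, hk⟩)
        have hni' : ∀ k : ℤ, p.1 x₀ - f x₀ ≠ k := fun k hk =>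
          hni (-k) (by push_cast; linarith)
        have hgn : ∀ k : ℤ, g y₀ - p.2 y₀ ≠ k := by
          intro k hk
          refine hx (mem_cr_iff_floor.2 ?_)
          rw [← hok.1, ← hok.2, ← neg_sub (g y₀)]
          exact exists_int_eq_iff_floor.1 ⟨k, hk⟩
        have hgn' : ∀ k : ℤ, p.2 y₀ - g y₀ ≠ k := fun k hk =>
          hgn (-k) (by push_cast; linarith)
        have hθc := θ.symm.continuous
        filter_upwards [eventually_floor_eq (w := fun y => f (θ.symm y) - p.1 (θ.symm y))
            (by fun_prop) hni, eventually_floor_eq (w := fun y => p.1 (θ.symm y) - f (θ.symm y))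
            (by fun_prop) hni', eventually_floor_eq (w := fun y => g y - p.2 y)
            (by fun_prop) hgn, eventually_floor_eq (w := fun y => p.2 y - g y)
            (by fun_prop) hgn'] with y h1 h2 h3 h4
        exact ⟨by rw [h1, h3, hok.1], by rw [h2, h4, hok.2]⟩
      suffices H : ∃ g : I → ℝ, Continuous g ∧ ∀ p ∈ s, ∀ᶠ y in 𝓝 y₀, ok p y (g y) by
        obtain ⟨g, hg, H⟩ := H
        exact ⟨_, (eventually_all_finite hs).2 H, g, hg.continuousOn, fun y hy => hy⟩
      by_cases hcross : ∃ p ∈ s, x₀ ∈ cr f p.1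
      · obtain ⟨p, hp, hxp⟩ := hcross
        have hθc := θ.symm.continuous
        have hgc : Continuous fun y => p.2 y + (f (θ.symm y) - p.1 (θ.symm y)) := by fun_prop
        refine ⟨_, hgc, fun q hq => ?_⟩
        by_cases hqp : q.1 = p.1
        · have hqp2 := hθ.snd_eq_of_fst_eq hq hp hqp
          refine .of_forall fun y => ⟨?_, ?_⟩
          · rw [hqp2, hqp]; congr 1; ring
          · rw [hqp2, hqp]; congr 1; ring
        -- Crossings with different functions are disjoint, so relative to `q` the values at `x₀`
        -- are not integers and the integer parts are locally constant.
        · have hxq : x₀ ∉ cr f q.1 := fun hxq => by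
            refine disjoint_left.1 (hT.disjoint_cr f mf _ (ms q hq) f mf _ (ms p hp)
              (hf q hq) (hf p hp) ?_) hxq hxp
            simp only [ne_eq, Sym2.eq_iff]
            rintro (⟨-, e⟩ | ⟨e, -⟩)
            · exact hqp e
            · exact hf p hp e
          refine hloc _ hgc q hq hxq ?_
          obtain ⟨k, hk⟩ := mem_cr_iff.1 hxp
          have e1 := hθ p hp q hq x₀
          have e2 := hθ q hq p hp x₀
          rw [hx₀, OrderIso.apply_symm_apply, ← hx₀] at e1 e2
          simp only [ok, ← hx₀, hk]
          constructor
          · rw [show p.2 y₀ + (k : ℝ) - q.2 y₀ = p.2 y₀ - q.2 y₀ + k by ring,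
              show f x₀ - q.1 x₀ = p.1 x₀ - q.1 x₀ + k by rw [← hk]; ring,
              Int.floor_add_intCast, Int.floor_add_intCast, e1]
          · rw [show q.2 y₀ - (p.2 y₀ + (k : ℝ)) = q.2 y₀ - p.2 y₀ - k by ring,
              show q.1 x₀ - f x₀ = q.1 x₀ - p.1 x₀ - k by rw [← hk]; ring,
              Int.floor_sub_intCast, Int.floor_sub_intCast, e2]
      · push Not at hcross
        have hlt : ∀ p ∈ s, (⌊f x₀ - p.1 x₀⌋ : ℝ) < f x₀ - p.1 x₀ := fun p hp =>
          lt_of_le_of_ne (Int.floor_le _) fun e => hcross p hp (mem_cr_iff.2 ⟨_, e.symm⟩)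
        -- The admissible constants form an intersection of open intervals of length `1`, so it
        -- suffices to compare lower ends with upper ends. This comparison bounds `p.2 y₀ - q.2 y₀`
        -- strictly by an integer, a condition on the integer part, which may be checked for `p.1 x₀
        -- - q.1 x₀`.
        obtain ⟨z, hz1, hz2⟩ := Order.exists_between_finsets
          (hs.toFinset.image fun p => p.2 y₀ + (⌊f x₀ - p.1 x₀⌋ : ℝ))
          (hs.toFinset.image fun p => p.2 y₀ + (⌊f x₀ - p.1 x₀⌋ : ℝ) + 1) (by
            simp only [Finset.mem_image, Finite.mem_toFinset]
            rintro _ ⟨p, hp, rfl⟩ _ ⟨q, hq, rfl⟩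
            have e1 := hθ p hp q hq x₀
            rw [hx₀, OrderIso.apply_symm_apply, ← hx₀] at e1
            have h1 := hlt p hp
            have h2 := Int.lt_floor_add_one (f x₀ - q.1 x₀)
            have h3 : ⌊p.1 x₀ - q.1 x₀⌋ < ⌊f x₀ - q.1 x₀⌋ + 1 - ⌊f x₀ - p.1 x₀⌋ := by
              rw [Int.floor_lt]; push_cast; linarith
            rw [e1, Int.floor_lt] at h3
            push_cast at h3
            linarith)
        simp only [Finset.mem_image, Finite.mem_toFinset, forall_exists_index, and_imp,
          forall_apply_eq_imp_iff₂] at hz1 hz2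
        refine ⟨fun _ => z, continuous_const, fun p hp => hloc _ continuous_const p hp
          (hcross p hp) ?_⟩
        have h1 := hz1 p hp
        have h2 := hz2 p hp
        have h3 := hlt p hp
        have h4 := Int.lt_floor_add_one (f x₀ - p.1 x₀)
        refine ⟨Int.floor_eq_iff.2 ⟨by linarith, by linarith⟩, ?_⟩
        simp only [← hx₀]
        have e1 : ⌊p.2 y₀ - z⌋ = -⌊f x₀ - p.1 x₀⌋ - 1 :=
          Int.floor_eq_iff.2 ⟨by push_cast; linarith, by push_cast; linarith⟩
        have e2 : ⌊p.1 x₀ - f x₀⌋ = -⌊f x₀ - p.1 x₀⌋ - 1 :=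
          Int.floor_eq_iff.2 ⟨by push_cast; linarith, by push_cast; linarith⟩
        rw [e1, e2])
  refine ⟨f', ?_⟩
  rintro p hp q hq x
  rcases hp with rfl | hp <;> rcases hq with rfl | hq
  · simp
  · simpa using (hf' (θ x) q hq).1.symm
  · simpa using (hf' (θ x) p hp).2.symm
  · exact hθ p hp q hq x

theorem SmoothRado.SimWithin.mono {ε ε' : ℝ} {A B : Set I} (h : SimWithin ε A B) (hε : ε ≤ ε') :
    SimWithin ε' A B := by
  obtain ⟨n, a, b, ha, hb, hA, hB, hd⟩ := h
  exact ⟨n, a, b, ha, hb, hA, hB, fun i => (hd i).trans_le hε⟩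

theorem infDist_int_le_one (a : ℝ) : Metric.infDist a (range ((↑) : ℤ → ℝ)) ≤ 1 := by
  refine (Metric.infDist_le_dist_of_mem (mem_range_self ⌊a⌋)).trans ?_
  rw [Real.dist_eq, abs_of_nonneg (sub_nonneg.2 (Int.floor_le a))]
  linarith [Int.lt_floor_add_one a]

/-- A function transverse to a finite family may be moved slightly without changing the integer
parts of the differences with members of the family, in infinitely many ways. -/
theorem infinite_matches_refl {F : Finset C(I, ℝ)} {f : C(I, ℝ)} (hf : f ∉ F)
    (hT : IsTransverse (insert f (F : Set C(I, ℝ)))) :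
    {f' : C(I, ℝ) | Matches (OrderIso.refl I)
      (insert (f, f') ((fun h => (h, h)) '' (F : Set C(I, ℝ))))}.Infinite := by
  set Z : Set ℝ := range ((↑) : ℤ → ℝ) with hZ
  have hZne : Z.Nonempty := range_nonempty _
  -- Factors are at most `1`, so `d` is at most the distance from the integers of each difference `f
  -- - h`. Hence `f + c • d` with `0 < c < 1` keeps all integer parts, and distinct `c` give
  -- distinct functions because `d ≠ 0`.
  let d : C(I, ℝ) := ⟨fun x => ∏ h ∈ F, Metric.infDist (f x - h x) Z,
    continuous_finsetProd _ fun h _ => (Metric.continuous_infDist_pt Z).comp (by fun_prop)⟩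
  have hd0 : ∀ x, 0 ≤ d x := fun x => Finset.prod_nonneg fun h _ => Metric.infDist_nonneg
  have hd1 : ∀ h ∈ F, ∀ x, d x ≤ Metric.infDist (f x - h x) Z := by
    intro h hh x
    classical
    change ∏ h ∈ F, _ ≤ _
    rw [← Finset.mul_prod_erase F _ hh]
    exact mul_le_of_le_one_right Metric.infDist_nonneg
      (Finset.prod_le_one (fun _ _ => Metric.infDist_nonneg) fun _ _ => infDist_int_le_one _)
  obtain ⟨x₀, hx₀⟩ : ∃ x₀, d x₀ ≠ 0 := by
    have hfin : (⋃ h ∈ F, cr f h).Finite := F.finite_toSet.biUnion fun h hh =>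
      hT.finite_cr f (mem_insert _ _) h (mem_insert_of_mem _ hh) fun e => hf (e ▸ hh)
    have : Infinite I := (Icc_infinite (zero_lt_one (α := ℝ))).to_subtype
    obtain ⟨x, hx⟩ := hfin.infinite_compl.nonempty
    refine ⟨x, Finset.prod_ne_zero_iff.2 fun h hh => ?_⟩
    refine ((Int.isClosedEmbedding_coe_real.isClosed_range.notMem_iff_infDist_pos hZne).1 ?_).ne'
    rintro ⟨k, hk⟩
    exact hx (mem_biUnion hh (mem_cr_iff.2 ⟨k, hk.symm⟩))
  have hinj : InjOn (fun c : ℝ => f + c • d) (Ioo 0 1) := by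
    intro a _ b _ hab
    have := congrArg (fun g : C(I, ℝ) => g x₀) hab
    simpa [hx₀] using this
  refine ((Ioo_infinite (zero_lt_one (α := ℝ))).image hinj).mono ?_
  rintro _ ⟨c, hc, rfl⟩
  have key : ∀ h ∈ F, ∀ x, ⌊f x - h x⌋ = ⌊(f + c • d) x - h x⌋ ∧
      ⌊h x - f x⌋ = ⌊h x - (f + c • d) x⌋ := by
    intro h hh x
    simp only [ContinuousMap.add_apply, ContinuousMap.smul_apply, smul_eq_mul]
    rcases eq_or_lt_of_le (hd0 x) with h0 | h0
    · simp [← h0]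
    · have hlt : c * d x < Metric.infDist (f x - h x) Z :=
        (mul_lt_of_lt_one_left h0 hc.2).trans_le (hd1 h hh x)
      have hle : ∀ k : ℤ, Metric.infDist (f x - h x) Z ≤ |f x - h x - k| := fun k =>
        Metric.infDist_le_dist_of_mem (mem_range_self k)
      have hpos := mul_pos hc.1 h0
      refine ⟨floor_eq_of_abs_sub_lt hle (lt_of_eq_of_lt ?_ hlt),
        floor_eq_of_abs_sub_lt (fun k => (hle (-k)).trans_eq ?_) (lt_of_eq_of_lt ?_ hlt)⟩
      · rw [abs_sub_comm, abs_of_nonneg (by linarith)]; ring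
      · rw [abs_sub_comm]
        congr 1
        push_cast; ring
      · rw [abs_of_nonneg (by linarith)]; ring
  rintro p hp q hq x
  simp only [mem_insert_iff, mem_image, Finset.mem_coe] at hp hq
  rcases hp with rfl | ⟨h₁, hh₁, rfl⟩ <;> rcases hq with rfl | ⟨h₂, hh₂, rfl⟩
  · simp
  · exact (key _ hh₂ x).1
  · exact (key _ hh₁ x).2
  · rfl

/-- If there were only finitely many such `g`, some `f'` matched with `f` by the identity would not
be among them. A member of `V` that approximates `f'` well enough is again matched with `f`, but is
closer to `f'` than any of the finitely many. -/
theorem SmoothRado.IsSmoothlyDense.infinite_matches {V : Set C(I, ℝ)} (hV : IsSmoothlyDense V)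
    {F : Finset C(I, ℝ)} (hF : (F : Set C(I, ℝ)) ⊆ V) {f : C(I, ℝ)} (hf : f ∉ F)
    (hT : IsTransverse (insert f (F : Set C(I, ℝ)))) :
    {g : C(I, ℝ) | g ∈ V ∧ g ∉ F ∧ ∃ ψ : I ≃o I,
      Matches ψ (insert (f, g) ((fun h => (h, h)) '' (F : Set C(I, ℝ))))}.Infinite := by
  intro hS
  set S := {g : C(I, ℝ) | g ∈ V ∧ g ∉ F ∧ ∃ ψ : I ≃o I,
      Matches ψ (insert (f, g) ((fun h => (h, h)) '' (F : Set C(I, ℝ))))} with hSdef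
  obtain ⟨f', hf'm, hf'S⟩ := ((infinite_matches_refl hf hT).sdiff hS).nonempty
  have hmem : ∀ (g : C(I, ℝ)), (f, g) ∈ insert (f, g) ((fun h => (h, h)) '' (F : Set C(I, ℝ))) :=
    fun g => mem_insert _ _
  have hmemF : ∀ (g : C(I, ℝ)), ∀ h ∈ F,
      (h, h) ∈ insert (f, g) ((fun h => (h, h)) '' (F : Set C(I, ℝ))) :=
    fun g h hh => mem_insert_of_mem _ ⟨h, hh, rfl⟩
  have hnot : ∀ (g : C(I, ℝ)) (ψ : I ≃o I),
      Matches ψ (insert (f, g) ((fun h => (h, h)) '' (F : Set C(I, ℝ)))) → g ∉ F :=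
    fun g ψ hψ hg => hf <| by
      have e : f = g := (hψ.fst_eq_iff (hmem g) (hmemF g g hg)).2 rfl
      rwa [e]
  have hT' : IsTransverse (insert f' (F : Set C(I, ℝ))) := by
    have := hf'm.isTransverse (by simpa [image_insert_eq, image_image] using hT)
    simpa [image_insert_eq, image_image] using this
  obtain ⟨ε, hε, H⟩ := hT'.exists_matches F.finite_toSet (hnot f' _ hf'm)
  obtain ⟨η, hη, hηS⟩ := exists_pos_forall_le hS (f := fun g => ‖f' - g‖) fun g hg =>
    norm_pos_iff.2 (sub_ne_zero.2 fun e => hf'S (e ▸ hg))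
  obtain ⟨g, hgV, hg1, hg2⟩ := hV.approx F hF f' (hnot f' _ hf'm) hT' (min ε η) (by positivity)
  obtain ⟨ψ, hψ⟩ := H g (hg1.trans_le (min_le_left _ _))
    fun h hh => (hg2 h hh).mono (min_le_left _ _)
  have hmatch : Matches ((OrderIso.refl I).trans ψ)
      (insert (f, g) ((fun h => (h, h)) '' (F : Set C(I, ℝ)))) := by
    refine hf'm.insert_trans hψ ?_
    rintro _ ⟨h, hh, rfl⟩
    exact hh
  exact absurd (hηS g ⟨hgV, hnot g _ hmatch, _, hmatch⟩)
    (not_le.2 (hg1.trans_le (min_le_right _ _)))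

/-! ### Almost sure extension property of the random graph -/

theorem ae_infinitePi_exists_mem {Y : Type*} [MeasurableSpace Y] {ν : ℕ → Measure Y}
    [∀ n, IsProbabilityMeasure (ν n)] {E : ℕ → Set Y} (hE : ∀ n, MeasurableSet (E n))
    {c : ENNReal} (hc : 0 < c) (hν : ∀ n, c ≤ ν n (E n)) :
    ∀ᵐ y ∂(Measure.infinitePi ν), ∃ n, y n ∈ E n := by
  rw [ae_iff]
  have hle : ∀ N : ℕ, Measure.infinitePi ν {y | ¬ ∃ n, y n ∈ E n} ≤ (1 - c) ^ N := by
    intro N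
    calc Measure.infinitePi ν {y | ¬ ∃ n, y n ∈ E n}
        ≤ Measure.infinitePi ν (Set.pi (Finset.range N) fun n => (E n)ᶜ) := by
          refine measure_mono fun y hy n _ hn => hy ⟨n, hn⟩
      _ = ∏ n ∈ Finset.range N, ν n (E n)ᶜ :=
          Measure.infinitePi_pi _ fun n _ => (hE n).compl
      _ ≤ ∏ n ∈ Finset.range N, (1 - c) := by
          refine Finset.prod_le_prod' fun n _ => ?_
          rw [prob_compl_eq_one_sub (hE n)]
          exact tsub_le_tsub_left (hν n) 1
      _ = (1 - c) ^ N := by simp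
  exact le_antisymm (ge_of_tendsto' (ENNReal.tendsto_pow_atTop_nhds_zero_of_lt_one
    (ENNReal.sub_lt_self ENNReal.one_ne_top one_ne_zero hc.ne')) hle) bot_le

/-- The blocks `{n} × κ` use disjoint sets of independent coordinates, and each block shows the
pattern `A` with probability at least `min p (1 - p) ^ |κ|`. Only the points of `A` need to be
eligible. -/
theorem ae_setBernoulli_exists {ι κ : Type*} [Finite κ] {u : Set ι} {p : I} (hp0 : 0 < p)
    (hp1 : p < 1) {f : ℕ × κ → ι} (hf : Function.Injective f) {A : Set κ}
    (hA : ∀ n, ∀ k ∈ A, f (n, k) ∈ u) :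
    ∀ᵐ S ∂(setBernoulli u p), ∃ n, ∀ k, f (n, k) ∈ S ↔ k ∈ A := by
  cases nonempty_fintype κ
  classical
  set μ : ι → Measure Prop := fun i =>
    toNNReal p • Measure.dirac (i ∈ u) + toNNReal (σ p) • Measure.dirac False with hμ
  set c : ENNReal := min (toNNReal p) (toNNReal (σ p)) with hc
  have hp0' : 0 < toNNReal p := by exact_mod_cast hp0
  have hp1' : 0 < toNNReal (σ p) := by
    have : (0 : ℝ) < (σ p : I) := by rw [coe_symm_eq, sub_pos]; exact_mod_cast hp1
    exact_mod_cast this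
  have hc0 : 0 < c := lt_min (by exact_mod_cast hp0') (by exact_mod_cast hp1')
  have hmeas : MeasurableSet {S : Set ι | ∃ n, ∀ k, f (n, k) ∈ S ↔ k ∈ A} := by
    simp only [ofPred_exists, ofPred_forall]
    refine .iUnion fun n => .iInter fun k => ?_
    exact measurableSet_setOfPred.2 ((measurable_set_mem _).iff measurable_const)
  rw [setBernoulli_eq_map, ae_map_iff (by fun_prop) hmeas]
  simp only [mem_ofPred_eq]
  have h1 : (Measure.infinitePi μ).map (fun ω (i : ℕ × κ) => ω (f i)) =
      Measure.infinitePi fun i => μ (f i) := Measure.map_infinitePi_infinitePi_of_inj hf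
  have h2 : (Measure.infinitePi fun i => μ (f i)).map (fun ω (n : ℕ) (k : κ) => ω (n, k)) =
      Measure.infinitePi fun n => Measure.infinitePi fun k => μ (f (n, k)) :=
    Measure.infinitePi_map_curry (fun n k => μ (f (n, k)))
  have hE : ∀ n : ℕ, MeasurableSet {y : κ → Prop | ∀ k, y k ↔ k ∈ A} := fun _ => .of_discrete
  have key := ae_infinitePi_exists_mem (ν := fun n => Measure.infinitePi fun k => μ (f (n, k)))
    hE (c := c ^ Fintype.card κ) (pos_iff_ne_zero.2 (pow_ne_zero _ hc0.ne')) (fun n => by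
      have e : {y : κ → Prop | ∀ k, y k ↔ k ∈ A} =
          Set.pi (Finset.univ : Finset κ) fun k => {b | b ↔ k ∈ A} := by
        ext y; simp [Set.mem_pi]
      rw [e, Measure.infinitePi_pi _ fun _ _ => .of_discrete, ← Finset.card_univ,
        ← Finset.prod_const]
      refine Finset.prod_le_prod' fun k _ => ?_
      by_cases hk : k ∈ A
      · refine (min_le_left _ _).trans ?_
        simp [hμ, hk, hA n k hk]
      · refine (min_le_right _ _).trans ?_
        simp [hμ, hk])
  rw [← h2, ← h1, Measure.map_map (by fun_prop) (by fun_prop)] at key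
  have hm : AEMeasurable ((fun (ω : ℕ × κ → Prop) (n : ℕ) (k : κ) => ω (n, k)) ∘
      fun (ω : ι → Prop) (i : ℕ × κ) => ω (f i)) (Measure.infinitePi μ) := by
    refine Measurable.aemeasurable (Measurable.comp (by fun_prop) (by fun_prop))
  exact ae_of_ae_map hm key

theorem ae_LARG_exists_adj {X : Type*} [NormedAddCommGroup X] {V : Set X} (hV : V.Countable)
    {p : I} (hp0 : 0 < p) (hp1 : p < 1) {F A : Finset V} {S : Set V} (hS : S.Infinite)
    (hSF : ∀ g ∈ S, g ∉ F) (hSA : ∀ g ∈ S, ∀ a ∈ A, ‖(g : X) - a‖ < 1) :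
    ∀ᵐ G ∂(LARG V p), ∃ g ∈ S, ∀ h ∈ F, G.Adj g h ↔ h ∈ A := by
  have := hV.to_subtype
  have hmeas : MeasurableSet {G : SimpleGraph V | ∃ g ∈ S, ∀ h ∈ F, G.Adj g h ↔ h ∈ A} := by
    simp only [ofPred_exists, ofPred_forall, ofPred_and]
    refine .iUnion fun g => .inter (.const _) (.iInter fun h => .iInter fun _ => ?_)
    exact measurableSet_setOfPred.2 (Measurable.iff (by fun_prop) measurable_const)
  rw [LARG, ae_map_iff SimpleGraph.measurable_fromEdgeSet.aemeasurable hmeas]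
  let g : ℕ ↪ S := hS.natEmbedding
  have hne : ∀ n, ∀ h ∈ F, (g n : V) ≠ h := fun n h hh e => hSF _ (g n).2 (e ▸ hh)
  -- The unordered pairs are distinct because no `g n` belongs to `F`; this yields independence.
  have hinj : Function.Injective fun z : ℕ × F => s((g z.1 : V), (z.2 : V)) := by
    rintro ⟨n, h⟩ ⟨m, k⟩ e
    simp only [Sym2.eq_iff] at e
    rcases e with ⟨e1, e2⟩ | ⟨e1, -⟩
    · exact Prod.ext (g.injective (Subtype.ext e1)) (Subtype.ext e2)
    · exact absurd e1 (hne n k k.2)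
  filter_upwards [ae_setBernoulli_exists (u := (unitDistGraph V).edgeSet) hp0 hp1 hinj
    (A := {k | (k : V) ∈ A}) (fun n k hk => ⟨hne n k k.2, hSA _ (g n).2 k hk⟩)] with T hT
  obtain ⟨n, hn⟩ := hT
  refine ⟨g n, (g n).2, fun h hh => ?_⟩
  rw [SimpleGraph.fromEdgeSet_adj, and_iff_left (hne n h hh)]
  exact hn ⟨h, hh⟩

/-- The extension property of graphs on a set of continuous functions that is shared by almost all
samples of the local area random graph. -/
structure HasExtension (V : Set C(I, ℝ)) (G : SimpleGraph V) : Prop where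
  norm_sub_lt_one : ∀ u v : V, G.Adj u v → ‖(u : C(I, ℝ)) - v‖ < 1
  exists_adj : ∀ (F : Finset V) (f : V) (A : Finset V), f ∉ F → A ⊆ F →
    (∀ a ∈ A, ‖(f : C(I, ℝ)) - a‖ < 1) → ∃ g : V, g ∉ F ∧
      (∃ ψ : I ≃o I, Matches ψ (insert ((f : C(I, ℝ)), (g : C(I, ℝ)))
        ((fun h => (h, h)) '' (Subtype.val '' (F : Set V))))) ∧
      ∀ h ∈ F, G.Adj g h ↔ h ∈ A

/-- There are only countably many triples `F`, `f`, `A`. For each, the infinitely many `g` matched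
with `f` over `F` are at distance less than `1` from `A`, as `f` is, so the required edges are
allowed. -/
theorem SmoothRado.IsSmoothlyDense.ae_hasExtension {V : Set C(I, ℝ)} (hVc : V.Countable)
    (hV : IsSmoothlyDense V) {p : I} (hp0 : 0 < p) (hp1 : p < 1) :
    ∀ᵐ G ∂(LARG V p), HasExtension V G := by
  classical
  have := hVc.to_subtype
  have h1 : ∀ᵐ G ∂(LARG V p), ∀ u v : V, G.Adj u v → ‖(u : C(I, ℝ)) - v‖ < 1 := by
    rw [ae_all_iff]; intro u
    rw [ae_all_iff]; intro v
    have hm : Measurable fun G : SimpleGraph V => G.Adj u v := by fun_prop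
    rw [LARG, ae_map_iff SimpleGraph.measurable_fromEdgeSet.aemeasurable
      (measurableSet_setOfPred.2 (hm.imp measurable_const))]
    filter_upwards [setBernoulli_ae_subset] with S hS h
    rw [SimpleGraph.fromEdgeSet_adj] at h
    exact (hS h.1 : (unitDistGraph V).Adj u v).2
  have h2 : ∀ᵐ G ∂(LARG V p), ∀ (F : Finset V) (f : V) (A : Finset V), f ∉ F → A ⊆ F →
      (∀ a ∈ A, ‖(f : C(I, ℝ)) - a‖ < 1) → ∃ g : V, g ∉ F ∧
        (∃ ψ : I ≃o I, Matches ψ (insert ((f : C(I, ℝ)), (g : C(I, ℝ)))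
          ((fun h => (h, h)) '' (Subtype.val '' (F : Set V))))) ∧
        ∀ h ∈ F, G.Adj g h ↔ h ∈ A := by
    simp only [ae_all_iff, eventually_imp_distrib_left]
    intro F f A hf hAF hA
    set F' : Finset C(I, ℝ) := F.image Subtype.val with hF'
    have hF'V : (F' : Set C(I, ℝ)) ⊆ V := by
      intro g hg
      simp only [hF', Finset.coe_image] at hg
      obtain ⟨g, -, rfl⟩ := hg
      exact g.2
    have hF'mem : ∀ g : V, (g : C(I, ℝ)) ∈ F' ↔ g ∈ F := by
      intro g
      simp [hF']
    have hinf := hV.infinite_matches hF'V (f := f) (by rwa [hF'mem])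
      (hV.transverse.mono (insert_subset f.2 hF'V))
    have hcoe : (F' : Set C(I, ℝ)) = Subtype.val '' (F : Set V) := by simp [hF']
    rw [hcoe] at hinf
    set S : Set V := {g | g ∉ F ∧ ∃ ψ : I ≃o I, Matches ψ (insert ((f : C(I, ℝ)), (g : C(I, ℝ)))
      ((fun h => (h, h)) '' (Subtype.val '' (F : Set V))))} with hS
    have hSinf : S.Infinite := by
      refine Infinite.of_image Subtype.val (hinf.mono ?_)
      rintro g ⟨hgV, hgF, hg⟩
      exact ⟨⟨g, hgV⟩, ⟨by rwa [← hF'mem], hg⟩, rfl⟩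
    filter_upwards [ae_LARG_exists_adj hVc hp0 hp1 (A := A) hSinf (fun g hg => hg.1)
      (fun g hg a ha => by
        obtain ⟨ψ, hψ⟩ := hg.2
        exact (hψ.norm_sub_lt_one (mem_insert _ _)
          (mem_insert_of_mem _ ⟨a, ⟨a, hAF ha, rfl⟩, rfl⟩)).1 (hA a ha))] with G hG
    obtain ⟨g, hg, H⟩ := hG
    exact ⟨g, hg.1, hg.2, H⟩
  filter_upwards [h1, h2] with G h1 h2 using ⟨h1, h2⟩

/-! ### Back and forth -/

/-- In the order of finite partial isomorphisms by inclusion, the conditions "`a` is in the domain"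
and "`b` is in the range" are cofinal; an increasing sequence that meets all of them has an
isomorphism as its union. -/
theorem SimpleGraph.nonempty_iso_of_back_and_forth {α β : Type*} [Countable α] [Countable β]
    [DecidableEq α] [DecidableEq β] {G : SimpleGraph α} {H : SimpleGraph β}
    (P : Finset (α × β) → Prop) (h0 : P ∅)
    (hl : ∀ s, P s → ∀ a, ∃ b, P (insert (a, b) s)) (hr : ∀ s, P s → ∀ b, ∃ a, P (insert (a, b) s))
    (hP : ∀ s, P s → ∀ p ∈ s, ∀ q ∈ s,
      (p.1 = q.1 ↔ p.2 = q.2) ∧ (G.Adj p.1 q.1 ↔ H.Adj p.2 q.2)) :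
    Nonempty (G ≃g H) := by
  cases nonempty_encodable α
  cases nonempty_encodable β
  let D : α ⊕ β → Order.Cofinal {s // P s} := fun i => i.rec
    (fun a => ⟨{s | ∃ b, (a, b) ∈ s.1}, fun s => by
      obtain ⟨b, hb⟩ := hl s.1 s.2 a
      exact ⟨⟨_, hb⟩, ⟨b, Finset.mem_insert_self _ _⟩, Finset.subset_insert _ _⟩⟩)
    (fun b => ⟨{s | ∃ a, (a, b) ∈ s.1}, fun s => by
      obtain ⟨a, ha⟩ := hr s.1 s.2 b
      exact ⟨⟨_, ha⟩, ⟨a, Finset.mem_insert_self _ _⟩, Finset.subset_insert _ _⟩⟩)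
  let S := Order.sequenceOfCofinals (⟨∅, h0⟩ : {s // P s}) D
  have hS : Monotone S := Order.sequenceOfCofinals.monotone _ _
  let R : α → β → Prop := fun a b => ∃ n, (a, b) ∈ (S n).1
  have hRl : ∀ a, ∃ b, R a b := fun a => by
    obtain ⟨b, hb⟩ := Order.sequenceOfCofinals.encode_mem (⟨∅, h0⟩ : {s // P s}) D (.inl a)
    exact ⟨b, _, hb⟩
  have hRr : ∀ b, ∃ a, R a b := fun b => by
    obtain ⟨a, ha⟩ := Order.sequenceOfCofinals.encode_mem (⟨∅, h0⟩ : {s // P s}) D (.inr b)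
    exact ⟨a, _, ha⟩
  have hR : ∀ {a b a' b'}, R a b → R a' b' → (a = a' ↔ b = b') ∧ (G.Adj a a' ↔ H.Adj b b') := by
    rintro a b a' b' ⟨n, hn⟩ ⟨m, hm⟩
    exact hP _ (S (max n m)).2 _ (hS (le_max_left n m) hn) _ (hS (le_max_right n m) hm)
  choose φ hφ using hRl
  choose χ hχ using hRr
  exact ⟨⟨⟨φ, χ, fun a => (hR (hχ (φ a)) (hφ a)).1.2 rfl,
    fun b => (hR (hφ (χ b)) (hχ b)).1.1 rfl⟩, fun {a b} => (hR (hφ a) (hφ b)).2.symm⟩⟩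

/-- The partner of `a` is found in three rounds: `f'` is a counterpart in `C[0,1]`, `g₀` replaces it
inside `W`, and `g` has in addition the prescribed adjacencies in `H`. -/
theorem HasExtension.exists_insert {V W : Set C(I, ℝ)} (hV : IsSmoothlyDense V)
    (hW : IsSmoothlyDense W) {G : SimpleGraph V} {H : SimpleGraph W} (hG : HasExtension V G)
    (hH : HasExtension W H) (s : Set (V × W)) (hs : s.Finite) {θ : I ≃o I}
    (hθ : Matches θ (Prod.map Subtype.val Subtype.val '' s))
    (hadj : ∀ p ∈ s, ∀ q ∈ s, G.Adj p.1 q.1 ↔ H.Adj p.2 q.2) (a : V) :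
    ∃ b : W, (∃ θ' : I ≃o I, Matches θ' (Prod.map Subtype.val Subtype.val '' insert (a, b) s)) ∧
      ∀ p ∈ insert (a, b) s, ∀ q ∈ insert (a, b) s, G.Adj p.1 q.1 ↔ H.Adj p.2 q.2 := by
  classical
  by_cases ha : ∃ b, (a, b) ∈ s
  · obtain ⟨b, hb⟩ := ha
    refine ⟨b, ?_⟩
    rw [insert_eq_of_mem hb]
    exact ⟨⟨θ, hθ⟩, hadj⟩
  push Not at ha
  set s' : Set (C(I, ℝ) × C(I, ℝ)) := Prod.map Subtype.val Subtype.val '' s with hs'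
  have hmem : ∀ p ∈ s, ((p.1 : C(I, ℝ)), (p.2 : C(I, ℝ))) ∈ s' := fun p hp => ⟨p, hp, rfl⟩
  have hane : ∀ p ∈ s', (a : C(I, ℝ)) ≠ p.1 := by
    rintro _ ⟨p, hp, rfl⟩ e
    exact ha p.2 (by rwa [show a = p.1 from Subtype.ext e])
  have hTV : IsTransverse (insert (a : C(I, ℝ)) (Prod.fst '' s')) := by
    refine hV.transverse.mono (insert_subset a.2 ?_)
    rintro _ ⟨_, ⟨p, hp, rfl⟩, rfl⟩
    exact p.1.2
  obtain ⟨f', hf'⟩ := hθ.exists_insert (hs.image _) hane hTV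
  set F : Finset W := hs.toFinset.image Prod.snd with hF
  have hFmem : ∀ p ∈ s, p.2 ∈ F := fun p hp =>
    Finset.mem_image_of_mem _ (hs.mem_toFinset.2 hp)
  set F' : Finset C(I, ℝ) := F.image Subtype.val with hF'
  have hF'W : (F' : Set C(I, ℝ)) ⊆ W := by
    intro g hg
    simp only [hF', Finset.coe_image] at hg
    obtain ⟨g, -, rfl⟩ := hg
    exact g.2
  have hF's : (F' : Set C(I, ℝ)) = Prod.snd '' s' := by
    ext g
    simp only [hF', hF, hs', Finset.coe_image, image_image, Finite.coe_toFinset, Prod.map_snd]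
  have hcoe : (F' : Set C(I, ℝ)) = Subtype.val '' (F : Set W) := by simp [hF']
  have hfF : f' ∉ F' := by
    rw [← Finset.mem_coe, hF's]
    rintro ⟨p, hp, e⟩
    exact hane p hp ((hf'.fst_eq_iff (mem_insert _ _) (mem_insert_of_mem _ hp)).2 e.symm)
  have hTW : IsTransverse (insert f' (F' : Set C(I, ℝ))) := by
    rw [hF's]
    have := hf'.isTransverse (by rwa [image_insert_eq])
    rwa [image_insert_eq] at this
  obtain ⟨g₀, hg₀W, hg₀F, ψ, hψ⟩ := (hW.infinite_matches hF'W hfF hTW).nonempty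
  have h1 : Matches (θ.trans ψ) (insert ((a : C(I, ℝ)), g₀) s') :=
    hf'.insert_trans hψ fun p hp => by rw [hF's]; exact mem_image_of_mem _ hp
  obtain ⟨g, hgF, ⟨χ, hχ⟩, hgadj⟩ := hH.exists_adj F ⟨g₀, hg₀W⟩
    (F.filter fun b => ∃ p ∈ s, p.2 = b ∧ G.Adj a p.1)
    (fun h => hg₀F (Finset.mem_image_of_mem _ h)) (Finset.filter_subset _ _) (by
      intro b hb
      obtain ⟨-, p, hp, rfl, hap⟩ := Finset.mem_filter.1 hb
      exact (h1.norm_sub_lt_one (mem_insert _ _) (mem_insert_of_mem _ (hmem p hp))).1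
        (hG.norm_sub_lt_one _ _ hap))
  have h2 : Matches ((θ.trans ψ).trans χ) (insert ((a : C(I, ℝ)), (g : C(I, ℝ))) s') :=
    h1.insert_trans hχ fun p hp => by rw [← hcoe, hF's]; exact mem_image_of_mem _ hp
  have hnew : ∀ p ∈ s, G.Adj a p.1 ↔ H.Adj g p.2 := by
    intro p hp
    rw [hgadj _ (hFmem p hp), Finset.mem_filter, and_iff_right (hFmem p hp)]
    refine ⟨fun h => ⟨p, hp, rfl, h⟩, ?_⟩
    rintro ⟨q, hq, hqp, h⟩
    have : q.1 = p.1 := Subtype.ext ((hθ.fst_eq_iff (hmem q hq) (hmem p hp)).2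
      (congrArg Subtype.val hqp))
    rwa [← this]
  refine ⟨g, ⟨_, by rw [image_insert_eq]; exact h2⟩, ?_⟩
  rintro p (rfl | hp) q (rfl | hq)
  · simp
  · exact hnew q hq
  · rw [G.adj_comm, H.adj_comm]; exact hnew p hp
  · exact hadj p hp q hq

theorem HasExtension.nonempty_iso {V W : Set C(I, ℝ)} (hVc : V.Countable) (hWc : W.Countable)
    (hV : IsSmoothlyDense V) (hW : IsSmoothlyDense W) {G : SimpleGraph V} {H : SimpleGraph W}
    (hG : HasExtension V G) (hH : HasExtension W H) : Nonempty (G ≃g H) := by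
  classical
  have := hVc.to_subtype
  have := hWc.to_subtype
  have swapImage : ∀ t : Set (V × W), Prod.map Subtype.val Subtype.val '' (Prod.swap '' t) =
      Prod.swap '' (Prod.map Subtype.val Subtype.val '' t : Set (C(I, ℝ) × C(I, ℝ))) := fun t => by
    simp only [image_image]; rfl
  refine SimpleGraph.nonempty_iso_of_back_and_forth (fun s : Finset (V × W) =>
    (∃ θ : I ≃o I, Matches θ (Prod.map Subtype.val Subtype.val '' (s : Set (V × W)))) ∧
      ∀ p ∈ s, ∀ q ∈ s, G.Adj p.1 q.1 ↔ H.Adj p.2 q.2) ?_ ?_ ?_ ?_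
  · exact ⟨⟨OrderIso.refl _, by simp [Matches]⟩, by simp⟩
  · rintro s ⟨⟨θ, hθ⟩, hs⟩ a
    obtain ⟨b, h1, h2⟩ := hG.exists_insert hV hW hH s s.finite_toSet hθ (by simpa using hs) a
    exact ⟨b, by simpa using h1, by simpa using h2⟩
  · rintro s ⟨⟨θ, hθ⟩, hs⟩ b
    obtain ⟨a, ⟨θ', h1⟩, h2⟩ := hH.exists_insert hW hV hG (Prod.swap '' (s : Set (V × W)))
      (s.finite_toSet.image _) (θ := θ.symm) (by rw [swapImage]; exact hθ.symm) (by
        rintro _ ⟨p, hp, rfl⟩ _ ⟨q, hq, rfl⟩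
        exact (hs p hp q hq).symm) b
    rw [show ((b, a) : W × V) = Prod.swap (a, b) from rfl, ← image_insert_eq] at h1 h2
    rw [swapImage] at h1
    refine ⟨a, ⟨θ'.symm, ?_⟩, fun p hp q hq => ?_⟩
    · have := h1.symm
      simp only [image_image, Prod.swap_swap] at this
      rwa [Finset.coe_insert]
    · rw [← Finset.mem_coe, Finset.coe_insert] at hp hq
      exact (h2 _ (mem_image_of_mem _ hp) _ (mem_image_of_mem _ hq)).symm
  · rintro s ⟨⟨θ, hθ⟩, hs⟩ p hp q hq
    refine ⟨?_, hs p hp q hq⟩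
    have := hθ.fst_eq_iff (mem_image_of_mem _ (Finset.mem_coe.2 hp))
      (mem_image_of_mem _ (Finset.mem_coe.2 hq))
    simpa [Subtype.ext_iff] using this

/-- A single sample on `V₀` with the extension property serves as a model, since
`HasExtension.nonempty_iso` compares graphs on different vertex sets. A rival `R'` is isomorphic to
some sample on `V₀` that also has the property. -/
theorem exists_isGRSD {V₀ : Set C(I, ℝ)} (hc : V₀.Countable) (hV₀ : IsSmoothlyDense V₀) :
    ∃ R : SimpleGraph ℕ, IsGRSD R ∧ ∀ R' : SimpleGraph ℕ, IsGRSD R' → Nonempty (R' ≃g R) := by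
  obtain ⟨p, hp0, hp1⟩ := exists_between (zero_lt_one (α := I))
  obtain ⟨G, hG⟩ := (hV₀.ae_hasExtension hc hp0 hp1).exists
  have hinf : V₀.Infinite := by
    -- With `F = ∅` no condition remains, so the lemma says that `V₀` is infinite.
    refine ((hV₀.infinite_matches (F := ∅) (f := 0) (by simp) (by simp) ?_)).mono
      fun g hg => hg.1
    constructor <;> simp
  have := hc.to_subtype
  have := hinf.to_subtype
  obtain ⟨e⟩ : Nonempty (V₀ ≃ ℕ) := nonempty_equiv_of_countable
  have eR : G ≃g G.map e.toEmbedding := SimpleGraph.Iso.map e G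
  refine ⟨G.map e.toEmbedding, fun V hVc hV q hq0 hq1 => ?_, fun R' hR' => ?_⟩
  · filter_upwards [hV.ae_hasExtension hVc hq0 hq1] with H hH
    obtain ⟨i⟩ := hH.nonempty_iso hVc hc hV hV₀ hG
    exact ⟨i.trans eR⟩
  · obtain ⟨H, hH, ⟨i⟩⟩ := ((hV₀.ae_hasExtension hc hp0 hp1).and
      (hR' V₀ hc hV₀ p hp0 hp1)).exists
    obtain ⟨j⟩ := hH.nonempty_iso hc hc hV₀ hV₀ hG
    exact ⟨i.symm.trans (j.trans eR)⟩

/-! ### Random sequences of functions are transverse -/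

theorem MeasureTheory.Measure.infinitePi_prod_map_update {ι X : Type*} [MeasurableSpace X]
    [DecidableEq ι] (μ : ι → Measure X) [∀ i, IsProbabilityMeasure (μ i)] (i : ι) :
    ((Measure.infinitePi μ).prod (μ i)).map (fun z => Function.update z.1 i z.2) =
      Measure.infinitePi μ := by
  refine Measure.eq_infinitePi _ fun s t ht => ?_
  rw [Measure.map_apply measurable_update' (MeasurableSet.pi s.countable_toSet fun j _ => ht j)]
  by_cases hi : i ∈ s
  · have e : (fun z : (ι → X) × X => Function.update z.1 i z.2) ⁻¹' (s : Set ι).pi t =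
        ((s.erase i : Finset ι) : Set ι).pi t ×ˢ t i := by
      ext ⟨y, z⟩
      simp only [mem_preimage, Set.mem_pi, mem_prod, Finset.mem_coe, Finset.mem_erase]
      constructor
      · intro h
        refine ⟨fun j hj => ?_, by simpa using h i hi⟩
        simpa [hj.1] using h j hj.2
      · rintro ⟨h1, h2⟩ j hj
        by_cases e : j = i
        · subst e; simpa using h2
        · simpa [e] using h1 j ⟨e, hj⟩
    rw [e, Measure.prod_prod, Measure.infinitePi_pi _ fun j _ => ht j, mul_comm,
      Finset.mul_prod_erase s (fun j => μ j (t j)) hi]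
  · have e : (fun z : (ι → X) × X => Function.update z.1 i z.2) ⁻¹' (s : Set ι).pi t =
        (s : Set ι).pi t ×ˢ univ := by
      ext ⟨y, z⟩
      simp only [mem_preimage, Set.mem_pi, mem_prod, Finset.mem_coe, mem_univ, and_true]
      refine forall₂_congr fun j hj => ?_
      rw [Function.update_of_ne (by rintro rfl; exact hi hj)]
    rw [e, Measure.prod_prod, Measure.infinitePi_pi _ fun j _ => ht j, measure_univ, mul_one]

/-- Resampling one coordinate independently does not change the product law, so by Fubini the other
coordinates may be frozen. -/
theorem MeasureTheory.Measure.ae_infinitePi_of_ae_update {ι X : Type*} [MeasurableSpace X]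
    [DecidableEq ι] (μ : ι → Measure X) [∀ i, IsProbabilityMeasure (μ i)] (i : ι)
    {p : (ι → X) → Prop} (hp : MeasurableSet {y | p y})
    (h : ∀ᵐ y ∂(Measure.infinitePi μ), ∀ᵐ z ∂(μ i), p (Function.update y i z)) :
    ∀ᵐ y ∂(Measure.infinitePi μ), p y := by
  rw [← Measure.infinitePi_prod_map_update μ i, ae_map_iff measurable_update'.aemeasurable hp,
    Measure.ae_prod_iff_ae_ae (p := fun z : (ι → X) × X => p (Function.update z.1 i z.2))
      (measurable_update' hp)]
  exact h

/-- A law on `C[0,1]` that is quasi-invariant under adding constants. -/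
def TranslationQuasiInvariant (P : Measure C(I, ℝ)) : Prop :=
  ∀ c : ℝ, P.map (fun u => u + ContinuousMap.const I c) ≪ P

/-- If one level set of `Φ` had positive mass, translation would give positive mass to all of them,
but only countably many disjoint sets can have positive mass. -/
theorem TranslationQuasiInvariant.ae_ne {P : Measure C(I, ℝ)} [IsProbabilityMeasure P]
    (hP : TranslationQuasiInvariant P) {Φ : C(I, ℝ) → ℝ} (hΦ : Measurable Φ)
    (hadd : ∀ u c, Φ (u + ContinuousMap.const I c) = Φ u + c) (a : ℝ) : ∀ᵐ u ∂P, Φ u ≠ a := by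
  by_contra hcon
  have hne : P {u | Φ u = a} ≠ 0 := by
    simpa only [ae_iff, ne_eq, not_not] using hcon
  have hpos : ∀ c : ℝ, 0 < P {u | Φ u = c} := by
    intro c
    refine pos_iff_ne_zero.2 fun h0 => hne ?_
    have h1 := hP (c - a) h0
    have hm : MeasurableSet {u | Φ u = c} := hΦ (measurableSet_singleton c)
    have hm' : Measurable fun u : C(I, ℝ) => u + ContinuousMap.const I (c - a) :=
      (continuous_id.add continuous_const).measurable
    rw [Measure.map_apply hm' hm] at h1
    refine (congrArg P ?_).trans h1
    ext u
    simp only [mem_ofPred_eq, mem_preimage, hadd]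
    constructor <;> intro h <;> linarith
  have hc := Measure.countable_meas_level_set_pos (μ := P) hΦ
  simp only [hpos, ofPred_true] at hc
  exact not_countable_univ hc

/-- The supremum over a set as a functional on `C[0,1]`. -/
noncomputable def supOn (K : Set I) (u : C(I, ℝ)) : ℝ := sSup (u '' K)

theorem bddAbove_image (K : Set I) (u : C(I, ℝ)) : BddAbove (u '' K) :=
  ((isCompact_range u.continuous).bddAbove).mono (image_subset_range _ _)

theorem supOn_add_const {K : Set I} (hK : K.Nonempty) (u : C(I, ℝ)) (c : ℝ) :
    supOn K (u + ContinuousMap.const I c) = supOn K u + c := by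
  have h := (OrderIso.addRight c).map_csSup' (hK.image u) (bddAbove_image K u)
  rw [OrderIso.addRight_apply] at h
  rw [supOn, supOn, h, image_image]
  rfl

theorem supOn_mono {K : Set I} (hK : K.Nonempty) {u v : C(I, ℝ)} (h : u ≤ v) :
    supOn K u ≤ supOn K v := by
  refine csSup_le (hK.image u) ?_
  rintro _ ⟨x, hx, rfl⟩
  exact (h x).trans (le_csSup (bddAbove_image K v) (mem_image_of_mem v hx))

theorem continuous_supOn {K : Set I} (hK : K.Nonempty) : Continuous (supOn K) := by
  refine (LipschitzWith.of_le_add fun u v => ?_).continuous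
  rw [← supOn_add_const hK]
  refine supOn_mono hK fun x => ?_
  have := (le_abs_self _).trans ((u - v).norm_coe_le_norm x)
  rw [ContinuousMap.sub_apply, ← dist_eq_norm] at this
  change u x ≤ v x + dist u v
  linarith

theorem supOn_eq_of_isMax {K : Set I} {u : C(I, ℝ)} {t : I} (ht : t ∈ K)
    (h : ∀ x ∈ K, u x ≤ u t) : supOn K u = u t := by
  refine (IsGreatest.csSup_eq ⟨mem_image_of_mem u ht, ?_⟩)
  rintro _ ⟨x, hx, rfl⟩
  exact h x hx

theorem TranslationQuasiInvariant.ae_supOn_ne {P : Measure C(I, ℝ)} [IsProbabilityMeasure P]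
    (hP : TranslationQuasiInvariant P) {K : Set I} (hK : K.Nonempty) (h : C(I, ℝ)) :
    ∀ᵐ u ∂P, ∀ m : ℤ, supOn K (u - h) ≠ m := by
  rw [ae_all_iff]
  intro m
  refine hP.ae_ne (Φ := fun u => supOn K (u - h)) ?_ (fun u c => ?_) m
  · exact ((continuous_supOn hK).comp (by fun_prop)).measurable
  · rw [← supOn_add_const hK, add_sub_right_comm]

theorem TranslationQuasiInvariant.ae_sequence_supOn_ne {P : Measure C(I, ℝ)}
    [IsProbabilityMeasure P] (hP : TranslationQuasiInvariant P) {K : Set I} (hK : K.Nonempty)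
    {i j : ℕ} (hij : i ≠ j) :
    ∀ᵐ f ∂(Measure.infinitePi fun _ : ℕ => P), ∀ m : ℤ, supOn K (f i - f j) ≠ m := by
  refine Measure.ae_infinitePi_of_ae_update _ i ?_ (.of_forall fun y => ?_)
  · have hm : Measurable fun f : ℕ → C(I, ℝ) => supOn K (f i - f j) :=
      ((continuous_supOn hK).comp (by fun_prop)).measurable
    simp only [ofPred_forall]
    exact .iInter fun m => (hm (measurableSet_singleton (m : ℝ))).compl
  · filter_upwards [hP.ae_supOn_ne hK (y j)] with z hz m
    rw [Function.update_self, Function.update_of_ne hij.symm]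
    exact hz m

/-- The set is a projection of a closed set along the compact interval; closedness supplies the
measurability needed for Fubini. -/
theorem isClosed_exists_cr (i j k l : ℕ) :
    IsClosed {f : ℕ → C(I, ℝ) | ∃ t, t ∈ cr (f i) (f j) ∧ t ∈ cr (f k) (f l)} := by
  have hc : IsClosed {z : I × (ℕ → C(I, ℝ)) |
      z.2 i z.1 - z.2 j z.1 ∈ range ((↑) : ℤ → ℝ) ∧
        z.2 k z.1 - z.2 l z.1 ∈ range ((↑) : ℤ → ℝ)} := by
    have he : ∀ i, Continuous fun z : I × (ℕ → C(I, ℝ)) => z.2 i z.1 := fun i => by fun_prop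
    have hZ := Int.isClosedEmbedding_coe_real.isClosed_range
    exact (hZ.preimage ((he i).sub (he j))).inter (hZ.preimage ((he k).sub (he l)))
  convert isClosedMap_snd_of_compactSpace _ hc using 1
  ext f
  simp only [mem_ofPred_eq, mem_cr_iff, mem_image, mem_range, Prod.exists, exists_eq_right,
    @eq_comm ℝ _ (Int.cast _)]

/-- Given the other functions, `cr (f i) (f j)` is finite, and the fresh function `f l` almost
surely avoids crossing `f k` at each of its points. The functional `supOn {t}` is evaluation at `t`.
-/
theorem TranslationQuasiInvariant.ae_sequence_disjoint_cr {P : Measure C(I, ℝ)}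
    [IsProbabilityMeasure P] (hP : TranslationQuasiInvariant P) {i j k l : ℕ} (hil : i ≠ l)
    (hjl : j ≠ l) (hkl : k ≠ l)
    (hfin : ∀ᵐ f ∂(Measure.infinitePi fun _ : ℕ => P), (cr (f i) (f j)).Finite) :
    ∀ᵐ f ∂(Measure.infinitePi fun _ : ℕ => P), Disjoint (cr (f i) (f j)) (cr (f k) (f l)) := by
  have hset : {f : ℕ → C(I, ℝ) | Disjoint (cr (f i) (f j)) (cr (f k) (f l))} =
      {f : ℕ → C(I, ℝ) | ∃ t, t ∈ cr (f i) (f j) ∧ t ∈ cr (f k) (f l)}ᶜ := by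
    ext f
    simp [disjoint_left]
  refine Measure.ae_infinitePi_of_ae_update _ l ?_ ?_
  · rw [hset]
    exact (isClosed_exists_cr i j k l).measurableSet.compl
  · filter_upwards [hfin] with f hf
    simp only [Function.update_of_ne hil, Function.update_of_ne hjl, Function.update_of_ne hkl,
      Function.update_self]
    have : ∀ᵐ z ∂P, ∀ t ∈ cr (f i) (f j), ∀ m : ℤ, supOn {t} (z - f k) ≠ m := by
      rw [ae_ball_iff hf.countable]
      exact fun t _ => hP.ae_supOn_ne (singleton_nonempty t) (f k)
    filter_upwards [this] with z hz
    rw [disjoint_left]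
    intro t ht htz
    rw [cr_comm, mem_cr_iff] at htz
    obtain ⟨m, hm⟩ := htz
    exact hz t ht m (by simpa [supOn] using hm)

/-- Families of functions in which level sets of differences are finite unless they contain local
extrema. -/
def IsTame (T : Set C(I, ℝ)) : Prop :=
  ∀ f ∈ T, ∀ g ∈ T, ∀ m : ℤ, {t | f t - g t = m}.Infinite →
    ∃ t, f t - g t = m ∧ IsLocalExtr (⇑(f - g)) t

theorem finite_cr_of_finite_levels {f g : C(I, ℝ)} (h : ∀ m : ℤ, {t | f t - g t = m}.Finite) :
    (cr f g).Finite := by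
  refine ((finite_Icc (-⌈‖f - g‖⌉) ⌈‖f - g‖⌉).biUnion fun m _ => h m).subset fun t ht => ?_
  obtain ⟨m, hm⟩ := mem_cr_iff.1 ht
  refine mem_biUnion (x := m) ?_ hm
  have h1 := abs_le.1 ((f - g).norm_coe_le_norm t)
  rw [ContinuousMap.sub_apply, hm] at h1
  have h2 := Int.le_ceil ‖f - g‖
  constructor
  · exact_mod_cast (show ((-⌈‖f - g‖⌉ : ℤ) : ℝ) ≤ m by push_cast; linarith)
  · exact_mod_cast h1.2.trans h2

theorem TranslationQuasiInvariant.ae_isTransverse {P : Measure C(I, ℝ)} [IsProbabilityMeasure P]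
    (hP : TranslationQuasiInvariant P) {T : Set C(I, ℝ)} (hT : IsTame T)
    (hTP : ∀ᵐ f ∂P, f ∈ T) :
    ∀ᵐ f ∂(Measure.infinitePi fun _ : ℕ => P), IsTransverse (range f) := by
  -- The value at a local maximum is the supremum over some basic open set. So countably many
  -- suprema control all local maxima, and the two singletons control the endpoints.
  set B : Set (Set I) := insert {0} (insert {1} (TopologicalSpace.countableBasis I)) with hB
  have hBc : B.Countable := ((TopologicalSpace.countable_countableBasis I).insert _).insert _
  have hBne : ∀ K ∈ B, K.Nonempty := by
    rintro K (rfl | rfl | hK)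
    · exact singleton_nonempty _
    · exact singleton_nonempty _
    · exact TopologicalSpace.nonempty_of_mem_countableBasis hK
  have hT' : ∀ᵐ f ∂(Measure.infinitePi fun _ : ℕ => P), ∀ i, f i ∈ T := by
    rw [ae_all_iff]
    exact fun i => (measurePreserving_eval_infinitePi (fun _ : ℕ => P) i).quasiMeasurePreserving.ae
      hTP
  have hsup : ∀ᵐ f ∂(Measure.infinitePi fun _ : ℕ => P), ∀ i j, i ≠ j → ∀ K ∈ B, ∀ m : ℤ,
      supOn K (f i - f j) ≠ m := by
    simp only [ae_all_iff, eventually_imp_distrib_left]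
    intro i j hij
    exact (ae_ball_iff hBc).2 fun K hK => hP.ae_sequence_supOn_ne (hBne K hK) hij
  have hpt : ∀ (f : ℕ → C(I, ℝ)), (∀ i j, i ≠ j → ∀ K ∈ B, ∀ m : ℤ, supOn K (f i - f j) ≠ m) →
      ∀ i j, i ≠ j → ∀ t, {t} ∈ B → t ∉ cr (f i) (f j) := by
    intro f hf i j hij t ht h
    obtain ⟨m, hm⟩ := mem_cr_iff.1 h
    exact hf i j hij _ ht m (by simpa [supOn] using hm)
  have hmax : ∀ (f : ℕ → C(I, ℝ)), (∀ i j, i ≠ j → ∀ K ∈ B, ∀ m : ℤ, supOn K (f i - f j) ≠ m) →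
      ∀ i j, i ≠ j → ∀ t ∈ cr (f i) (f j), ¬ IsLocalMax (⇑(f i - f j)) t := by
    intro f hf i j hij t ht h
    obtain ⟨m, hm⟩ := mem_cr_iff.1 ht
    obtain ⟨U, hU, htU, hUN⟩ :=
      (TopologicalSpace.isBasis_countableBasis I).mem_nhds_iff.1 h
    exact hf i j hij U (.inr (.inr hU)) m ((supOn_eq_of_isMax htU fun x hx => hUN hx).trans hm)
  have hext : ∀ (f : ℕ → C(I, ℝ)), (∀ i j, i ≠ j → ∀ K ∈ B, ∀ m : ℤ, supOn K (f i - f j) ≠ m) →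
      ∀ i j, i ≠ j → ∀ t ∈ cr (f i) (f j), ¬ IsLocalExtr (⇑(f i - f j)) t := by
    rintro f hf i j hij t ht (h | h)
    · refine hmax f hf j i hij.symm t (cr_comm (f i) (f j) ▸ ht) ?_
      have := h.neg
      rwa [show (fun x => -(f i - f j) x) = ⇑(f j - f i) from funext fun x => by simp] at this
    · exact hmax f hf i j hij t ht h
  have hfin : ∀ᵐ f ∂(Measure.infinitePi fun _ : ℕ => P), ∀ i j, i ≠ j →
      (cr (f i) (f j)).Finite := by
    filter_upwards [hT', hsup] with f hfT hf i j hij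
    refine finite_cr_of_finite_levels fun m => ?_
    by_contra hinf
    -- By tameness an infinite level set contains a local extremum, which has just been excluded at
    -- integer levels.
    obtain ⟨t, htm, ht⟩ := hT _ (hfT i) _ (hfT j) m hinf
    exact hext f hf i j hij t (mem_cr_iff.2 ⟨m, htm⟩) ht
  have hdisj : ∀ᵐ f ∂(Measure.infinitePi fun _ : ℕ => P), ∀ i j k l, i ≠ j → i ≠ l → j ≠ l →
      k ≠ l → Disjoint (cr (f i) (f j)) (cr (f k) (f l)) := by
    simp only [ae_all_iff, eventually_imp_distrib_left]
    intro i j k l hij hil hjl hkl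
    refine hP.ae_sequence_disjoint_cr hil hjl hkl ?_
    filter_upwards [hfin] with f hf using hf i j hij
  filter_upwards [hsup, hfin, hdisj] with f h1 h2 h3
  have hidx : ∀ {i j}, f i ≠ f j → i ≠ j := fun h e => h (e ▸ rfl)
  constructor
  · rintro _ ⟨i, rfl⟩ _ ⟨j, rfl⟩ _ ⟨k, rfl⟩ _ ⟨l, rfl⟩ hij hkl hne
    replace hij := hidx hij
    replace hkl := hidx hkl
    -- Two different pairs of indices always leave an index of the second pair outside the first.
    by_cases hl : i ≠ l ∧ j ≠ l
    · exact h3 i j k l hij hl.1 hl.2 hkl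
    · by_cases hk : i ≠ k ∧ j ≠ k
      · rw [cr_comm (f k)]
        exact h3 i j l k hij hk.1 hk.2 hkl.symm
      · refine absurd ?_ hne
        rw [Sym2.eq_iff]
        have : (i = k ∧ j = l) ∨ (i = l ∧ j = k) := by omega
        rcases this with ⟨rfl, rfl⟩ | ⟨rfl, rfl⟩
        · exact .inl ⟨rfl, rfl⟩
        · exact .inr ⟨rfl, rfl⟩
  · rintro _ ⟨i, rfl⟩ _ ⟨j, rfl⟩ hij
    exact h2 i j (hidx hij)
  · rintro _ ⟨i, rfl⟩ _ ⟨j, rfl⟩ hij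
    exact hpt f h1 i j (hidx hij) 0 (.inl rfl)
  · rintro _ ⟨i, rfl⟩ _ ⟨j, rfl⟩ hij
    exact hpt f h1 i j (hidx hij) 1 (.inr (.inl rfl))
  · rintro _ ⟨i, rfl⟩ _ ⟨j, rfl⟩ hij
    exact hext f h1 i j (hidx hij)

/-! ### Steep approximations -/

/-- A continuous function passing through an integer at `p`, with no other integer value nearby and
no local extremum at `p`, changes sign there. -/
theorem exists_sign_of_not_isLocalExtr {u : I → ℝ} (hu : Continuous u) {p x₁ x₂ : I} {k : ℤ}
    (hp : u p = k) (h1 : x₁ < p) (h2 : p < x₂)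
    (hno : ∀ x ∈ Icc x₁ x₂, x ≠ p → ∀ m : ℤ, u x ≠ m) (hext : ¬ IsLocalExtr u p) :
    ∃ s : ℤ, (s = 1 ∨ s = -1) ∧ ∀ x ∈ Icc x₁ x₂, x ≠ p →
      0 < s * (u x - k) * ((x : ℝ) - p) ∧ |u x - k| < 1 := by
  have hnear : ∀ᶠ y in 𝓝 p, (k : ℝ) - 1 < u y ∧ u y < k + 1 :=
    (hu.tendsto p).eventually (Ioo_mem_nhds (by linarith) (by linarith))
  have hR : ∀ x ∈ Ioc p x₂, ⌊u x⌋ = ⌊u x₂⌋ := fun x hx =>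
    floor_eq_of_forall_uIcc hu fun z hz m => by
      rw [uIcc_of_le hx.2] at hz
      exact hno z ⟨(h1.trans hx.1).le.trans hz.1, hz.2⟩ (hx.1.trans_le hz.1).ne' m
  have hL : ∀ x ∈ Ico x₁ p, ⌊u x⌋ = ⌊u x₁⌋ := fun x hx =>
    floor_eq_of_forall_uIcc hu fun z hz m => by
      rw [uIcc_of_ge hx.1] at hz
      exact hno z ⟨hz.1, hz.2.trans (hx.2.trans h2).le⟩ (hz.2.trans_lt hx.2).ne m
  have hk : ∀ {x : I}, (k : ℝ) - 1 < u x ∧ u x < k + 1 → ⌊u x⌋ = k - 1 ∨ ⌊u x⌋ = k := by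
    intro x hx
    have a1 : k - 1 ≤ ⌊u x⌋ := Int.le_floor.2 (by push_cast; exact hx.1.le)
    have a2 : ⌊u x⌋ < k + 1 := Int.floor_lt.2 (by push_cast; exact hx.2)
    omega
  have hR2 : ⌊u x₂⌋ = k - 1 ∨ ⌊u x₂⌋ = k := by
    have := nhdsGT_neBot_of_exists_gt ⟨x₂, h2⟩
    obtain ⟨y, hy, hy'⟩ := ((hnear.filter_mono nhdsWithin_le_nhds).and
      (Ioc_mem_nhdsGT h2)).exists
    rw [← hR y hy']
    exact hk hy
  have hL2 : ⌊u x₁⌋ = k - 1 ∨ ⌊u x₁⌋ = k := by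
    have := nhdsLT_neBot_of_exists_lt ⟨x₁, h1⟩
    obtain ⟨y, hy, hy'⟩ := ((hnear.filter_mono nhdsWithin_le_nhds).and
      (Ico_mem_nhdsLT h1)).exists
    rw [← hL y hy']
    exact hk hy
  have hcases : ∀ y ∈ Icc x₁ x₂, y = p ∨ ⌊u y⌋ = ⌊u x₁⌋ ∧ y < p ∨ ⌊u y⌋ = ⌊u x₂⌋ ∧ p < y := by
    intro y hy
    rcases lt_trichotomy y p with h | h | h
    · exact .inr (.inl ⟨hL y ⟨hy.1, h⟩, h⟩)
    · exact .inl h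
    · exact .inr (.inr ⟨hR y ⟨h, hy.2⟩, h⟩)
  have hIcc : Icc x₁ x₂ ∈ 𝓝 p := Icc_mem_nhds h1 h2
  have hlow : ∀ {y}, ⌊u y⌋ = k - 1 → y ∈ Icc x₁ x₂ → y ≠ p → u y < k ∧ |u y - k| < 1 := by
    intro y hy hyI hyp
    have a1 := Int.floor_le (u y)
    have a2 := Int.lt_floor_add_one (u y)
    have a3 := hno y hyI hyp (k - 1)
    rw [hy] at a1 a2
    push_cast at a1 a2 a3
    have a4 := lt_of_le_of_ne a1 (Ne.symm a3)
    exact ⟨by linarith, abs_lt.2 ⟨by linarith, by linarith⟩⟩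
  have hhigh : ∀ {y}, ⌊u y⌋ = k → y ∈ Icc x₁ x₂ → y ≠ p → (k : ℝ) < u y ∧ |u y - k| < 1 := by
    intro y hy hyI hyp
    have a1 := Int.floor_le (u y)
    have a2 := Int.lt_floor_add_one (u y)
    have a3 := hno y hyI hyp k
    rw [hy] at a1 a2
    have a4 := lt_of_le_of_ne a1 (Ne.symm a3)
    exact ⟨a4, abs_lt.2 ⟨by linarith, by linarith⟩⟩
  -- Equal integer parts on the two sides would make `p` a local maximum (both `k - 1`) or minimum
  -- (both `k`); the mixed cases give the two signs.
  rcases hL2 with hL2 | hL2 <;> rcases hR2 with hR2 | hR2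
  · refine absurd (Or.inr ?_) hext
    filter_upwards [hIcc] with y hy
    rcases hcases y hy with rfl | ⟨e, h⟩ | ⟨e, h⟩
    · exact le_rfl
    · rw [hp]; exact (hlow (e.trans hL2) hy h.ne).1.le
    · rw [hp]; exact (hlow (e.trans hR2) hy h.ne').1.le
  · refine ⟨1, .inl rfl, fun x hx hxp => ?_⟩
    rcases hcases x hx with h | ⟨e, h⟩ | ⟨e, h⟩
    · exact absurd h hxp
    · obtain ⟨b1, b2⟩ := hlow (e.trans hL2) hx hxp
      have h' : (x : ℝ) < p := h
      refine ⟨?_, b2⟩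
      push_cast; nlinarith
    · obtain ⟨b1, b2⟩ := hhigh (e.trans hR2) hx hxp
      have h' : (p : ℝ) < x := h
      refine ⟨?_, b2⟩
      push_cast; nlinarith
  · refine ⟨-1, .inr rfl, fun x hx hxp => ?_⟩
    rcases hcases x hx with h | ⟨e, h⟩ | ⟨e, h⟩
    · exact absurd h hxp
    · obtain ⟨b1, b2⟩ := hhigh (e.trans hL2) hx hxp
      have h' : (x : ℝ) < p := h
      refine ⟨?_, b2⟩
      push_cast; nlinarith
    · obtain ⟨b1, b2⟩ := hlow (e.trans hR2) hx hxp
      have h' : (p : ℝ) < x := h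
      refine ⟨?_, b2⟩
      push_cast; nlinarith
  · refine absurd (Or.inl ?_) hext
    filter_upwards [hIcc] with y hy
    rcases hcases y hy with rfl | ⟨e, h⟩ | ⟨e, h⟩
    · exact le_rfl
    · rw [hp]; exact (hhigh (e.trans hL2) hy h.ne).1.le
    · rw [hp]; exact (hhigh (e.trans hR2) hy h.ne').1.le

/-- Points chosen within `ρ` of points that are `2 * ρ` apart appear in the same order. -/
theorem simWithin_of_forall_exists_unique {A B : Set I} (hA : A.Finite) {ρ ε : ℝ} (hρε : ρ ≤ ε)
    (hsep : ∀ p ∈ A, ∀ q ∈ A, p ≠ q → 2 * ρ ≤ |(p : ℝ) - q|)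
    (hB : ∀ x ∈ B, ∃ p ∈ A, |(x : ℝ) - p| < ρ)
    (hAB : ∀ p ∈ A, ∃ b : I, |(b : ℝ) - p| < ρ ∧ ∀ x : I, |(x : ℝ) - p| < ρ → (x ∈ B ↔ x = b)) :
    SimWithin ε A B := by
  choose! b hb hbB using hAB
  have hmem : ∀ i, hA.toFinset.orderEmbOfFin rfl i ∈ A := fun i =>
    hA.mem_toFinset.1 (Finset.orderEmbOfFin_mem _ rfl i)
  have hrange : range (hA.toFinset.orderEmbOfFin rfl) = A := by
    rw [Finset.range_orderEmbOfFin, hA.coe_toFinset]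
  refine ⟨_, hA.toFinset.orderEmbOfFin rfl, fun i => b (hA.toFinset.orderEmbOfFin rfl i),
    OrderEmbedding.strictMono _, fun i j hij => ?_, hrange, ?_, fun i => ?_⟩
  · have h1 : hA.toFinset.orderEmbOfFin rfl i < hA.toFinset.orderEmbOfFin rfl j :=
      OrderEmbedding.strictMono _ hij
    have h2 := hsep _ (hmem i) _ (hmem j) h1.ne
    have h1' : ((hA.toFinset.orderEmbOfFin rfl i : I) : ℝ) < hA.toFinset.orderEmbOfFin rfl j := h1
    rw [abs_of_neg (by linarith)] at h2
    have h3 := abs_lt.1 (hb _ (hmem i))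
    have h4 := abs_lt.1 (hb _ (hmem j))
    exact Subtype.coe_lt_coe.1 (by linarith)
  · ext x
    constructor
    · rintro ⟨i, rfl⟩
      exact (hbB _ (hmem i) _ (hb _ (hmem i))).2 rfl
    · intro hx
      obtain ⟨p, hp, hxp⟩ := hB x hx
      obtain ⟨i, hi⟩ := hrange.symm ▸ hp
      exact ⟨i, by simp only [hi]; exact ((hbB p hp x hxp).1 hx).symm⟩
  · rw [dist_comm]
    exact (hb _ (hmem i)).trans_le hρε

/-- At `p ± ρ` the integer parts of `g - h` are those of `f - h`, so `g - h` lies on opposite sides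
of `k` and within `1` of it. This forces a crossing in between, and monotonicity excludes a second
one and all other integers. -/
theorem simWithin_of_strictMonoOn {f g h : C(I, ℝ)} {ρ ε : ℝ} (hρ : 0 < ρ) (hρε : ρ ≤ ε)
    (hfin : (cr f h).Finite) (hsep : ∀ p ∈ cr f h, ∀ q ∈ cr f h, p ≠ q → 2 * ρ ≤ |(p : ℝ) - q|)
    (h0 : ∀ p ∈ cr f h, ρ ≤ (p : ℝ)) (h1 : ∀ p ∈ cr f h, (p : ℝ) ≤ 1 - ρ)
    (hext : ∀ p ∈ cr f h, ¬ IsLocalExtr (⇑(f - h)) p)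
    (hfl : ∀ x : I, (∀ p ∈ cr f h, ρ ≤ |(x : ℝ) - p|) →
      ⌊f x - h x⌋ = ⌊g x - h x⌋ ∧ x ∉ cr g h)
    (hmono : ∀ p ∈ cr f h, StrictMonoOn (fun x => g x - h x) {x : I | |(x : ℝ) - p| ≤ ρ} ∨
      StrictAntiOn (fun x => g x - h x) {x : I | |(x : ℝ) - p| ≤ ρ}) :
    SimWithin ε (cr f h) (cr g h) := by
  refine simWithin_of_forall_exists_unique hfin hρε hsep (fun x hx => ?_) fun p hp => ?_
  · by_contra hcon
    push Not at hcon
    exact (hfl x hcon).2 hx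
  obtain ⟨k, hk⟩ := mem_cr_iff.1 hp
  have hp0 := h0 p hp
  have hp1 := h1 p hp
  obtain ⟨x₁, hx₁⟩ : ∃ z : I, (z : ℝ) = p - ρ := ⟨⟨p - ρ, ⟨by linarith, by linarith⟩⟩, rfl⟩
  obtain ⟨x₂, hx₂⟩ : ∃ z : I, (z : ℝ) = p + ρ := ⟨⟨p + ρ, ⟨by linarith, by linarith⟩⟩, rfl⟩
  have hx1p : x₁ < p := Subtype.coe_lt_coe.1 (by linarith)
  have hpx2 : p < x₂ := Subtype.coe_lt_coe.1 (by linarith)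
  have hx12 : x₁ ≤ x₂ := (hx1p.trans hpx2).le
  have hIcc : ∀ x : I, x ∈ Icc x₁ x₂ ↔ |(x : ℝ) - p| ≤ ρ := by
    intro x
    rw [abs_le, mem_Icc, ← Subtype.coe_le_coe, ← Subtype.coe_le_coe, hx₁, hx₂]
    constructor <;> rintro ⟨a, b⟩ <;> constructor <;> linarith
  obtain ⟨s, hs, hsgn⟩ := exists_sign_of_not_isLocalExtr (u := fun x => f x - h x) (by fun_prop)
    hk hx1p hpx2 (fun x hx hxp m hm => by
      have := hsep x (mem_cr_iff.2 ⟨m, hm⟩) p hp hxp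
      have := (hIcc x).1 hx
      linarith) (hext p hp)
  have hfar : ∀ x : I, |(x : ℝ) - p| = ρ → ∀ q ∈ cr f h, ρ ≤ |(x : ℝ) - q| := by
    intro x hx q hq
    by_cases e : p = q
    · rw [← e, hx]
    · have h3 := hsep p hp q hq e
      have h4 := abs_sub_le (p : ℝ) x q
      rw [abs_sub_comm (p : ℝ) x] at h4
      linarith
  have hend : ∀ x : I, |(x : ℝ) - p| = ρ →
      0 < s * (g x - h x - k) * ((x : ℝ) - p) ∧ |g x - h x - k| < 1 := by
    intro x hx
    have hxp : x ≠ p := by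
      rintro rfl
      simp only [sub_self, abs_zero] at hx
      exact hρ.ne hx
    obtain ⟨e1, e2⟩ := hsgn x ((hIcc x).2 hx.le) hxp
    obtain ⟨e3, e4⟩ := hfl x (hfar x hx)
    have e5 : ∀ m : ℤ, g x - h x ≠ m := fun m hm => e4 (mem_cr_iff.2 ⟨m, hm⟩)
    have a1 := Int.floor_le (g x - h x)
    have a2 := Int.lt_floor_add_one (g x - h x)
    have a3 := lt_of_le_of_ne a1 (e5 _).symm
    rw [← e3] at a2 a3
    have b1 := Int.floor_le (f x - h x)
    have b2 := Int.lt_floor_add_one (f x - h x)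
    rw [abs_lt] at e2
    have key : ∀ {d : ℝ}, (0 < d ↔ 0 < g x - h x - k) → (d < 0 ↔ g x - h x - k < 0) →
        0 < s * d * ((x : ℝ) - p) → 0 < s * (g x - h x - k) * ((x : ℝ) - p) := by
      intro d hd1 hd2 hd
      have hd0 : d ≠ 0 := by rintro rfl; simp at hd
      rcases lt_or_gt_of_ne hd0 with hneg | hpos
      · have := hd2.1 hneg
        have : s * ((x : ℝ) - p) < 0 := by by_contra hc; push Not at hc; nlinarith
        nlinarith
      · have := hd1.1 hpos
        have : 0 < s * ((x : ℝ) - p) := by by_contra hc; push Not at hc; nlinarith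
        nlinarith
    have hu : f x - h x ≠ k := by
      intro e
      rw [e] at e1
      simp at e1
    rcases lt_or_gt_of_ne hu with hlt | hgt
    · have e6 : ⌊f x - h x⌋ = k - 1 := Int.floor_eq_iff.2 ⟨by push_cast; linarith, by
        push_cast; linarith⟩
      rw [e6] at a2 a3
      push_cast at a2 a3
      exact ⟨key ⟨fun _ => by linarith, fun _ => by linarith⟩
        ⟨fun _ => by linarith, fun _ => by linarith⟩ e1, abs_lt.2 ⟨by linarith, by linarith⟩⟩
    · have e6 : ⌊f x - h x⌋ = k := Int.floor_eq_iff.2 ⟨by linarith, by linarith⟩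
      rw [e6] at a2 a3
      exact ⟨key ⟨fun _ => by linarith, fun _ => by linarith⟩
        ⟨fun _ => by linarith, fun _ => by linarith⟩ e1, abs_lt.2 ⟨by linarith, by linarith⟩⟩
  have hgc : Continuous fun x => g x - h x := by fun_prop
  have d1 := hend x₁ (by rw [hx₁]; simp [abs_of_pos hρ])
  have d2 := hend x₂ (by rw [hx₂]; simp [abs_of_pos hρ])
  rw [hx₁, show (p : ℝ) - ρ - p = -ρ by ring, abs_lt] at d1
  rw [hx₂, show (p : ℝ) + ρ - p = ρ by ring, abs_lt] at d2
  have hku : (k : ℝ) ∈ uIcc (g x₁ - h x₁) (g x₂ - h x₂) := by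
    rw [mem_uIcc]
    rcases hs with rfl | rfl
    · push_cast at d1 d2
      exact .inl ⟨by nlinarith, by nlinarith⟩
    · push_cast at d1 d2
      exact .inr ⟨by nlinarith, by nlinarith⟩
  obtain ⟨b, hb, hbk⟩ := intermediate_value_uIcc hgc.continuousOn hku
  rw [uIcc_of_le hx12, hIcc] at hb
  have hbcr : b ∈ cr g h := mem_cr_iff.2 ⟨k, hbk⟩
  have hbρ : |(b : ℝ) - p| < ρ := lt_of_le_of_ne hb fun e => (hfl b (hfar b e)).2 hbcr
  refine ⟨b, hbρ, fun x hx => ⟨fun hxcr => ?_, fun e => e ▸ hbcr⟩⟩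
  obtain ⟨m, hm⟩ := mem_cr_iff.1 hxcr
  have hxI := (hIcc x).2 hx.le
  have hm1 : ∀ z ∈ Icc x₁ x₂, |(z : ℝ) - p| ≤ ρ := fun z hz => (hIcc z).1 hz
  have hinj : InjOn (fun x => g x - h x) {x : I | |(x : ℝ) - p| ≤ ρ} :=
    (hmono p hp).elim StrictMonoOn.injOn StrictAntiOn.injOn
  have hbd : (k : ℝ) - 1 < g x - h x ∧ g x - h x < k + 1 := by
    rcases hmono p hp with hm' | hm'
    · have c1 := hm'.monotoneOn (hm1 x₁ ⟨le_rfl, hx12⟩) (hm1 x hxI) hxI.1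
      have c2 := hm'.monotoneOn (hm1 x hxI) (hm1 x₂ ⟨hx12, le_rfl⟩) hxI.2
      exact ⟨by linarith [d1.2.1], by linarith [d2.2.2]⟩
    · have c1 := hm'.antitoneOn (hm1 x₁ ⟨le_rfl, hx12⟩) (hm1 x hxI) hxI.1
      have c2 := hm'.antitoneOn (hm1 x hxI) (hm1 x₂ ⟨hx12, le_rfl⟩) hxI.2
      exact ⟨by linarith [d2.2.1], by linarith [d1.2.2]⟩
  rw [hm] at hbd
  have e1 : k - 1 < m := by exact_mod_cast hbd.1
  have e2 : m < k + 1 := by exact_mod_cast hbd.2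
  have e3 : m = k := by omega
  subst e3
  exact hinj hx.le hb (hm.trans hbk.symm)

/-- On `[a, b]`, the function `g` has slope at least `S` in the direction of the sign `s`. -/
def Steep (s : ℤ) (S a b : ℝ) (g : C(I, ℝ)) : Prop :=
  ∀ x y : I, x ≤ y → a ≤ (x : ℝ) → (y : ℝ) ≤ b → S * ((y : ℝ) - x) ≤ s * (g y - g x)

theorem Steep.mono {s : ℤ} {S S' a a' b b' : ℝ} {g : C(I, ℝ)} (h : Steep s S a b g) (hS : S' ≤ S)
    (ha : a ≤ a') (hb : b' ≤ b) : Steep s S' a' b' g := fun x y hxy hx hy =>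
  (mul_le_mul_of_nonneg_right hS (sub_nonneg.2 hxy)).trans
    (h x y hxy (ha.trans hx) (hy.trans hb))

/-- Steep pieces are added later to the Lipschitz approximation, whose bounded slope they can
dominate; `f` itself may have unbounded slopes. -/
theorem exists_lipschitz_near (f : C(I, ℝ)) {ε : ℝ} (hε : 0 < ε) :
    ∃ (f₀ : C(I, ℝ)) (L : ℝ), 0 ≤ L ∧ (∀ x y, |f₀ x - f₀ y| ≤ L * |(x : ℝ) - y|) ∧
      ∀ x, |f₀ x - f x| < ε := by
  obtain ⟨p, hp⟩ := exists_polynomial_near_continuousMap 0 1 f ε hε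
  obtain ⟨C, hC⟩ := (isCompact_Icc (a := (0 : ℝ)) (b := 1)).exists_bound_of_continuousOn
    (f := fun x => p.derivative.eval x) p.derivative.continuous.continuousOn
  refine ⟨p.toContinuousMapOn _, max C 0, le_max_right _ _, fun x y => ?_, fun x => ?_⟩
  · have := (convex_Icc (0 : ℝ) 1).norm_image_sub_le_of_norm_hasDerivWithin_le
      (f := fun x => p.eval x) (f' := fun x => p.derivative.eval x) (C := max C 0)
      (fun z _ => (p.hasDerivAt z).hasDerivWithinAt)
      (fun z hz => (hC z hz).trans (le_max_left _ _)) y.2 x.2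
    simpa using this
  · simpa using (ContinuousMap.norm_coe_le_norm (p.toContinuousMapOn _ - f) x).trans_lt hp

/-- A sum of disjointly supported clamped linear functions with slope `±S` at the points of `P`. -/
theorem exists_zigzag (P : Finset I) (s : I → ℤ) (hs : ∀ p ∈ P, s p = 1 ∨ s p = -1) {A S ρ : ℝ}
    (hA : 0 ≤ A) (hρ : 0 < ρ) (hsep : ∀ p ∈ P, ∀ q ∈ P, p ≠ q → 4 * ρ ≤ |(p : ℝ) - q|) :
    ∃ Z : C(I, ℝ), (∀ x, |Z x| ≤ A) ∧ ∀ p ∈ P, ∀ x : I, |(x : ℝ) - p| ≤ ρ →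
      Z x = s p * max (-A) (min A (S * ((x : ℝ) - p))) := by
  classical
  let c : I → I → ℝ := fun p x => max (-A) (min A (S * ((x : ℝ) - p)))
  let d : I → I → ℝ := fun p x => max 0 (min 1 (2 - |(x : ℝ) - p| / ρ))
  have hc : ∀ p x, |c p x| ≤ A := fun p x =>
    abs_le.2 ⟨le_max_left _ _, max_le (by linarith) (min_le_left _ _)⟩
  have hd0 : ∀ p x, 0 ≤ d p x := fun p x => le_max_left _ _
  have hd1 : ∀ p x, d p x ≤ 1 := fun p x => max_le zero_le_one (min_le_left _ _)
  have hd2 : ∀ p x : I, 2 * ρ ≤ |(x : ℝ) - p| → d p x = 0 := fun p x h => by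
    refine max_eq_left (min_le_of_right_le ?_)
    rw [sub_nonpos, le_div_iff₀ hρ]
    exact h
  have hd3 : ∀ p x : I, |(x : ℝ) - p| ≤ ρ → d p x = 1 := fun p x h => by
    have : |(x : ℝ) - p| / ρ ≤ 1 := (div_le_one₀ hρ).2 h
    simp only [d]
    rw [min_eq_left (by linarith), max_eq_right zero_le_one]
  let Z : C(I, ℝ) := ⟨fun x => ∑ p ∈ P, s p * c p x * d p x, by
    simp only [c, d]; fun_prop⟩
  have hZ : ∀ p ∈ P, ∀ x : I, |(x : ℝ) - p| < 2 * ρ → Z x = s p * c p x * d p x := by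
    intro p hp x hx
    refine Finset.sum_eq_single_of_mem p hp fun q hq hqp => ?_
    rw [hd2, mul_zero]
    have h1 := hsep q hq p hp hqp
    have h2 := abs_sub_le (q : ℝ) x p
    rw [abs_sub_comm (q : ℝ) x] at h2
    linarith
  refine ⟨Z, fun x => ?_, fun p hp x hx => ?_⟩
  · by_cases h : ∃ p ∈ P, |(x : ℝ) - p| < 2 * ρ
    · obtain ⟨p, hp, hx⟩ := h
      rw [hZ p hp x hx, abs_mul, abs_mul, abs_of_nonneg (hd0 p x)]
      have h1 : |(s p : ℝ)| = 1 := by rcases hs p hp with h | h <;> simp [h]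
      rw [h1, one_mul]
      exact (mul_le_of_le_one_right (abs_nonneg _) (hd1 p x)).trans (hc p x)
    · push Not at h
      have : Z x = 0 := Finset.sum_eq_zero fun p hp => by rw [hd2 p x (h p hp), mul_zero]
      rwa [this, abs_zero]
  · rw [hZ p hp x (by linarith), hd3 p x hx, mul_one]

/-- Here `u` is `f - h` near a crossing, `v` the added zigzag and `w` the remaining error. The
zigzag has the sign of `u - k` and size at least `A / 4`, which exceeds `3 * A / 16`, so `v + w`
pushes `u` further from `k`, but by too little to reach another integer. -/
theorem abs_add_sub_lt {u v w k s t A : ℝ} (hs : s = 1 ∨ s = -1) (ht : t ≠ 0)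
    (h1 : 0 < s * (u - k) * t) (h2 : |u - k| ≤ 1 / 2)
    (hw : |w| ≤ 3 * A / 16) (hv : s * v * t ≥ A / 4 * |t|) (hv' : |v| ≤ A) (hA : 0 < A)
    (hA' : A ≤ 1 / 8) {m : ℤ} (hk : k = m) :
    ⌊u⌋ = ⌊u + v + w⌋ ∧ ∀ j : ℤ, u + v + w ≠ j := by
  obtain ⟨a1, a2⟩ := abs_le.1 h2
  obtain ⟨b1, b2⟩ := abs_le.1 hw
  obtain ⟨c1, c2⟩ := abs_le.1 hv'
  have key : (0 < u - k ∧ 0 < v + w) ∨ (u - k < 0 ∧ v + w < 0) := by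
    rcases hs with rfl | rfl <;> rcases lt_or_gt_of_ne ht with ht | ht
    · rw [abs_of_neg ht] at hv
      exact .inr ⟨by nlinarith, by nlinarith⟩
    · rw [abs_of_pos ht] at hv
      exact .inl ⟨by nlinarith, by nlinarith⟩
    · rw [abs_of_neg ht] at hv
      exact .inl ⟨by nlinarith, by nlinarith⟩
    · rw [abs_of_pos ht] at hv
      exact .inr ⟨by nlinarith, by nlinarith⟩
  subst hk
  rcases key with ⟨k1, k2⟩ | ⟨k1, k2⟩
  · have e1 : ⌊u⌋ = m := Int.floor_eq_iff.2 ⟨by linarith, by linarith⟩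
    have e2 : ⌊u + v + w⌋ = m := Int.floor_eq_iff.2 ⟨by linarith, by linarith⟩
    refine ⟨e1.trans e2.symm, fun j hj => ?_⟩
    rw [hj, Int.floor_intCast] at e2
    subst e2
    linarith
  · have e1 : ⌊u⌋ = m - 1 := Int.floor_eq_iff.2 ⟨by push_cast; linarith, by push_cast; linarith⟩
    have e2 : ⌊u + v + w⌋ = m - 1 :=
      Int.floor_eq_iff.2 ⟨by push_cast; linarith, by push_cast; linarith⟩
    refine ⟨e1.trans e2.symm, fun j hj => ?_⟩
    rw [hj, Int.floor_intCast] at e2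
    subst e2
    push_cast at hj
    linarith

/-- Steepness around the real points of `P` is implied by steepness on intervals with rational ends,
of which there are only countably many finite lists. The rational intervals lie between radii `l /
4` and `l / 2`, which leaves a margin `l / 2`. -/
theorem exists_rat_list (P : Finset I) (s : I → ℤ) (hs : ∀ p ∈ P, s p = 1 ∨ s p = -1) {l S : ℝ}
    (hl : 0 < l) {f₂ : C(I, ℝ)} (h0 : ∀ p ∈ P, l ≤ (p : ℝ)) (h1 : ∀ p ∈ P, (p : ℝ) ≤ 1 - l)
    (hst : ∀ p ∈ P, Steep (s p) S (p - l) (p + l) f₂) :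
    ∃ L : Finset (ℚ × ℚ × ℤ), (∀ z ∈ L, (z.2.2 = 1 ∨ z.2.2 = -1) ∧ l / 2 ≤ (z.1 : ℝ) ∧
        (z.2.1 : ℝ) ≤ 1 - l / 2 ∧ Steep z.2.2 S (z.1 - l / 2) (z.2.1 + l / 2) f₂) ∧
      ∀ S' : ℝ, ∀ g, (∀ z ∈ L, Steep z.2.2 S' z.1 z.2.1 g) →
        ∀ p ∈ P, Steep (s p) S' (p - l / 4) (p + l / 4) g := by
  classical
  have ha : ∀ p : I, ∃ a : ℚ, (p : ℝ) - l / 2 < a ∧ (a : ℝ) < p - l / 4 := fun p =>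
    exists_rat_btwn (by linarith)
  have hb : ∀ p : I, ∃ b : ℚ, (p : ℝ) + l / 4 < b ∧ (b : ℝ) < p + l / 2 := fun p =>
    exists_rat_btwn (by linarith)
  choose a ha using ha
  choose b hb using hb
  refine ⟨P.image fun p => (a p, b p, s p), ?_, fun S' g hg p hp => ?_⟩
  · simp only [Finset.forall_mem_image]
    intro p hp
    refine ⟨hs p hp, by linarith [h0 p hp, ha p], by linarith [h1 p hp, hb p], ?_⟩
    exact (hst p hp).mono le_rfl (by linarith [ha p]) (by linarith [hb p])
  · exact (hg _ (Finset.mem_image_of_mem _ hp)).mono le_rfl (ha p).2.le (hb p).1.le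

/-- The direction of crossing depends on `p` alone, because `p` is a crossing of `f` with only one
member of `F`. -/
theorem SmoothRado.IsTransverse.exists_sign {F : Finset C(I, ℝ)} {f : C(I, ℝ)} (hf : f ∉ F)
    (hT : IsTransverse (insert f (F : Set C(I, ℝ)))) {ρ₀ : ℝ} (hρ₀ : 0 < ρ₀) :
    ∃ (P : Finset I) (s : I → ℤ) (ρ : ℝ), 0 < ρ ∧ ρ ≤ ρ₀ ∧
      (∀ p, p ∈ P ↔ ∃ h ∈ F, p ∈ cr f h) ∧ (∀ p ∈ P, s p = 1 ∨ s p = -1) ∧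
      (∀ p ∈ P, ∀ q ∈ P, p ≠ q → 4 * ρ ≤ |(p : ℝ) - q|) ∧ (∀ p ∈ P, 2 * ρ ≤ (p : ℝ)) ∧
      (∀ p ∈ P, (p : ℝ) ≤ 1 - 2 * ρ) ∧
      ∀ h ∈ F, ∀ p ∈ cr f h, ∃ k : ℤ, ∀ x : I, |(x : ℝ) - p| ≤ ρ →
        |f x - h x - k| ≤ 1 / 2 ∧ (x ≠ p → 0 < s p * (f x - h x - k) * ((x : ℝ) - p)) := by
  classical
  have hne : ∀ h ∈ F, f ≠ h := fun h hh e => hf (e ▸ hh)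
  have mf : f ∈ insert f (F : Set C(I, ℝ)) := mem_insert _ _
  have mF : ∀ h ∈ F, h ∈ insert f (F : Set C(I, ℝ)) := fun h hh => mem_insert_of_mem f hh
  have hfin : (⋃ h ∈ F, cr f h).Finite := F.finite_toSet.biUnion fun h hh =>
    hT.finite_cr f mf h (mF h hh) (hne h hh)
  set P := hfin.toFinset with hP
  have hmem : ∀ p, p ∈ P ↔ ∃ h ∈ F, p ∈ cr f h := fun p => by simp [hP]
  obtain ⟨δ₀, hδ₀, hsep⟩ := exists_separation (P := (P : Set I)) P.finite_toSet
    (fun h0 => by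
      obtain ⟨h, hh, h0⟩ := (hmem _).1 h0
      exact hT.zero_notMem f mf h (mF h hh) (hne h hh) h0)
    (fun h0 => by
      obtain ⟨h, hh, h0⟩ := (hmem _).1 h0
      exact hT.one_notMem f mf h (mF h hh) (hne h hh) h0)
  have huc : ∀ h : C(I, ℝ), ∃ r > 0, ∀ x y : I, dist x y < r →
      dist (f x - h x) (f y - h y) < 1 / 2 := fun h =>
    Metric.uniformContinuous_iff.1 (CompactSpace.uniformContinuous_of_continuous
      (f := fun x => f x - h x) (by fun_prop)) (1 / 2) (by norm_num)
  choose r hr hr' using huc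
  obtain ⟨r₀, hr₀, hr₀'⟩ := exists_pos_forall_le F.finite_toSet (f := r) fun h _ => hr h
  set ρ := min ρ₀ (min (δ₀ / 2) (r₀ / 2)) with hρdef
  have hρ : 0 < ρ := by positivity
  have hρ1 : ρ ≤ ρ₀ := min_le_left _ _
  have hρ2 : 2 * ρ ≤ δ₀ := by
    have : ρ ≤ δ₀ / 2 := (min_le_right _ _).trans (min_le_left _ _)
    linarith
  have hρ3 : ρ < r₀ := by
    have : ρ ≤ r₀ / 2 := (min_le_right _ _).trans (min_le_right _ _)
    linarith
  obtain ⟨S1, S2, S3⟩ := hsep (2 * ρ) hρ2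
  have hclose : ∀ h ∈ F, ∀ p x : I, |(x : ℝ) - p| ≤ ρ →
      |(f x - h x) - (f p - h p)| < 1 / 2 := fun h hh p x hx =>
    hr' h x p ((show dist x p = |(x : ℝ) - p| from rfl) ▸ (hx.trans_lt (hρ3.trans_le (hr₀' h hh))))
  have hsign : ∀ h ∈ F, ∀ p ∈ cr f h, ∃ s : ℤ, (s = 1 ∨ s = -1) ∧ ∃ k : ℤ,
      ∀ x : I, |(x : ℝ) - p| ≤ ρ →
        |f x - h x - k| ≤ 1 / 2 ∧ (x ≠ p → 0 < s * (f x - h x - k) * ((x : ℝ) - p)) := by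
    intro h hh p hp
    have hpP : p ∈ P := (hmem p).2 ⟨h, hh, hp⟩
    obtain ⟨k, hk⟩ := mem_cr_iff.1 hp
    have q0 := S2 p hpP
    have q1 := S3 p hpP
    obtain ⟨x₁, hx₁⟩ : ∃ z : I, (z : ℝ) = p - ρ := ⟨⟨_, ⟨by linarith, by linarith⟩⟩, rfl⟩
    obtain ⟨x₂, hx₂⟩ : ∃ z : I, (z : ℝ) = p + ρ := ⟨⟨_, ⟨by linarith, by linarith⟩⟩, rfl⟩
    have hIcc : ∀ x : I, |(x : ℝ) - p| ≤ ρ ↔ x ∈ Icc x₁ x₂ := fun x => by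
      rw [abs_le, mem_Icc, ← Subtype.coe_le_coe, ← Subtype.coe_le_coe, hx₁, hx₂]
      constructor <;> rintro ⟨a, b⟩ <;> constructor <;> linarith
    obtain ⟨s, hs, H⟩ := exists_sign_of_not_isLocalExtr (u := ⇑(f - h)) (by fun_prop) (k := k)
      (p := p) (x₁ := x₁) (x₂ := x₂)
      (by simpa using hk) (Subtype.coe_lt_coe.1 (by linarith)) (Subtype.coe_lt_coe.1 (by linarith))
      (fun x hx hxp m hm => by
        have h2 := S1 x ((hmem x).2 ⟨h, hh, mem_cr_iff.2 ⟨m, hm⟩⟩) p hpP hxp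
        have h3 := (hIcc x).2 hx
        linarith)
      (hT.not_isLocalExtr f mf h (mF h hh) (hne h hh) p hp)
    refine ⟨s, hs, k, fun x hx => ⟨?_, fun hxp => (H x ((hIcc x).1 hx) hxp).1⟩⟩
    rw [← hk]
    exact (hclose h hh p x hx).le
  have huniq : ∀ h ∈ F, ∀ h' ∈ F, ∀ p, p ∈ cr f h → p ∈ cr f h' → h = h' := by
    intro h hh h' hh' p hp hp'
    by_contra hcon
    refine Set.disjoint_left.1 (hT.disjoint_cr f mf h (mF h hh) f mf h' (mF h' hh') (hne h hh)
      (hne h' hh') fun e => ?_) hp hp'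
    simp only [Sym2.eq, Sym2.rel_iff', Prod.mk.injEq, Prod.swap_prod_mk, true_and] at e
    rcases e with e | ⟨e, -⟩
    · exact hcon e
    · exact hne h' hh' e
  have hex : ∀ p ∈ P, ∃ s : ℤ, (s = 1 ∨ s = -1) ∧ ∀ h ∈ F, p ∈ cr f h → ∃ k : ℤ,
      ∀ x : I, |(x : ℝ) - p| ≤ ρ →
        |f x - h x - k| ≤ 1 / 2 ∧ (x ≠ p → 0 < s * (f x - h x - k) * ((x : ℝ) - p)) := by
    intro p hp
    obtain ⟨h, hh, hph⟩ := (hmem p).1 hp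
    obtain ⟨s, hs, H⟩ := hsign h hh p hph
    exact ⟨s, hs, fun h' hh' hph' => huniq h hh h' hh' p hph hph' ▸ H⟩
  choose! s hs hs' using hex
  refine ⟨P, s, ρ, hρ, hρ1, hmem, hs, fun p hp q hq hpq => ?_, S2, S3, fun h hh p hp =>
    hs' p ((hmem p).2 ⟨h, hh, hp⟩) h hh hp⟩
  have := S1 p hp q hq hpq
  linarith

/-- The data of a transverse function near a finite set are shared by all sufficiently close
functions that are sufficiently steep on suitable intervals. -/
theorem SmoothRado.IsTransverse.exists_steep {F : Finset C(I, ℝ)} {f : C(I, ℝ)} (hf : f ∉ F)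
    (hT : IsTransverse (insert f (F : Set C(I, ℝ)))) {ε : ℝ} (hε : 0 < ε) {S : ℝ}
    (hS : ∀ h ∈ F, ∀ x y : I, x < y → |h x - h y| < S * ((y : ℝ) - x)) (hS0 : 0 ≤ S) :
    ∃ (f₂ : C(I, ℝ)) (η δ : ℝ) (L : Finset (ℚ × ℚ × ℤ)), 0 < η ∧ 0 < δ ∧
      (∀ z ∈ L, (z.2.2 = 1 ∨ z.2.2 = -1) ∧ δ ≤ (z.1 : ℝ) ∧ (z.2.1 : ℝ) ≤ 1 - δ ∧
        Steep z.2.2 (S + 1) (z.1 - δ) (z.2.1 + δ) f₂) ∧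
      ∀ g : C(I, ℝ), ‖g - f₂‖ ≤ η → (∀ z ∈ L, Steep z.2.2 S z.1 z.2.1 g) →
        ‖f - g‖ < ε ∧ ∀ h ∈ F, SimWithin ε (cr f h) (cr g h) := by
  classical
  have hne : ∀ h ∈ F, f ≠ h := fun h hh e => hf (e ▸ hh)
  have mf : f ∈ insert f (F : Set C(I, ℝ)) := mem_insert _ _
  have mF : ∀ h ∈ F, h ∈ insert f (F : Set C(I, ℝ)) := fun h hh => mem_insert_of_mem f hh
  obtain ⟨P, s, ρ, hρ, hρε, hmem, hs, hsep, h0, h1, hsign⟩ := hT.exists_sign hf hε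
  have hη : ∀ h : C(I, ℝ), ∃ η > 0, ∀ x : I, (∀ p ∈ cr f h, ρ ≤ |(x : ℝ) - p|) → ∀ k : ℤ,
      η ≤ |f x - h x - k| := by
    intro h
    have hclosed : IsClosed {x : I | ∀ p ∈ cr f h, ρ ≤ |(x : ℝ) - p|} := by
      simp only [ofPred_forall]
      exact isClosed_iInter fun p => isClosed_iInter fun _ =>
        isClosed_le continuous_const (by fun_prop)
    obtain ⟨η, hη, H⟩ := exists_dist_int_pos hclosed.isCompact (u := fun x => f x - h x)
      (by fun_prop) fun x hx k hk => by
        have := hx x (mem_cr_iff.2 ⟨k, hk⟩)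
        simp at this
        linarith
    exact ⟨η, hη, H⟩
  choose η hη hη' using hη
  obtain ⟨η₀, hη₀, hη₀'⟩ := exists_pos_forall_le F.finite_toSet (f := η) fun h _ => hη h
  -- `A` is the height of the zigzag: small against the distance of `f - h` from the integers away
  -- from crossings, against `1 / 2` and against `ε`.
  set A := min η₀ (min (1 / 2) ε) / 4 with hA_def
  have hA : 0 < A := by positivity
  have hA1 : 4 * A ≤ η₀ := by
    have : min η₀ (min (1 / 2) ε) ≤ η₀ := min_le_left _ _
    linarith
  have hA2 : 4 * A ≤ 1 / 2 := by
    have : min η₀ (min (1 / 2) ε) ≤ 1 / 2 := (min_le_right _ _).trans (min_le_left _ _)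
    linarith
  have hA3 : 4 * A ≤ ε := by
    have : min η₀ (min (1 / 2) ε) ≤ ε := (min_le_right _ _).trans (min_le_right _ _)
    linarith
  obtain ⟨f₀, L₀, hL₀, hlip, hf₀⟩ := exists_lipschitz_near f (ε := A / 8) (by positivity)
  -- The slope of the zigzag absorbs the slope `L₀` of `f₀` and leaves `S + 1`. The term `A / ρ`
  -- makes the zigzag reach its height `A` at a distance `l ≤ ρ`.
  set S' := L₀ + S + 1 + A / ρ with hS'
  have hS'0 : 0 < S' := by positivity
  obtain ⟨Z, hZA, hZ⟩ := exists_zigzag P s hs (S := S') hA.le hρ hsep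
  set l := A / S' with hl_def
  have hl : 0 < l := by positivity
  have hlS : S' * l = A := by rw [hl_def]; field_simp
  have hlρ : l ≤ ρ := by
    rw [hl_def, div_le_iff₀ hS'0, hS', mul_add, mul_div_cancel₀ _ hρ.ne']
    have : 0 ≤ ρ * (L₀ + S + 1) := by positivity
    linarith
  have hZl : ∀ p ∈ P, ∀ x : I, |(x : ℝ) - p| ≤ l → Z x = s p * (S' * ((x : ℝ) - p)) := by
    intro p hp x hx
    rw [hZ p hp x (hx.trans hlρ)]
    have : |S' * ((x : ℝ) - p)| ≤ A := by
      rw [abs_mul, abs_of_pos hS'0, ← hlS]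
      gcongr
    obtain ⟨a, b⟩ := abs_le.1 this
    rw [min_eq_right b, max_eq_right a]
  have hst : ∀ p ∈ P, Steep (s p) (S + 1) (p - l) (p + l) (f₀ + Z) := by
    intro p hp x y hxy hx hy
    have hxy' : (x : ℝ) ≤ y := hxy
    rw [ContinuousMap.add_apply, ContinuousMap.add_apply,
      hZl p hp x (abs_le.2 ⟨by linarith, by linarith⟩),
      hZl p hp y (abs_le.2 ⟨by linarith, by linarith⟩)]
    have h2 := hlip y x
    rw [abs_of_nonneg (sub_nonneg.2 hxy')] at h2
    have h3 := abs_le.1 h2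
    have h4 : (L₀ + S + 1) * ((y : ℝ) - x) ≤ S' * (y - x) :=
      mul_le_mul_of_nonneg_right (by rw [hS']; linarith [div_nonneg hA.le hρ.le])
        (sub_nonneg.2 hxy')
    rcases hs p hp with e | e <;> rw [e] <;> push_cast <;> linarith
  obtain ⟨L, hL1, hL2⟩ := exists_rat_list P s hs hl (f₂ := f₀ + Z)
    (fun p hp => by linarith [h0 p hp]) (fun p hp => by linarith [h1 p hp]) hst
  refine ⟨f₀ + Z, A / 16, l / 2, L, by positivity, by positivity, hL1, fun g hg hgL => ?_⟩
  have hgst := hL2 S g hgL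
  -- The error is at most `A / 16` from `g` plus `A / 8` from `f₀`.
  have hw : ∀ x, |g x - f x - Z x| ≤ 3 * A / 16 := by
    intro x
    have h2 := (ContinuousMap.norm_coe_le_norm (g - (f₀ + Z)) x).trans hg
    have h3 := hf₀ x
    simp only [ContinuousMap.sub_apply, ContinuousMap.add_apply, Real.norm_eq_abs] at h2
    obtain ⟨a, b⟩ := abs_le.1 h2
    obtain ⟨c, d⟩ := abs_lt.1 h3
    exact abs_le.2 ⟨by linarith, by linarith⟩
  have hgf : ∀ x, |f x - g x| < 2 * A := fun x => by
    obtain ⟨a, b⟩ := abs_le.1 (hw x)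
    obtain ⟨c, d⟩ := abs_le.1 (hZA x)
    exact abs_lt.2 ⟨by linarith, by linarith⟩
  refine ⟨?_, fun h hh => ?_⟩
  · rw [ContinuousMap.norm_lt_iff _ hε]
    intro x
    exact (hgf x).trans (by linarith)
  have hmemP : ∀ p ∈ cr f h, p ∈ P := fun p hp => (hmem p).2 ⟨h, hh, hp⟩
  -- Beyond `l / 4` from a crossing the zigzag has size at least `A / 4` and protects the integer
  -- parts; within `l / 4`, `g` is steeper than every `h ∈ F`, so `g - h` is strictly monotone.
  refine simWithin_of_strictMonoOn (ρ := l / 4) (by positivity) (by linarith)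
    (hT.finite_cr f mf h (mF h hh) (hne h hh)) (fun p hp q hq hpq => ?_) (fun p hp => ?_)
    (fun p hp => ?_) (hT.not_isLocalExtr f mf h (mF h hh) (hne h hh)) (fun x hx => ?_)
    fun p hp => ?_
  · linarith [hsep p (hmemP p hp) q (hmemP q hq) hpq]
  · linarith [h0 p (hmemP p hp)]
  · linarith [h1 p (hmemP p hp)]
  · by_cases hfar : ∃ p ∈ cr f h, |(x : ℝ) - p| < ρ
    · obtain ⟨p, hp, hxp⟩ := hfar
      obtain ⟨k, hk⟩ := hsign h hh p hp
      obtain ⟨k1, k2⟩ := hk x hxp.le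
      have hx' := hx p hp
      have hne : (x : ℝ) - p ≠ 0 := fun e => by rw [e, abs_zero] at hx'; linarith
      have hsr : (s p : ℝ) = 1 ∨ (s p : ℝ) = -1 := by
        rcases hs p (hmemP p hp) with e | e <;> simp [e]
      have hss : (s p : ℝ) * s p = 1 := by rcases hsr with e | e <;> rw [e] <;> norm_num
      have key := abs_add_sub_lt (u := f x - h x) (v := Z x) (w := g x - f x - Z x) hsr hne
        (k2 fun e => hne (by rw [e, sub_self])) k1 (hw x) (A := A) ?_ (hZA x) hA (by linarith)
        rfl
      · have e : f x - h x + Z x + (g x - f x - Z x) = g x - h x := by ring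
        rw [e] at key
        refine ⟨key.1, fun hc => ?_⟩
        obtain ⟨m, hm⟩ := mem_cr_iff.1 hc
        exact key.2 m hm
      · rw [hZ p (hmemP p hp) x hxp.le, ← mul_assoc, hss, one_mul]
        have h5 : S' * (l / 4) = A / 4 := by rw [← hlS]; ring
        rcases lt_or_gt_of_ne hne with hlt | hgt
        · rw [abs_of_neg hlt] at hx' ⊢
          have h6 : S' * (l / 4) ≤ S' * -((x : ℝ) - p) := by gcongr
          have h7 : max (-A) (min A (S' * ((x : ℝ) - p))) ≤ -(A / 4) :=
            max_le (by linarith) (min_le_of_right_le (by linarith))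
          have h8 := mul_le_mul_of_nonneg_right h7 (neg_nonneg.2 hlt.le)
          linarith
        · rw [abs_of_pos hgt] at hx' ⊢
          have h6 : S' * (l / 4) ≤ S' * ((x : ℝ) - p) := by gcongr
          have h7 : A / 4 ≤ max (-A) (min A (S' * ((x : ℝ) - p))) :=
            le_max_of_le_right (le_min (by linarith) (by linarith))
          exact mul_le_mul_of_nonneg_right h7 hgt.le
    · push Not at hfar
      have h2 : ∀ k : ℤ, 2 * A ≤ |f x - h x - k| := fun k =>
        (by linarith [hη₀' h hh] : 2 * A ≤ η h).trans (hη' h x hfar k)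
      have h3 : |f x - h x - (g x - h x)| < 2 * A := by simpa using hgf x
      refine ⟨floor_eq_of_abs_sub_lt h2 h3, fun hc => ?_⟩
      obtain ⟨m, hm⟩ := mem_cr_iff.1 hc
      exact ne_int_of_abs_sub_lt h2 h3 m hm
  · have hstp := hgst p (hmemP p hp)
    have key : ∀ x y : I, |(x : ℝ) - p| ≤ l / 4 → |(y : ℝ) - p| ≤ l / 4 → x < y →
        0 < s p * ((g y - h y) - (g x - h x)) := by
      intro x y hx hy hxy
      have a1 := hstp x y hxy.le (by linarith [(abs_le.1 hx).1]) (by linarith [(abs_le.1 hy).2])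
      have a2 := abs_lt.1 (hS h hh x y hxy)
      rcases hs p (hmemP p hp) with e | e <;> rw [e] at a1 ⊢ <;> push_cast at a1 ⊢ <;> linarith
    rcases hs p (hmemP p hp) with e | e
    · left
      intro x hx y hy hxy
      have := key x y hx hy hxy
      rw [e] at this
      push_cast at this
      change g x - h x < g y - h y
      linarith
    · right
      intro x hx y hy hxy
      have := key x y hx hy hxy
      rw [e] at this
      push_cast at this
      change g y - h y < g x - h x
      linarith

/-! ### Approximation by steep functions and almost sure smooth density -/

theorem isClosed_steep (s : ℤ) (S a b : ℝ) : IsClosed {g : C(I, ℝ) | Steep s S a b g} := by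
  simp only [Steep, ofPred_forall]
  refine isClosed_iInter fun x => isClosed_iInter fun y => isClosed_iInter fun _ =>
    isClosed_iInter fun _ => isClosed_iInter fun _ => isClosed_le continuous_const ?_
  exact continuous_const.mul ((continuous_eval_const y).sub (continuous_eval_const x))

/-- Every continuous function is approximated with positive probability by functions that are
asymptotically as steep. -/
def ApproximatesSteeply (P : Measure C(I, ℝ)) : Prop :=
  ∀ (f : C(I, ℝ)) (η δ : ℝ), 0 < η → 0 < δ →
    0 < P {g | ‖g - f‖ ≤ η ∧ ∀ (s : ℤ) (S a b : ℝ), (s = 1 ∨ s = -1) → δ ≤ a → b ≤ 1 - δ →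
      Steep s S (a - δ) (b + δ) f → Steep s (S - η) a b g}

/-- The closed sets of functions near the `n`-th member of a dense sequence and steep on finitely
many intervals. -/
def steepBall (n k S : ℕ) (L : Finset (ℚ × ℚ × ℤ)) : Set C(I, ℝ) :=
  {g | ‖g - TopologicalSpace.denseSeq C(I, ℝ) n‖ ≤ 1 / ((k : ℝ) + 1) ∧
    ∀ z ∈ L, Steep z.2.2 S z.1 z.2.1 g}

theorem isClosed_steepBall (n k S : ℕ) (L : Finset (ℚ × ℚ × ℤ)) : IsClosed (steepBall n k S L) := by
  have : steepBall n k S L = {g | ‖g - TopologicalSpace.denseSeq C(I, ℝ) n‖ ≤ 1 / ((k : ℝ) + 1)} ∩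
      ⋂ z ∈ L, {g | Steep z.2.2 S z.1 z.2.1 g} := by
    ext g
    simp [steepBall]
  rw [this]
  exact (isClosed_le (by fun_prop) continuous_const).inter
    (isClosed_biInter fun z _ => isClosed_steep _ _ _ _)

/-- Since `steepBall` has discrete parameters, almost surely all of these sets of positive measure
are hit by the sample at once, so targets chosen after sampling can be served. -/
theorem ApproximatesSteeply.exists_steepBall {P : Measure C(I, ℝ)} (hP : ApproximatesSteeply P)
    {f : C(I, ℝ)} {η δ : ℝ} {L : Finset (ℚ × ℚ × ℤ)} {S : ℕ} (hη : 0 < η) (hδ : 0 < δ)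
    (hL : ∀ z ∈ L, (z.2.2 = 1 ∨ z.2.2 = -1) ∧ δ ≤ (z.1 : ℝ) ∧ (z.2.1 : ℝ) ≤ 1 - δ ∧
        Steep z.2.2 (S + 1) (z.1 - δ) (z.2.1 + δ) f) :
    ∃ n k, 0 < P (steepBall n k S L) ∧ ∀ g ∈ steepBall n k S L, ‖g - f‖ ≤ η := by
  obtain ⟨k, hk⟩ := exists_nat_one_div_lt (half_pos hη)
  have hk0 : (0 : ℝ) < 1 / ((k : ℝ) + 1) := by positivity
  obtain ⟨n, hn⟩ := (TopologicalSpace.denseRange_denseSeq C(I, ℝ)).exists_dist_lt f (half_pos hk0)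
  rw [dist_eq_norm] at hn
  set d := TopologicalSpace.denseSeq C(I, ℝ) n
  refine ⟨n, k, ?_, fun g hg => ?_⟩
  · refine (hP f (min (1 / ((k : ℝ) + 1) / 2) 1) δ (by positivity) hδ).trans_le
      (measure_mono fun g hg => ⟨?_, fun z hz => ?_⟩)
    · have h1 := hg.1.trans (min_le_left _ _)
      have h2 := norm_sub_le_norm_sub_add_norm_sub g f d
      linarith
    · obtain ⟨z1, z2, z3, z4⟩ := hL z hz
      refine (hg.2 _ _ _ _ z1 z2 z3 z4).mono ?_ le_rfl le_rfl
      linarith [min_le_right (1 / ((k : ℝ) + 1) / 2) 1]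
  · have h2 := norm_sub_le_norm_sub_add_norm_sub g d f
    have h3 := hg.1
    rw [norm_sub_rev] at hn
    linarith

/-- Samples from a sufficiently nice law are almost surely smoothly dense. -/
theorem TranslationQuasiInvariant.ae_isSmoothlyDense {P : Measure C(I, ℝ)} [IsProbabilityMeasure P]
    (hP : TranslationQuasiInvariant P) (hP' : ApproximatesSteeply P) {T : Set C(I, ℝ)}
    (hT : IsTame T) (hTP : ∀ᵐ f ∂P, f ∈ T) (hlip : ∀ f ∈ T, ∃ K : NNReal, LipschitzWith K f) :
    ∀ᵐ f ∂(Measure.infinitePi fun _ : ℕ => P), IsSmoothlyDense (range f) := by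
  have h1 : ∀ᵐ f ∂(Measure.infinitePi fun _ : ℕ => P), ∀ n k S L, 0 < P (steepBall n k S L) →
      ∃ i, f i ∈ steepBall n k S L := by
    simp only [ae_all_iff]
    intro n k S L h
    exact ae_infinitePi_exists_mem (ν := fun _ => P) (E := fun _ => steepBall n k S L)
      (fun _ => (isClosed_steepBall n k S L).measurableSet) h fun _ => le_rfl
  have h2 : ∀ᵐ f ∂(Measure.infinitePi fun _ : ℕ => P), ∀ i, f i ∈ T := by
    rw [ae_all_iff]
    intro i
    exact (measurePreserving_eval_infinitePi (fun _ : ℕ => P) i).quasiMeasurePreserving.ae hTP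
  filter_upwards [h1, h2, hP.ae_isTransverse hT hTP] with f hf1 hf2 hf3
  refine ⟨?_, hf3, ?_, ?_⟩
  · rw [Metric.dense_iff]
    intro g r hr
    obtain ⟨n, k, hpos, H⟩ := hP'.exists_steepBall (f := g) (η := r / 2) (δ := 1) (L := ∅) (S := 0)
      (half_pos hr) one_pos (by simp)
    obtain ⟨i, hi⟩ := hf1 n k 0 ∅ hpos
    refine ⟨f i, ?_, mem_range_self i⟩
    rw [mem_ball_iff_norm]
    exact (H _ hi).trans_lt (half_lt_self hr)
  · rintro _ ⟨i, rfl⟩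
    exact hlip _ (hf2 i)
  · intro F hF g hg hFT ε hε
    have hK : ∀ h : C(I, ℝ), ∃ K : NNReal, h ∈ F → LipschitzWith K h := fun h => by
      by_cases hh : h ∈ F
      · obtain ⟨i, rfl⟩ := hF hh
        obtain ⟨K, hK⟩ := hlip _ (hf2 i)
        exact ⟨K, fun _ => hK⟩
      · exact ⟨0, fun h => absurd h hh⟩
    choose K hK using hK
    -- `S` exceeds the Lipschitz constant of every member of `F`.
    obtain ⟨S, hS⟩ := exists_nat_gt (∑ h ∈ F, K h)
    obtain ⟨f₂, η, δ, L, hη, hδ, hL, H⟩ := hFT.exists_steep hg hε (S := S)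
      (fun h hh x y hxy => by
        have h2 := (hK h hh).dist_le_mul x y
        rw [Real.dist_eq, Subtype.dist_eq, Real.dist_eq, abs_sub_comm (x : ℝ),
          abs_of_pos (sub_pos.2 (Subtype.coe_lt_coe.2 hxy))] at h2
        refine h2.trans_lt (mul_lt_mul_of_pos_right ?_ (sub_pos.2 (Subtype.coe_lt_coe.2 hxy)))
        exact_mod_cast (Finset.single_le_sum (f := K) (fun _ _ => zero_le) hh).trans_lt hS)
      S.cast_nonneg
    obtain ⟨n, k, hpos, H'⟩ := hP'.exists_steepBall hη hδ hL
    obtain ⟨i, hi⟩ := hf1 n k S L hpos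
    exact ⟨f i, mem_range_self i, H _ (H' _ hi) hi.2⟩

/-! ### Poisson mixtures -/

theorem poissonMeasure_one_singleton_ne_zero (n : ℕ) : poissonMeasure 1 {n} ≠ 0 := fun h => by
  have := poissonMeasure_real_singleton_pos n (r := 1) one_pos
  rw [measureReal_def, h] at this
  simp at this

section Mixture

variable {Ω : Type*} [MeasurableSpace Ω] {ν : Measure Ω} [IsProbabilityMeasure ν]
  {Φ : ℕ × Ω → C(I, ℝ)}

theorem mixture_pos (hΦ : Measurable Φ) {A : Set C(I, ℝ)} {n : ℕ} {B : Set Ω} (hB : 0 < ν B)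
    (h : ∀ ω ∈ B, Φ (n, ω) ∈ A) : 0 < ((poissonMeasure 1).prod ν).map Φ A := by
  refine lt_of_lt_of_le ?_ (Measure.le_map_apply hΦ.aemeasurable A)
  refine lt_of_lt_of_le ?_ (measure_mono (s := {n} ×ˢ B) ?_)
  · rw [Measure.prod_prod]
    exact ENNReal.mul_pos (poissonMeasure_one_singleton_ne_zero n) hB.ne'
  · rintro ⟨m, ω⟩ ⟨hm, hω⟩
    obtain rfl : m = n := hm
    exact h ω hω

/-- Every value of the Poisson variable has positive mass, so a null set for the mixture is null for
each fixed `n`, and the translation can be realized by a different `τ` for each `n`. -/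
theorem mixture_translationQuasiInvariant (hΦ : Measurable Φ)
    (h : ∀ (n : ℕ) (c : ℝ), ∃ τ : Ω → Ω, Measurable τ ∧ ν.map τ ≪ ν ∧
      ∀ ω, Φ (n, τ ω) = Φ (n, ω) + ContinuousMap.const I c) :
    TranslationQuasiInvariant (((poissonMeasure 1).prod ν).map Φ) := by
  intro c
  have hc : Measurable fun u : C(I, ℝ) => u + ContinuousMap.const I c :=
    (by fun_prop : Continuous fun u : C(I, ℝ) => u + ContinuousMap.const I c).measurable
  refine Measure.AbsolutelyContinuous.mk fun A hA h0 => ?_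
  rw [Measure.map_apply hΦ hA, Measure.measure_prod_null (hΦ hA)] at h0
  rw [Measure.map_map hc hΦ, Measure.map_apply (hc.comp hΦ) hA,
    Measure.measure_prod_null ((hc.comp hΦ) hA)]
  refine .of_forall fun n => ?_
  have hn : ν (Prod.mk n ⁻¹' (Φ ⁻¹' A)) = 0 := by
    by_contra hne
    refine poissonMeasure_one_singleton_ne_zero n (measure_mono_null ?_ h0)
    rintro m rfl
    exact hne
  obtain ⟨τ, hτ, hν, H⟩ := h n c
  have h2 := hν hn
  rw [Measure.map_apply hτ (measurable_prodMk_left (hΦ hA))] at h2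
  have e : Prod.mk n ⁻¹' (((fun u : C(I, ℝ) => u + ContinuousMap.const I c) ∘ Φ) ⁻¹' A) =
      τ ⁻¹' (Prod.mk n ⁻¹' (Φ ⁻¹' A)) := by
    ext ω
    simp [H]
  change ν _ = 0
  rw [e]
  exact h2

end Mixture

/-- Normal laws with the same nonzero variance and different means are equivalent, and the other
coordinates are untouched. -/
theorem map_update_add_gaussian_absolutelyContinuous (i : ℕ) (c : ℝ) :
    (Measure.infinitePi fun _ : ℕ => gaussianReal 0 1).map
      (fun a => Function.update a i (a i + c)) ≪
        Measure.infinitePi fun _ : ℕ => gaussianReal 0 1 := by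
  set G := Measure.infinitePi fun _ : ℕ => gaussianReal 0 1 with hG
  have hU : Measurable fun z : (ℕ → ℝ) × ℝ => Function.update z.1 i z.2 := measurable_update'
  have hm : Measurable fun a : ℕ → ℝ => Function.update a i (a i + c) :=
    hU.comp (by fun_prop : Measurable fun a : ℕ → ℝ => (a, a i + c))
  have hs : Measurable fun z : (ℕ → ℝ) × ℝ => (z.1, z.2 + c) := by fun_prop
  have e := Measure.infinitePi_prod_map_update (fun _ : ℕ => gaussianReal 0 1) i
  rw [← hG] at e
  have e2 : G.map (fun a => Function.update a i (a i + c)) =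
      ((G.prod (gaussianReal 0 1)).map fun z => (z.1, z.2 + c)).map
        fun z => Function.update z.1 i z.2 := by
    conv_lhs => rw [← e]
    rw [Measure.map_map hm hU, Measure.map_map hU hs]
    congr 1
    ext z j
    simp
  have e3 : (G.prod (gaussianReal 0 1)).map (fun z => (z.1, z.2 + c)) =
      G.prod (gaussianReal c 1) := by
    have := Measure.map_prod_map G (gaussianReal 0 1) measurable_id (measurable_add_const c)
    rw [Measure.map_id, gaussianReal_map_add_const, zero_add] at this
    exact this.symm
  rw [e2, e3]
  conv_rhs => rw [← e]
  refine Measure.AbsolutelyContinuous.map (Measure.AbsolutelyContinuous.prod .rfl ?_) hU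
  exact (gaussianReal_absolutelyContinuous c one_ne_zero).trans
    (gaussianReal_absolutelyContinuous' 0 one_ne_zero)

/-- Coordinates are shifted one by one. Finiteness of their number matters: a shift of all
coordinates by `c ≠ 0` gives a singular law. -/
theorem map_add_below_gaussian_absolutelyContinuous (n : ℕ) (c : ℝ) :
    Measurable (fun (a : ℕ → ℝ) j => if j < n then a j + c else a j) ∧
    (Measure.infinitePi fun _ : ℕ => gaussianReal 0 1).map
      (fun a j => if j < n then a j + c else a j) ≪
        Measure.infinitePi fun _ : ℕ => gaussianReal 0 1 := by
  have hmeas : ∀ n, Measurable (fun (a : ℕ → ℝ) j => if j < n then a j + c else a j) := by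
    intro n
    refine measurable_pi_lambda _ fun j => ?_
    split_ifs <;> fun_prop
  refine ⟨hmeas n, ?_⟩
  induction n with
  | zero => simp [Measure.AbsolutelyContinuous.rfl]
  | succ n ih =>
    have hU : Measurable fun a : ℕ → ℝ => Function.update a n (a n + c) :=
      (measurable_update' (X := fun _ : ℕ => ℝ)).comp
        (by fun_prop : Measurable fun a : ℕ → ℝ => (a, a n + c))
    have e : (fun (a : ℕ → ℝ) j => if j < n + 1 then a j + c else a j) =
        (fun (a : ℕ → ℝ) => Function.update a n (a n + c)) ∘
          fun (a : ℕ → ℝ) j => if j < n then a j + c else a j := by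
      ext a j
      simp only [Function.comp_apply, Function.update_apply]
      rcases lt_trichotomy j n with h | h | h
      · simp [h, h.ne, h.trans (Nat.lt_succ_self n)]
      · simp [h]
      · have : ¬ j < n + 1 := by omega
        simp [this, h.ne', h.le.not_gt]
    rw [e, ← Measure.map_map hU (hmeas n)]
    exact (ih.map hU).trans (map_update_add_gaussian_absolutelyContinuous n c)

theorem infinitePi_box_pos {X : Type*} [PseudoMetricSpace X] [MeasurableSpace X]
    [OpensMeasurableSpace X] (μ : Measure X) [IsProbabilityMeasure μ] [μ.IsOpenPosMeasure]
    (s : Finset ℕ) (v : ℕ → X) {r : ℝ} (hr : 0 < r) :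
    0 < (Measure.infinitePi fun _ : ℕ => μ) {a | ∀ i ∈ s, dist (a i) (v i) < r} := by
  have : {a : ℕ → X | ∀ i ∈ s, dist (a i) (v i) < r} =
      (s : Set ℕ).pi fun i => Metric.ball (v i) r := by
    ext a
    simp [Set.mem_pi]
  rw [this, Measure.infinitePi_pi _ fun i _ => Metric.isOpen_ball.measurableSet]
  exact pos_iff_ne_zero.2 (Finset.prod_ne_zero_iff.2 fun i _ =>
    (Metric.measure_ball_pos μ (v i) hr).ne')

instance : (gaussianReal 0 1).IsOpenPosMeasure :=
  (gaussianReal_absolutelyContinuous' 0 one_ne_zero).isOpenPosMeasure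

/-! ### Random polynomials -/

theorem Polynomial.exists_derivative_eq (D : Polynomial ℝ) : ∃ G : Polynomial ℝ,
    G.derivative = D := by
  induction D using Polynomial.induction_on' with
  | add p q hp hq =>
    obtain ⟨P, rfl⟩ := hp
    obtain ⟨Q, rfl⟩ := hq
    exact ⟨P + Q, Polynomial.derivative_add⟩
  | monomial n a =>
    refine ⟨Polynomial.monomial (n + 1) (a / (n + 1)), ?_⟩
    rw [Polynomial.derivative_monomial, Nat.add_sub_cancel]
    congr 1
    push_cast
    field_simp

/-- A continuous function is approximated by polynomials that are asymptotically as steep. -/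
theorem exists_polynomial_steep (f : C(I, ℝ)) {η δ : ℝ} (hη : 0 < η) (hδ : 0 < δ) :
    ∃ G : Polynomial ℝ, (∀ t : I, |G.eval (t : ℝ) - f t| ≤ η) ∧
      ∀ (s : ℤ) (S a b : ℝ), (s = 1 ∨ s = -1) → δ ≤ a → b ≤ 1 - δ →
        Steep s S (a - δ) (b + δ) f → Steep s (S - η) a b (G.toContinuousMapOn _) := by
  set F : ℝ → ℝ := fun x => f (projIcc 0 1 zero_le_one x) with hF
  have hFc : Continuous F := f.continuous.comp continuous_projIcc
  have hFI : ∀ t : I, F t = f t := fun t => by simp [hF]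
  obtain ⟨r₀, hr₀, huc⟩ := Metric.uniformContinuous_iff.1
    (CompactSpace.uniformContinuous_of_continuous f.continuous) (η / 4) (by positivity)
  set r := min (r₀ / 2) δ with hr_def
  have hr : 0 < r := by positivity
  have hrr : r < r₀ := (min_le_left _ _).trans_lt (by linarith)
  have hrδ : r ≤ δ := min_le_right _ _
  have hFu : ∀ x y : ℝ, |x - y| ≤ r → |F x - F y| < η / 4 := fun x y hxy => by
    refine huc ?_
    refine lt_of_le_of_lt ?_ hrr
    rw [Subtype.dist_eq, Real.dist_eq]
    exact (abs_projIcc_sub_projIcc _).trans hxy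
  set Φ : ℝ → ℝ := fun x => ∫ u in (0 : ℝ)..x, F u with hΦ
  have hΦd : ∀ x, HasDerivAt Φ (F x) x := fun x => hFc.integral_hasStrictDerivAt 0 x |>.hasDerivAt
  -- The moving average `m` has the difference quotient `d` as its derivative. Steepness of `f` says
  -- directly that `s * d ≥ S` wherever the window of length `r ≤ δ` stays in the steep interval.
  set m : ℝ → ℝ := fun x => (Φ (x + r) - Φ x) / r with hm
  set d : ℝ → ℝ := fun x => (F (x + r) - F x) / r with hd
  have hmd : ∀ x, HasDerivAt m (d x) x := fun x =>
    (((hΦd (x + r)).comp_add_const x r).sub (hΦd x)).div_const r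
  have hmf : ∀ x, |m x - F x| < η / 4 := by
    intro x
    obtain ⟨c, hc, hc'⟩ := exists_hasDerivAt_eq_slope Φ F (lt_add_of_pos_right x hr)
      (fun y _ => (hΦd y).continuousAt.continuousWithinAt) fun y _ => hΦd y
    have : m x = F c := by rw [hc', hm, add_sub_cancel_left]
    rw [this]
    exact hFu c x (abs_le.2 ⟨by linarith [hc.1], by linarith [hc.2]⟩)
  -- The derivative is approximated and then integrated, which controls values and slopes
  -- simultaneously.
  obtain ⟨D, hD⟩ := exists_polynomial_near_of_continuousOn 0 1 d
    (by fun_prop : Continuous d).continuousOn (η / 4) (by positivity)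
  obtain ⟨G₀, hG₀⟩ := D.exists_derivative_eq
  set G := G₀ + Polynomial.C (m 0 - G₀.eval 0) with hG
  have hGd : ∀ x, HasDerivAt (fun x => G.eval x) (D.eval x) x := fun x => by
    have := G.hasDerivAt x
    rwa [hG, Polynomial.derivative_add, Polynomial.derivative_C, add_zero, hG₀] at this
  have hG0 : G.eval 0 = m 0 := by simp [hG]
  have hGm : ∀ t : I, |G.eval (t : ℝ) - m t| ≤ η / 4 := by
    intro t
    have := (convex_Icc (0 : ℝ) 1).norm_image_sub_le_of_norm_hasDerivWithin_le
      (f := fun x => G.eval x - m x) (f' := fun x => D.eval x - d x) (C := η / 4)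
      (fun z _ => ((hGd z).sub (hmd z)).hasDerivWithinAt)
      (fun z hz => (hD z hz).le) (left_mem_Icc.2 zero_le_one) t.2
    simp only [hG0, sub_self, sub_zero, Real.norm_eq_abs, abs_of_nonneg t.2.1] at this
    exact this.trans (mul_le_of_le_one_right (by positivity) t.2.2)
  refine ⟨G, fun t => ?_, fun s S a b hs ha hb hst x y hxy hx hy => ?_⟩
  · have h1 := abs_le.1 (hGm t)
    have h2 := abs_lt.1 (hmf t)
    rw [hFI] at h2
    exact abs_le.2 ⟨by linarith, by linarith⟩
  · have hxy' : (x : ℝ) ≤ y := hxy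
    have hs' : |(s : ℝ)| = 1 := by rcases hs with rfl | rfl <;> simp
    have hder : ∀ z ∈ Icc (x : ℝ) y, S - η ≤ s * D.eval z := by
      intro z hz
      have hz0 : z ∈ Icc (0 : ℝ) 1 := ⟨x.2.1.trans hz.1, hz.2.trans y.2.2⟩
      have hz1 : z + r ∈ Icc (0 : ℝ) 1 := ⟨by linarith [hz0.1], by linarith [hz.2]⟩
      have h1 := hst ⟨z, hz0⟩ ⟨z + r, hz1⟩ (Subtype.mk_le_mk.2 (by linarith))
        (by simp only; linarith [hz.1]) (by simp only; linarith [hz.2])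
      rw [← hFI, ← hFI] at h1
      simp only [add_sub_cancel_left] at h1
      have h2 : S ≤ s * d z := by
        rw [hd, ← mul_div_assoc, le_div_iff₀ hr]
        exact h1
      have h3 : |s * (D.eval z - d z)| ≤ η / 4 := by
        rw [abs_mul, hs', one_mul]
        exact (hD z hz0).le
      have h4 := (abs_le.1 h3).1
      rw [mul_sub] at h4
      linarith
    have hmono : MonotoneOn (fun z => s * G.eval z - (S - η) * z) (Icc (x : ℝ) y) := by
      refine monotoneOn_of_hasDerivWithinAt_nonneg (convex_Icc _ _)
        (f' := fun z => s * D.eval z - (S - η) * 1) (by fun_prop)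
        (fun z _ => (((hGd z).const_mul (s : ℝ)).sub
          ((hasDerivAt_id z).const_mul (S - η))).hasDerivWithinAt) fun z hz => ?_
      linarith [hder z (interior_subset hz)]
    have := hmono (left_mem_Icc.2 hxy') (right_mem_Icc.2 hxy') hxy'
    simp only [Polynomial.toContinuousMapOn_apply, Polynomial.toContinuousMap_apply] at this ⊢
    linarith

theorem Steep.of_perturb {s : ℤ} {S S' a b e : ℝ} {f g : C(I, ℝ)} (h : Steep s S a b f)
    (hs : s = 1 ∨ s = -1) (hS : S' ≤ S - e)
    (hg : ∀ x y : I, x ≤ y → |(g y - f y) - (g x - f x)| ≤ e * ((y : ℝ) - x)) :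
    Steep s S' a b g := fun x y hxy hx hy => by
  have h1 := h x y hxy hx hy
  have h2 := abs_le.1 (hg x y hxy)
  have h3 := mul_le_mul_of_nonneg_right hS (sub_nonneg.2 (Subtype.coe_le_coe.2 hxy))
  rcases hs with rfl | rfl <;> push_cast at h1 ⊢ <;> linarith

theorem abs_pow_sub_pow_le_of_mem (x y : I) (n : ℕ) :
    |(y : ℝ) ^ n - (x : ℝ) ^ n| ≤ n * |(y : ℝ) - x| := by
  induction n with
  | zero => simp
  | succ n ih =>
    have e : (y : ℝ) ^ (n + 1) - (x : ℝ) ^ (n + 1) = y * ((y : ℝ) ^ n - (x : ℝ) ^ n) +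
        (x : ℝ) ^ n * (y - x) := by ring
    rw [e]
    refine (abs_add_le _ _).trans ?_
    rw [abs_mul, abs_mul, abs_of_nonneg y.2.1, abs_of_nonneg (pow_nonneg x.2.1 n)]
    have h1 : (y : ℝ) * |(y : ℝ) ^ n - (x : ℝ) ^ n| ≤ 1 * (n * |(y : ℝ) - x|) :=
      mul_le_mul y.2.2 ih (abs_nonneg _) zero_le_one
    have h2 : (x : ℝ) ^ n * |(y : ℝ) - x| ≤ 1 * |(y : ℝ) - x| :=
      mul_le_mul_of_nonneg_right (pow_le_one₀ x.2.1 x.2.2) (abs_nonneg _)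
    push_cast
    linarith

theorem approximatesSteeply_polyMeasure : ApproximatesSteeply polyMeasure := by
  intro f η δ hη hδ
  obtain ⟨G, hG1, hG2⟩ := exists_polynomial_steep f (half_pos hη) hδ
  set N := G.natDegree
  -- One factor `N + 1` counts the coefficients, the other bounds the Lipschitz constants of the
  -- powers `t ^ i` on `[0,1]`.
  set r := η / 2 / ((N : ℝ) + 1) ^ 2 with hr
  have hr0 : 0 < r := by positivity
  have hrN : ((N : ℝ) + 1) * ((N + 1) * r) = η / 2 := by rw [hr]; field_simp
  refine mixture_pos measurable_polyMap (n := N)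
    (infinitePi_box_pos (gaussianReal 0 1) (Finset.range (N + 1)) G.coeff hr0) fun a ha => ?_
  have ha' : ∀ i ∈ Finset.range (N + 1), |a i - G.coeff i| ≤ r := fun i hi => (ha i hi).le
  have hdiff : ∀ t : I, polyMap (N, a) t - G.eval (t : ℝ) =
      ∑ i ∈ Finset.range (N + 1), (a i - G.coeff i) * (t : ℝ) ^ i := fun t => by
    rw [Polynomial.eval_eq_sum_range, polyMap, ContinuousMap.coe_mk, ← Finset.sum_sub_distrib]
    exact Finset.sum_congr rfl fun i _ => by ring
  have hsum : ∀ u : ℕ → ℝ, (∀ i ∈ Finset.range (N + 1), |u i| ≤ (N + 1) * r) →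
      |∑ i ∈ Finset.range (N + 1), u i| ≤ η / 2 := fun u hu => by
    refine (Finset.abs_sum_le_sum_abs _ _).trans ((Finset.sum_le_sum hu).trans ?_)
    rw [Finset.sum_const, Finset.card_range, nsmul_eq_mul]
    push_cast
    exact hrN.le
  refine ⟨?_, fun s S a' b hs ha1 hb hst => ?_⟩
  · rw [ContinuousMap.norm_le _ hη.le]
    intro t
    have h1 : |polyMap (N, a) t - G.eval (t : ℝ)| ≤ η / 2 := by
      rw [hdiff]
      refine hsum _ fun i hi => ?_
      rw [abs_mul, abs_of_nonneg (pow_nonneg t.2.1 i)]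
      have h2 : |a i - G.coeff i| * (t : ℝ) ^ i ≤ r * 1 :=
        mul_le_mul (ha' i hi) (pow_le_one₀ t.2.1 t.2.2) (pow_nonneg t.2.1 i) hr0.le
      have h3 : 0 ≤ (N : ℝ) * r := by positivity
      linarith
    have h2 := abs_le.1 h1
    have h3 := abs_le.1 (hG1 t)
    exact abs_le.2 ⟨by simp only [ContinuousMap.sub_apply]; linarith,
      by simp only [ContinuousMap.sub_apply]; linarith⟩
  · refine (hG2 s S a' b hs ha1 hb hst).of_perturb hs (e := η / 2) (by linarith)
      fun x y hxy => ?_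
    simp only [Polynomial.toContinuousMapOn_apply, Polynomial.toContinuousMap_apply]
    have hxy' : (0 : ℝ) ≤ y - x := sub_nonneg.2 hxy
    rw [hdiff, hdiff, ← Finset.sum_sub_distrib]
    refine (Finset.abs_sum_le_sum_abs _ _).trans ?_
    have h4 : ∀ i ∈ Finset.range (N + 1), |(a i - G.coeff i) * (y : ℝ) ^ i -
        (a i - G.coeff i) * (x : ℝ) ^ i| ≤ (N + 1) * r * (y - x) := fun i hi => by
      rw [← mul_sub, abs_mul]
      have h5 := abs_pow_sub_pow_le_of_mem x y i
      rw [abs_of_nonneg hxy'] at h5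
      have h6 : (i : ℝ) ≤ N + 1 := by exact_mod_cast (Finset.mem_range.1 hi).le
      calc |a i - G.coeff i| * |(y : ℝ) ^ i - (x : ℝ) ^ i| ≤ r * ((N + 1) * (y - x)) :=
            mul_le_mul (ha' i hi) (h5.trans (by gcongr)) (abs_nonneg _) hr0.le
        _ = _ := by ring
    refine (Finset.sum_le_sum h4).trans ?_
    rw [Finset.sum_const, Finset.card_range, nsmul_eq_mul, ← hrN]
    push_cast
    exact le_of_eq (by ring)

theorem translationQuasiInvariant_polyMeasure : TranslationQuasiInvariant polyMeasure := by
  refine mixture_translationQuasiInvariant measurable_polyMap fun n c =>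
    ⟨fun a => Function.update a 0 (a 0 + c), ?_, map_update_add_gaussian_absolutelyContinuous 0 c,
      fun a => ?_⟩
  · exact (measurable_update' (X := fun _ : ℕ => ℝ)).comp
      (by fun_prop : Measurable fun a : ℕ → ℝ => (a, a 0 + c))
  · ext t
    simp only [polyMap, ContinuousMap.coe_mk, ContinuousMap.add_apply, ContinuousMap.const_apply]
    rw [Finset.sum_range_succ', Finset.sum_range_succ']
    simp [add_assoc]

/-- The polynomial functions on the unit interval. -/
def polynomialMaps : Set C(I, ℝ) := {f | ∃ p : Polynomial ℝ, ∀ t : I, f t = p.eval (t : ℝ)}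

/-- A polynomial difference with an infinite level set is constant, and then every point is a local
extremum. -/
theorem isTame_polynomialMaps : IsTame polynomialMaps := by
  rintro f ⟨p, hp⟩ g ⟨q, hq⟩ m hm
  have h : p = q + Polynomial.C (m : ℝ) := by
    refine Polynomial.eq_of_infinite_eval_eq _ _
      ((hm.image Subtype.val_injective.injOn).mono ?_)
    rintro _ ⟨t, ht, rfl⟩
    have ht' : f t - g t = m := ht
    rw [hp, hq] at ht'
    simp only [mem_ofPred_eq, Polynomial.eval_add, Polynomial.eval_C]
    linarith
  have hfg : ∀ t, f t - g t = m := fun t => by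
    rw [hp, hq, h]
    simp
  refine ⟨0, hfg 0, .inl (.of_forall fun t => ?_)⟩
  simp only [ContinuousMap.sub_apply, hfg, le_refl]

/-- Measurability comes from writing polynomials of bounded degree as a finite-dimensional, hence
closed, subspace. -/
theorem ae_mem_polynomialMaps : ∀ᵐ f ∂polyMeasure, f ∈ polynomialMaps := by
  let Λ : ∀ n : ℕ, (Fin (n + 1) → ℝ) →ₗ[ℝ] C(I, ℝ) := fun n =>
    { toFun := fun a => ⟨fun t => ∑ i, a i * (t : ℝ) ^ (i : ℕ), by fun_prop⟩
      map_add' := fun a b => by ext t; simp [add_mul, Finset.sum_add_distrib]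
      map_smul' := fun c a => by ext t; simp [mul_assoc, Finset.mul_sum] }
  have hmeas : MeasurableSet (⋃ n, (LinearMap.range (Λ n) : Set C(I, ℝ))) :=
    .iUnion fun n => (Submodule.closed_of_finiteDimensional _).measurableSet
  have hsub : ∀ f ∈ ⋃ n, (LinearMap.range (Λ n) : Set C(I, ℝ)), f ∈ polynomialMaps := by
    intro f hf
    obtain ⟨n, a, rfl⟩ := mem_iUnion.1 hf
    refine ⟨∑ i, Polynomial.C (a i) * Polynomial.X ^ (i : ℕ), fun t => ?_⟩
    simp [Λ, Polynomial.eval_finsetSum]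
  have hae : ∀ᵐ f ∂polyMeasure, f ∈ ⋃ n, (LinearMap.range (Λ n) : Set C(I, ℝ)) := by
    refine (ae_map_iff (p := fun f => f ∈ ⋃ n, (LinearMap.range (Λ n) : Set C(I, ℝ)))
      measurable_polyMap.aemeasurable hmeas).2 (.of_forall fun q => ?_)
    refine mem_iUnion.2 ⟨q.1, fun i => q.2 i, ?_⟩
    ext t
    simp [Λ, polyMap, Finset.sum_range]
  exact hae.mono hsub

theorem exists_lipschitzWith_of_mem_polynomialMaps {f : C(I, ℝ)} (hf : f ∈ polynomialMaps) :
    ∃ K : NNReal, LipschitzWith K f := by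
  obtain ⟨p, hp⟩ := hf
  obtain ⟨K, hK⟩ := ((p.contDiff_aeval (𝕜 := ℝ) 1).contDiffOn
    (s := Icc (0 : ℝ) 1)).exists_lipschitzOnWith one_ne_zero (convex_Icc 0 1) isCompact_Icc
  simp only [Polynomial.coe_aeval_eq_eval] at hK
  refine ⟨K, fun x y => ?_⟩
  rw [hp, hp]
  exact hK x.2 y.2

theorem ae_isSmoothlyDense_polyMeasure :
    ∀ᵐ f ∂(Measure.infinitePi fun _ : ℕ => polyMeasure), IsSmoothlyDense (range f) :=
  translationQuasiInvariant_polyMeasure.ae_isSmoothlyDense approximatesSteeply_polyMeasure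
    isTame_polynomialMaps ae_mem_polynomialMaps
    fun _ => exists_lipschitzWith_of_mem_polynomialMaps

/-! ### Piecewise linear functions -/

/-- The function that vanishes up to `u`, is linear on `[u, v]` and equals `1` from `v` on. -/
noncomputable def ramp (u v t : ℝ) : ℝ := max 0 (min 1 ((t - u) / (v - u)))

theorem ramp_mem (u v t : ℝ) : ramp u v t ∈ Icc (0 : ℝ) 1 :=
  ⟨le_max_left _ _, max_le zero_le_one (min_le_left _ _)⟩

theorem ramp_eq_zero {u v t : ℝ} (huv : u ≤ v) (h : t ≤ u) : ramp u v t = 0 :=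
  max_eq_left (min_le_of_right_le
    (div_nonpos_of_nonpos_of_nonneg (sub_nonpos.2 h) (sub_nonneg.2 huv)))

theorem ramp_eq_one {u v t : ℝ} (huv : u < v) (h : v ≤ t) : ramp u v t = 1 := by
  have : 1 ≤ (t - u) / (v - u) := by rw [le_div_iff₀ (sub_pos.2 huv)]; linarith
  rw [ramp, min_eq_left this, max_eq_right zero_le_one]

/-- Division by zero gives `0`, so coinciding change points contribute nothing. -/
theorem ramp_self (u t : ℝ) : ramp u u t = 0 := by simp [ramp]

theorem mul_ramp {u v t : ℝ} (h1 : u ≤ t) (h2 : t ≤ v) : (v - u) * ramp u v t = t - u := by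
  rcases (h1.trans h2).eq_or_lt with rfl | h
  · rw [ramp_self, le_antisymm h1 h2]; ring
  · have h3 : 0 < v - u := sub_pos.2 h
    have h4 : 0 ≤ (t - u) / (v - u) := div_nonneg (sub_nonneg.2 h1) h3.le
    have h5 : (t - u) / (v - u) ≤ 1 := (div_le_one₀ h3).2 (by linarith)
    rw [ramp, min_eq_right h5, max_eq_right h4, mul_div_cancel₀ _ h3.ne']

/-- In this form the sum over consecutive intervals telescopes (`sum_mul_ramp`). -/
theorem mul_ramp_eq_min {u v : ℝ} (huv : u ≤ v) (t : ℝ) :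
    (v - u) * ramp u v t = min v t - min u t := by
  rcases le_total t u with h | h
  · rw [ramp_eq_zero huv h, min_eq_right h, min_eq_right (h.trans huv)]; ring
  · rcases le_total t v with h' | h'
    · rw [mul_ramp h h', min_eq_right h', min_eq_left h]
    · rcases huv.eq_or_lt with rfl | h3
      · simp
      · rw [ramp_eq_one h3 h', min_eq_left h', min_eq_left h, mul_one]

theorem abs_ramp_sub_le (u v s t : ℝ) : |ramp u v s - ramp u v t| ≤ |(v - u)⁻¹| * |s - t| := by
  have h1 := abs_max_sub_max_le_abs (min 1 ((s - u) / (v - u))) (min 1 ((t - u) / (v - u))) 0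
  have h2 := abs_min_sub_min_le_max 1 ((s - u) / (v - u)) 1 ((t - u) / (v - u))
  rw [sub_self, abs_zero, max_eq_right (abs_nonneg _)] at h2
  have h3 : (s - u) / (v - u) - (t - u) / (v - u) = (v - u)⁻¹ * (s - t) := by ring
  rw [h3, abs_mul] at h2
  rw [ramp, ramp, max_comm 0, max_comm 0]
  exact h1.trans h2

theorem ramp_affine {u v a b y : ℝ} (huv : u ≤ v) (hay : a ≤ y) (hyb : y ≤ b)
    (h : b ≤ u ∨ v ≤ a ∨ u = a ∧ v = b) :
    (b - a) * ramp u v y = (b - y) * ramp u v a + (y - a) * ramp u v b := by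
  rcases h with h | h | ⟨rfl, rfl⟩
  · rw [ramp_eq_zero huv h, ramp_eq_zero huv (hyb.trans h),
      ramp_eq_zero huv (hay.trans (hyb.trans h))]
    ring
  · rcases huv.eq_or_lt with rfl | h3
    · simp [ramp_self]
    · rw [ramp_eq_one h3 h, ramp_eq_one h3 (h.trans hay), ramp_eq_one h3 (h.trans (hay.trans hyb))]
      ring
  · rw [mul_ramp hay hyb, ramp_eq_zero huv le_rfl]
    rcases huv.eq_or_lt with rfl | h3
    · rw [ramp_self, le_antisymm hyb hay]; ring
    · rw [ramp_eq_one h3 le_rfl]; ring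

section Interpolation

variable {c y : ℕ → ℝ} {M : ℕ}

theorem sum_mul_ramp (hc : ∀ i < M, c i ≤ c (i + 1)) {t : ℝ} (h0 : c 0 ≤ t) (h1 : t ≤ c M) :
    ∑ i ∈ Finset.range M, (c (i + 1) - c i) * ramp (c i) (c (i + 1)) t = t - c 0 := by
  rw [Finset.sum_congr rfl fun i hi => mul_ramp_eq_min (hc i (Finset.mem_range.1 hi)) t,
    Finset.sum_range_sub (fun i => min (c i) t), min_eq_right h1, min_eq_left h0]

theorem add_sum_ramp (hc : ∀ i < M, c i < c (i + 1)) {k : ℕ} (hk : k < M) {t : ℝ}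
    (h0 : c k ≤ t) (h1 : t ≤ c (k + 1)) :
    y 0 + ∑ i ∈ Finset.range M, (y (i + 1) - y i) * ramp (c i) (c (i + 1)) t =
      y k + (y (k + 1) - y k) * ramp (c k) (c (k + 1)) t := by
  have hmono : ∀ j, j ≤ M → ∀ i ≤ j, c i ≤ c j := by
    intro j
    induction j with
    | zero => intro _ i hi; rw [Nat.le_zero.1 hi]
    | succ j ih =>
      intro hj i hi
      rcases hi.eq_or_lt with rfl | hi
      · exact le_rfl
      · exact (ih (by omega) i (by omega)).trans (hc j (by omega)).le
  have hA : ∀ m ≤ k, y 0 + ∑ i ∈ Finset.range m, (y (i + 1) - y i) * ramp (c i) (c (i + 1)) t =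
      y m := by
    intro m hm
    rw [Finset.sum_congr rfl (g := fun i => y (i + 1) - y i) fun i hi => ?_, Finset.sum_range_sub]
    · ring
    · have hi' := Finset.mem_range.1 hi
      rw [ramp_eq_one (hc i (by omega)) ((hmono k hk.le (i + 1) (by omega)).trans h0), mul_one]
  have hB : ∀ m, k + 1 ≤ m → m ≤ M →
      y 0 + ∑ i ∈ Finset.range m, (y (i + 1) - y i) * ramp (c i) (c (i + 1)) t =
        y k + (y (k + 1) - y k) * ramp (c k) (c (k + 1)) t := by
    intro m hm
    induction m, hm using Nat.le_induction with
    | base => intro _; rw [Finset.sum_range_succ, ← add_assoc, hA k le_rfl]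
    | succ m hm ih =>
      intro hM
      rw [Finset.sum_range_succ, ← add_assoc, ih (by omega),
        ramp_eq_zero (hc m hM).le (h1.trans (hmono m (by omega) (k + 1) hm)), mul_zero, add_zero]
  exact hB M hk le_rfl

theorem exists_mem_segment {t : ℝ} (hM : 0 < M) (h0 : c 0 ≤ t) (h1 : t ≤ c M) :
    ∃ k < M, c k ≤ t ∧ t ≤ c (k + 1) := by
  by_contra hcon
  push Not at hcon
  have h : ∀ k < M, c k ≤ t := by
    intro k
    induction k with
    | zero => exact fun _ => h0
    | succ k ih => exact fun hk => (hcon k (by omega) (ih (by omega))).le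
  obtain ⟨m, rfl⟩ := Nat.exists_eq_succ_of_ne_zero hM.ne'
  exact absurd h1 (hcon m (by omega) (h m (by omega))).not_ge

/-- Interpolation at sufficiently dense points yields a close and almost as steep function. -/
theorem interpolation_steep {f g : C(I, ℝ)} {η δ ρ κ : ℝ} (hM : 0 < M)
    (hc : ∀ i < M, c i < c (i + 1)) (hc0 : c 0 = 0) (hcM : c M = 1)
    (hcI : ∀ i ≤ M, c i ∈ Icc (0 : ℝ) 1)
    (hg : ∀ t : I, g t =
      y 0 + ∑ i ∈ Finset.range M, (y (i + 1) - y i) * ramp (c i) (c (i + 1)) t)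
    (hρ : ∀ i < M, c (i + 1) - c i ≤ ρ) (hρδ : ρ ≤ δ)
    (hf : ∀ s t : I, |(s : ℝ) - t| ≤ ρ → |f s - f t| ≤ η / 2)
    (hy : ∀ i ≤ M, ∀ z : I, (z : ℝ) = c i → |y i - f z| ≤ κ) (hκ : κ ≤ η / 2)
    (hκ' : ∀ i < M, 2 * κ ≤ η * (c (i + 1) - c i)) :
    (∀ t, |g t - f t| ≤ η) ∧ ∀ (s : ℤ) (S a b : ℝ), (s = 1 ∨ s = -1) → δ ≤ a → b ≤ 1 - δ →
      Steep s S (a - δ) (b + δ) f → Steep s (S - η) a b g := by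
  refine ⟨fun t => ?_, fun s S a b hs ha hb hst x x' hxx hx hx' => ?_⟩
  · obtain ⟨k, hk, hk1, hk2⟩ := exists_mem_segment hM (hc0 ▸ t.2.1) (hcM ▸ t.2.2)
    rw [hg t, add_sum_ramp hc hk hk1 hk2]
    obtain ⟨θ0, θ1⟩ := ramp_mem (c k) (c (k + 1)) t
    set θ := ramp (c k) (c (k + 1)) t
    have hkρ := hρ k hk
    have a1 := abs_le.1 (hy k hk.le ⟨c k, hcI k hk.le⟩ rfl)
    have a2 := abs_le.1 (hy (k + 1) hk ⟨c (k + 1), hcI (k + 1) hk⟩ rfl)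
    have a3 := abs_le.1 (hf ⟨c k, hcI k hk.le⟩ t
      (abs_le.2 ⟨by simp only; linarith, by simp only; linarith⟩))
    have a4 := abs_le.1 (hf ⟨c (k + 1), hcI (k + 1) hk⟩ t
      (abs_le.2 ⟨by simp only; linarith, by simp only; linarith⟩))
    have e : y k + (y (k + 1) - y k) * θ - f t = (1 - θ) * (y k - f t) + θ * (y (k + 1) - f t) := by
      ring
    rw [e]
    have b1 : |y k - f t| ≤ η := abs_le.2 ⟨by linarith, by linarith⟩
    have b2 : |y (k + 1) - f t| ≤ η := abs_le.2 ⟨by linarith, by linarith⟩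
    refine (abs_add_le _ _).trans ?_
    rw [abs_mul, abs_mul, abs_of_nonneg θ0, abs_of_nonneg (sub_nonneg.2 θ1)]
    have b3 := mul_le_mul_of_nonneg_left b1 (sub_nonneg.2 θ1)
    have b4 := mul_le_mul_of_nonneg_left b2 θ0
    linarith
  · have hxx' : (x : ℝ) ≤ x' := hxx
    have e1 := sum_mul_ramp (fun i hi => (hc i hi).le) (t := x) (hc0 ▸ x.2.1) (hcM ▸ x.2.2)
    have e2 := sum_mul_ramp (fun i hi => (hc i hi).le) (t := x') (hc0 ▸ x'.2.1) (hcM ▸ x'.2.2)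
    -- The increments of the identity and of `g` are combinations of `c (i + 1) - c i` and `y (i +
    -- 1) - y i` with the same nonnegative weights, so slopes can be compared segment by segment.
    have e3 : (x' : ℝ) - x = ∑ i ∈ Finset.range M, (c (i + 1) - c i) *
        (ramp (c i) (c (i + 1)) x' - ramp (c i) (c (i + 1)) x) := by
      simp only [mul_sub, Finset.sum_sub_distrib] at e1 e2 ⊢
      linarith
    have e4 : g x' - g x = ∑ i ∈ Finset.range M, (y (i + 1) - y i) *
        (ramp (c i) (c (i + 1)) x' - ramp (c i) (c (i + 1)) x) := by
      rw [hg, hg]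
      simp only [mul_sub, Finset.sum_sub_distrib]
      ring
    rw [e3, e4, Finset.mul_sum, Finset.mul_sum]
    refine Finset.sum_le_sum fun i hi => ?_
    have hi' := Finset.mem_range.1 hi
    have hci := hc i hi'
    rw [← mul_assoc, ← mul_assoc]
    by_cases hout : (x' : ℝ) ≤ c i ∨ c (i + 1) ≤ x
    · have : ramp (c i) (c (i + 1)) x' - ramp (c i) (c (i + 1)) x = 0 := by
        rcases hout with h | h
        · rw [ramp_eq_zero hci.le h, ramp_eq_zero hci.le (hxx'.trans h), sub_self]
        · rw [ramp_eq_one hci h, ramp_eq_one hci (h.trans hxx'), sub_self]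
      rw [this, mul_zero, mul_zero]
    -- A segment that meets the interior of `[x, x']` has length at most `δ`, so its ends lie in `[a
    -- - δ, b + δ]`, where `f` is steep; the errors at both ends cost at most `2 * κ`.
    · push Not at hout
      have hri := hρ i hi'
      have hD : 0 ≤ ramp (c i) (c (i + 1)) x' - ramp (c i) (c (i + 1)) x := by
        refine sub_nonneg.2 (max_le_max le_rfl (min_le_min le_rfl ?_))
        exact div_le_div_of_nonneg_right (by linarith) (sub_pos.2 hci).le
      refine mul_le_mul_of_nonneg_right ?_ hD
      have h1 := hst ⟨c i, hcI i hi'.le⟩ ⟨c (i + 1), hcI (i + 1) hi'⟩ (Subtype.mk_le_mk.2 hci.le)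
        (by simp only; linarith) (by simp only; linarith)
      have a1 := abs_le.1 (hy i hi'.le ⟨c i, hcI i hi'.le⟩ rfl)
      have a2 := abs_le.1 (hy (i + 1) hi' ⟨c (i + 1), hcI (i + 1) hi'⟩ rfl)
      have a3 := hκ' i hi'
      simp only at h1
      rcases hs with rfl | rfl <;> push_cast at h1 ⊢ <;> linarith

end Interpolation

/-! ### Change points and the law of random piecewise linear functions -/

theorem plMap_apply (q : ℕ × (ℕ → I) × (ℕ → ℝ)) (t : I) :
    plMap q t = q.2.2 0 + ∑ i : Fin (q.1 + 1), (q.2.2 (i + 1) - q.2.2 i) *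
      ramp (changePoint q.1 q.2.1 i.castSucc) (changePoint q.1 q.2.1 i.succ) t := rfl

theorem changePoint_mem (n : ℕ) (x : ℕ → I) (j : Fin (n + 2)) :
    changePoint n x j ∈ Icc (0 : ℝ) 1 := by
  refine Fin.cases ?_ (fun j => Fin.lastCases ?_ (fun j => ?_) j) j
  · simp [changePoint]
  · simp [changePoint]
  · simp only [changePoint, Fin.cons_succ, Fin.snoc_castSucc]
    exact Subtype.property _

theorem changePoint_zero (n : ℕ) (x : ℕ → I) : changePoint n x 0 = 0 := by simp [changePoint]

theorem changePoint_last (n : ℕ) (x : ℕ → I) : changePoint n x (Fin.last (n + 1)) = 1 := by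
  rw [← Fin.succ_last]
  simp only [changePoint, Fin.cons_succ, Fin.snoc_last]

theorem monotone_changePoint (n : ℕ) (x : ℕ → I) : Monotone (changePoint n x) := by
  intro i j
  refine Fin.cases ?_ (fun i => ?_) i
  · intro _
    rw [changePoint_zero]
    exact (changePoint_mem n x j).1
  refine Fin.cases (fun h => absurd h (by simp)) (fun j => ?_) j
  refine Fin.lastCases ?_ (fun j => ?_) j
  · intro _
    rw [Fin.succ_last, changePoint_last]
    exact (changePoint_mem n x _).2
  refine Fin.lastCases (fun h => absurd h ?_) (fun i h => ?_) i
  · rw [Fin.succ_le_succ_iff, not_le]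
    exact Fin.castSucc_lt_last j
  · rw [Fin.succ_le_succ_iff, Fin.castSucc_le_castSucc_iff] at h
    simp only [changePoint, Fin.cons_succ, Fin.snoc_castSucc]
    exact Tuple.monotone_sort (fun i : Fin n => x (i + 1)) h

theorem exists_changePoint_segment (n : ℕ) (x : ℕ → I) (t : I) : ∃ i : Fin (n + 1),
    changePoint n x i.castSucc ≤ t ∧ t ≤ changePoint n x i.succ := by
  by_contra hcon
  push Not at hcon
  have h : ∀ j, changePoint n x j ≤ t := by
    intro j
    induction j using Fin.induction with
    | zero => rw [changePoint_zero]; exact t.2.1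
    | succ i ih => exact (hcon i ih).le
  have := hcon (Fin.last n) (h _)
  rw [Fin.succ_last, changePoint_last] at this
  exact absurd t.2.2 this.not_ge

/-- The `K`-Lipschitz functions that are affine on each of `N` intervals covering `[0,1]`. -/
def piecewiseAffine (N K : ℕ) : Set C(I, ℝ) :=
  {f | (∀ x y, |f x - f y| ≤ K * |(x : ℝ) - y|) ∧ ∃ ab : Fin N → I × I,
    (∀ t, ∃ i, (ab i).1 ≤ t ∧ t ≤ (ab i).2) ∧ ∀ i, (ab i).1 ≤ (ab i).2 ∧ ∀ t : I,
      (((ab i).2 : ℝ) - (ab i).1) * f (max (ab i).1 (min (ab i).2 t)) =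
        (((ab i).2 : ℝ) - (max (ab i).1 (min (ab i).2 t) : I)) * f (ab i).1 +
          (((max (ab i).1 (min (ab i).2 t) : I) : ℝ) - (ab i).1) * f (ab i).2}

/-- Clamping `t` to the interval turns affinity into a family of equations valid for all `t`, closed
jointly in the function and the endpoints. The endpoints range over a compact space, so they can be
projected away. -/
theorem isClosed_piecewiseAffine (N K : ℕ) : IsClosed (piecewiseAffine N K) := by
  refine IsClosed.inter (s₁ := {f : C(I, ℝ) | ∀ x y, |f x - f y| ≤ K * |(x : ℝ) - y|}) ?_ ?_
  · simp only [ofPred_forall]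
    refine isClosed_iInter fun x => isClosed_iInter fun y => isClosed_le ?_ continuous_const
    exact ((continuous_eval_const x).sub (continuous_eval_const y)).abs
  · let W : Set (C(I, ℝ) × (Fin N → I × I)) := {w |
      (∀ t, ∃ i, (w.2 i).1 ≤ t ∧ t ≤ (w.2 i).2) ∧ ∀ i, (w.2 i).1 ≤ (w.2 i).2 ∧ ∀ t : I,
      (((w.2 i).2 : ℝ) - (w.2 i).1) * w.1 (max (w.2 i).1 (min (w.2 i).2 t)) =
        (((w.2 i).2 : ℝ) - (max (w.2 i).1 (min (w.2 i).2 t) : I)) * w.1 (w.2 i).1 +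
          (((max (w.2 i).1 (min (w.2 i).2 t) : I) : ℝ) - (w.2 i).1) * w.1 (w.2 i).2}
    have hW : IsClosed W := by
      refine IsClosed.inter (s₁ := {w : C(I, ℝ) × (Fin N → I × I) |
        ∀ t, ∃ i, (w.2 i).1 ≤ t ∧ t ≤ (w.2 i).2}) ?_ ?_
      · simp only [ofPred_forall, ofPred_exists]
        refine isClosed_iInter fun t => isClosed_iUnion_of_finite fun i => ?_
        exact (isClosed_le (by fun_prop) continuous_const).inter
          (isClosed_le continuous_const (by fun_prop))
      · change IsClosed {w : C(I, ℝ) × (Fin N → I × I) |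
          ∀ i, (w.2 i).1 ≤ (w.2 i).2 ∧ ∀ t : I,
          (((w.2 i).2 : ℝ) - (w.2 i).1) * w.1 (max (w.2 i).1 (min (w.2 i).2 t)) =
            (((w.2 i).2 : ℝ) - (max (w.2 i).1 (min (w.2 i).2 t) : I)) * w.1 (w.2 i).1 +
              (((max (w.2 i).1 (min (w.2 i).2 t) : I) : ℝ) - (w.2 i).1) * w.1 (w.2 i).2}
        simp only [ofPred_forall, ofPred_and]
        refine isClosed_iInter fun i => (isClosed_le (by fun_prop) (by fun_prop)).inter
          (isClosed_iInter fun t => isClosed_eq ?_ ?_)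
        · fun_prop
        · fun_prop
    change IsClosed {f : C(I, ℝ) | ∃ ab, (f, ab) ∈ W}
    have e : {f : C(I, ℝ) | ∃ ab, (f, ab) ∈ W} = Prod.fst '' W := by
      ext f
      simp
    rw [e]
    exact isClosedMap_fst_of_compactSpace W hW

theorem plMap_mem_piecewiseAffine (q : ℕ × (ℕ → I) × (ℕ → ℝ)) :
    ∃ K, plMap q ∈ piecewiseAffine (q.1 + 1) K := by
  set c := changePoint q.1 q.2.1 with hc
  have hcm : Monotone c := monotone_changePoint _ _
  obtain ⟨K, hK⟩ := exists_nat_ge (∑ i : Fin (q.1 + 1), |q.2.2 (i + 1) - q.2.2 i| *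
    |(c i.succ - c i.castSucc)⁻¹|)
  refine ⟨K, fun x y => ?_, fun i => (⟨c i.castSucc, changePoint_mem _ _ _⟩,
    ⟨c i.succ, changePoint_mem _ _ _⟩), fun t => exists_changePoint_segment _ _ t,
    fun i => ⟨hcm i.castSucc_lt_succ.le, fun t => ?_⟩⟩
  · rw [plMap_apply, plMap_apply, add_sub_add_left_eq_sub, ← Finset.sum_sub_distrib]
    refine (Finset.abs_sum_le_sum_abs _ _).trans ?_
    refine le_trans ?_ (mul_le_mul_of_nonneg_right hK (abs_nonneg _))
    rw [Finset.sum_mul]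
    refine Finset.sum_le_sum fun i _ => ?_
    rw [← mul_sub, abs_mul, mul_assoc]
    exact mul_le_mul_of_nonneg_left (abs_ramp_sub_le _ _ _ _) (abs_nonneg _)
  · have hi : c i.castSucc ≤ c i.succ := hcm i.castSucc_lt_succ.le
    set a : I := ⟨c i.castSucc, changePoint_mem _ _ _⟩ with ha
    set b : I := ⟨c i.succ, changePoint_mem _ _ _⟩ with hb
    set y : I := max a (min b t) with hy
    have hay : (a : ℝ) ≤ y := Subtype.coe_le_coe.2 (le_max_left _ _)
    have hyb : (y : ℝ) ≤ b := Subtype.coe_le_coe.2 (max_le hi (min_le_left _ _))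
    change ((b : ℝ) - a) * plMap q y = (b - y) * plMap q a + (y - a) * plMap q b
    simp only [plMap_apply, mul_add, Finset.mul_sum]
    have key : ∀ j : Fin (q.1 + 1), ((b : ℝ) - a) * ((q.2.2 (j + 1) - q.2.2 j) *
        ramp (c j.castSucc) (c j.succ) y) = (b - y) * ((q.2.2 (j + 1) - q.2.2 j) *
        ramp (c j.castSucc) (c j.succ) a) + (y - a) * ((q.2.2 (j + 1) - q.2.2 j) *
        ramp (c j.castSucc) (c j.succ) b) := by
      intro j
      have := ramp_affine (u := c j.castSucc) (v := c j.succ) (hcm j.castSucc_lt_succ.le) hay hyb ?_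
      · linear_combination (q.2.2 (j + 1) - q.2.2 j) * this
      · rcases lt_trichotomy j i with h | h | h
        · exact .inr (.inl (hcm (Fin.succ_le_castSucc_iff.2 h)))
        · subst h
          exact .inr (.inr ⟨rfl, rfl⟩)
        · exact .inl (hcm (Fin.succ_le_castSucc_iff.2 h))
    rw [Finset.sum_congr rfl fun j _ => key j, Finset.sum_add_distrib]
    ring

theorem exists_affine_of_mem_piecewiseAffine {N K : ℕ} {f : C(I, ℝ)} (hf : f ∈ piecewiseAffine N K)
    {T : Set I} (hT : T.Infinite) : ∃ T' ⊆ T, T'.Infinite ∧ ∃ a b : I, T' ⊆ Icc a b ∧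
      ∃ α β : ℝ, ∀ t ∈ Icc a b, f t = α + β * t := by
  obtain ⟨-, ab, h1, h2⟩ := hf
  obtain ⟨i, hi⟩ : ∃ i, (T ∩ Icc (ab i).1 (ab i).2).Infinite := by
    by_contra hcon
    push Not at hcon
    refine hT ((finite_iUnion hcon).subset fun t ht => ?_)
    obtain ⟨i, hi⟩ := h1 t
    exact mem_iUnion.2 ⟨i, ht, hi⟩
  refine ⟨_, inter_subset_left, hi, (ab i).1, (ab i).2, inter_subset_right, ?_⟩
  obtain ⟨h3, h4⟩ := h2 i
  have hlt : ((ab i).1 : ℝ) < (ab i).2 := by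
    refine lt_of_le_of_ne h3 fun e => hi ?_
    rw [Subtype.ext e, Icc_self]
    exact (finite_singleton _).inter_of_right _
  have hd : ((ab i).2 : ℝ) - (ab i).1 ≠ 0 := (sub_pos.2 hlt).ne'
  refine ⟨(((ab i).2 : ℝ) * f (ab i).1 - (ab i).1 * f (ab i).2) / ((ab i).2 - (ab i).1),
    (f (ab i).2 - f (ab i).1) / ((ab i).2 - (ab i).1), fun t ht => ?_⟩
  have := h4 t
  rw [min_eq_right ht.2, max_eq_right ht.1] at this
  field_simp
  linarith

/-- By pigeonhole infinitely many points of the level set lie in one affine piece of `f` and one of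
`g`. Of three such points, two make the difference constant on the common piece, and the middle one
has a neighbourhood inside it. -/
theorem isTame_piecewiseAffine : IsTame (⋃ N, ⋃ K, piecewiseAffine N K) := by
  intro f hf g hg m hm
  simp only [mem_iUnion] at hf hg
  obtain ⟨N, K, hf⟩ := hf
  obtain ⟨N', K', hg⟩ := hg
  obtain ⟨T, hT, hTi, a, b, hTab, α, β, hαβ⟩ := exists_affine_of_mem_piecewiseAffine hf hm
  obtain ⟨T', hT', hTi', a', b', hTab', α', β', hαβ'⟩ := exists_affine_of_mem_piecewiseAffine hg hTi
  have hlin : ∀ t ∈ Icc a b ∩ Icc a' b', f t - g t = (α - α') + (β - β') * t := fun t ht => by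
    rw [hαβ t ht.1, hαβ' t ht.2]; ring
  have hmem : ∀ t ∈ T', t ∈ Icc a b ∩ Icc a' b' ∧ f t - g t = m := fun t ht =>
    ⟨⟨hTab (hT' ht), hTab' ht⟩, hT (hT' ht)⟩
  obtain ⟨F, hF, hF3⟩ := hTi'.exists_subset_card_eq 3
  obtain ⟨e, he⟩ : ∃ e : Fin 3 ↪o I, range e = F := ⟨F.orderEmbOfFin hF3, by simp⟩
  have heT : ∀ i, e i ∈ T' := fun i => hF (by rw [← he]; exact mem_range_self i)
  have h01 : e 0 < e 1 := e.lt_iff_lt.2 (by decide)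
  have h12 : e 1 < e 2 := e.lt_iff_lt.2 (by decide)
  obtain ⟨m0, v0⟩ := hmem _ (heT 0)
  obtain ⟨m1, v1⟩ := hmem _ (heT 1)
  obtain ⟨m2, v2⟩ := hmem _ (heT 2)
  have hβ : β - β' = 0 := by
    have e1 := hlin _ m0
    have e2 := hlin _ m1
    have e3 : (β - β') * ((e 1 : ℝ) - e 0) = 0 := by linarith
    exact (mul_eq_zero.1 e3).resolve_right (sub_pos.2 (Subtype.coe_lt_coe.2 h01)).ne'
  refine ⟨e 1, v1, .inl ?_⟩
  filter_upwards [Icc_mem_nhds h01 h12] with t ht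
  have e1 := hlin _ m1
  have e2 := hlin t ⟨⟨m0.1.1.trans ht.1, ht.2.trans m2.1.2⟩, ⟨m0.2.1.trans ht.1, ht.2.trans m2.2.2⟩⟩
  rw [hβ] at e1 e2
  simp only [ContinuousMap.sub_apply]
  linarith

theorem ae_mem_piecewiseAffine : ∀ᵐ f ∂plMeasure, f ∈ ⋃ N, ⋃ K, piecewiseAffine N K := by
  refine (ae_map_iff (p := fun f => f ∈ ⋃ N, ⋃ K, piecewiseAffine N K)
    measurable_plMap.aemeasurable (.iUnion fun N => .iUnion fun K =>
      (isClosed_piecewiseAffine N K).measurableSet)).2 (.of_forall fun q => ?_)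
  obtain ⟨K, hK⟩ := plMap_mem_piecewiseAffine q
  exact mem_iUnion₂.2 ⟨_, K, hK⟩

theorem exists_lipschitzWith_of_mem_piecewiseAffine {f : C(I, ℝ)}
    (hf : f ∈ ⋃ N, ⋃ K, piecewiseAffine N K) : ∃ K : NNReal, LipschitzWith K f := by
  obtain ⟨N, K, hf⟩ := mem_iUnion₂.1 hf
  exact ⟨K, LipschitzWith.of_dist_le_mul fun x y => hf.1 x y⟩

theorem translationQuasiInvariant_plMeasure : TranslationQuasiInvariant plMeasure := by
  refine mixture_translationQuasiInvariant measurable_plMap fun n c => ?_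
  -- The function depends on the `n + 2` values `y 0, …, y (n + 1)`; shifting all of them shifts the
  -- function.
  obtain ⟨hm, hac⟩ := map_add_below_gaussian_absolutelyContinuous (n + 2) c
  refine ⟨fun q => (q.1, fun j => if j < n + 2 then q.2 j + c else q.2 j),
    measurable_fst.prodMk (hm.comp measurable_snd), ?_, fun q => ?_⟩
  · have := Measure.map_prod_map (Measure.infinitePi fun _ : ℕ => (volume : Measure I))
      (Measure.infinitePi fun _ : ℕ => gaussianReal 0 1) measurable_id hm
    rw [Measure.map_id] at this
    change Measure.map (Prod.map id fun (a : ℕ → ℝ) j => if j < n + 2 then a j + c else a j) _ ≪ _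
    rw [← this]
    exact Measure.AbsolutelyContinuous.prod .rfl hac
  · ext t
    simp only [plMap_apply, ContinuousMap.add_apply, ContinuousMap.const_apply]
    have h : ∀ i : Fin (n + 1), (i : ℕ) < n + 2 ∧ (i : ℕ) + 1 < n + 2 := fun i =>
      ⟨by omega, by omega⟩
    simp only [h, if_true, add_sub_add_right_eq_sub, Nat.zero_lt_succ]
    ring

instance : (volume : Measure I).IsOpenPosMeasure where
  open_pos U hU hne := by
    obtain ⟨V, hV, rfl⟩ := isOpen_induced_iff.1 hU
    obtain ⟨x, hx⟩ := hne
    have hx' : (x : ℝ) ∈ closure (Ioo (0 : ℝ) 1) := by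
      rw [closure_Ioo zero_ne_one]
      exact x.2
    have h := (hV.inter isOpen_Ioo).measure_pos volume (mem_closure_iff.1 hx' V hV hx)
    rw [unitInterval.volume_apply]
    refine (h.trans_le (measure_mono ?_)).ne'
    rintro t ⟨ht, ht'⟩
    exact ⟨⟨t, Ioo_subset_Icc_self ht'⟩, ht, rfl⟩

/-- With positive probability the change points are close to the equidistant nodes `j * h` and the
values close to those of `f` there, so `interpolation_steep` applies. -/
theorem approximatesSteeply_plMeasure : ApproximatesSteeply plMeasure := by
  intro f η δ hη hδ
  have huc : ∀ e > 0, ∃ r > 0, ∀ s t : I, |(s : ℝ) - t| ≤ r → |f s - f t| ≤ e := fun e he => by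
    obtain ⟨r, hr, H⟩ := Metric.uniformContinuous_iff.1
      (CompactSpace.uniformContinuous_of_continuous f.continuous) e he
    exact ⟨r / 2, half_pos hr, fun s t h => (H (show dist s t < r from
      lt_of_le_of_lt h (half_lt_self hr))).le⟩
  obtain ⟨ρ₁, hρ₁, hu1⟩ := huc (η / 2) (half_pos hη)
  set ρ := min ρ₁ δ with hρdef
  have hρ0 : 0 < ρ := by positivity
  have hρ1 : ρ ≤ ρ₁ := min_le_left _ _
  have hρδ : ρ ≤ δ := min_le_right _ _
  obtain ⟨n, hn⟩ := exists_nat_one_div_lt (half_pos hρ0)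
  set h : ℝ := 1 / ((n : ℝ) + 1) with hh
  have hh0 : 0 < h := by positivity
  have hh1 : h ≤ 1 := by rw [hh, div_le_one₀ (by positivity)]; linarith [n.cast_nonneg (α := ℝ)]
  -- Gaps between change points will be at least `h / 2`, so the errors `2 * κ` at the two ends
  -- change the slope by at most `η`.
  set κ := η * h / 4 with hκdef
  have hκ0 : 0 < κ := by positivity
  have hκη : κ ≤ η / 2 := by
    have : η * h ≤ η * 1 := by gcongr
    linarith
  obtain ⟨r₁, hr₁, hu2⟩ := huc (κ / 2) (half_pos hκ0)
  -- Displacements of at most `h / 4` keep the gaps between `h / 2` and `3 * h / 2`, which is less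
  -- than `ρ`; the bound `r₁` limits the resulting change of `f` to `κ / 2`.
  set r := min r₁ (h / 4) with hrdef
  have hr0 : 0 < r := by positivity
  have hr1 : r ≤ r₁ := min_le_left _ _
  have hrh : r ≤ h / 4 := min_le_right _ _
  have hnode : ∀ j : ℕ, j ≤ n + 1 → (j : ℝ) * h ∈ Icc (0 : ℝ) 1 := fun j hj => by
    refine ⟨by positivity, ?_⟩
    rw [hh, mul_one_div, div_le_one₀ (by positivity)]
    exact_mod_cast hj
  set v : ℕ → I := fun j => projIcc 0 1 zero_le_one ((j : ℝ) * h) with hv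
  have hvj : ∀ j : ℕ, j ≤ n + 1 → (v j : ℝ) = j * h := fun j hj => by
    rw [hv]
    simp only
    rw [projIcc_of_mem _ (hnode j hj)]
  refine mixture_pos measurable_plMap (n := n)
    (B := {x : ℕ → I | ∀ i ∈ Finset.range (n + 2), dist (x i) (v i) < r} ×ˢ
      {y : ℕ → ℝ | ∀ i ∈ Finset.range (n + 2), dist (y i) (f (v i)) < κ / 2}) ?_ ?_
  · rw [Measure.prod_prod]
    exact ENNReal.mul_pos (infinitePi_box_pos volume _ v hr0).ne'
      (infinitePi_box_pos (gaussianReal 0 1) _ (fun i => f (v i)) (half_pos hκ0)).ne'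
  rintro ⟨x, y⟩ ⟨hx, hy⟩
  have hx' : ∀ i < n + 2, |(x i : ℝ) - v i| < r := fun i hi => hx i (Finset.mem_range.2 hi)
  have hy' : ∀ i < n + 2, |y i - f (v i)| < κ / 2 := fun i hi => hy i (Finset.mem_range.2 hi)
  -- The points are already in increasing order, so the sorting permutation is the identity.
  have hxmono : Monotone fun i : Fin n => x (i + 1) := by
    intro i j hij
    rcases hij.eq_or_lt with rfl | hij
    · exact le_rfl
    have a1 := abs_lt.1 (hx' (i + 1) (by omega))
    have a2 := abs_lt.1 (hx' (j + 1) (by omega))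
    rw [hvj _ (by omega)] at a1 a2
    have a3 : (i : ℝ) + 1 ≤ j := by exact_mod_cast hij
    push_cast at a1 a2
    have a4 : ((i : ℝ) + 1) * h ≤ j * h := by gcongr
    exact Subtype.coe_le_coe.1 (by linarith)
  set c : ℕ → ℝ := fun j => if hj : j < n + 2 then changePoint n x ⟨j, hj⟩ else 1 with hc
  have hcF : ∀ j : Fin (n + 2), changePoint n x j = c j := fun j => by simp [hc]
  have hcI : ∀ i ≤ n + 1, c i ∈ Icc (0 : ℝ) 1 := fun i hi => by
    have := hcF ⟨i, by omega⟩
    simp only at this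
    rw [← this]
    exact changePoint_mem _ _ _
  have hcnear : ∀ j : Fin (n + 2), |changePoint n x j - j * h| ≤ r := by
    intro j
    refine Fin.cases ?_ (fun j => Fin.lastCases ?_ (fun j => ?_) j) j
    · simp [changePoint_zero, hr0.le]
    · rw [Fin.succ_last, changePoint_last, hh]
      simp only [Fin.val_last]
      push_cast
      rw [mul_one_div_cancel (by positivity), sub_self, abs_zero]
      exact hr0.le
    · have e : Tuple.sort (fun i : Fin n => x (i + 1)) = Equiv.refl _ :=
        Tuple.sort_eq_refl_iff_monotone.2 hxmono
      simp only [changePoint, Fin.cons_succ, Fin.snoc_castSucc, e, Equiv.refl_apply]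
      have := hx' (j + 1) (by omega)
      rw [hvj _ (by omega)] at this
      simpa using this.le
  have hcnear' : ∀ j ≤ n + 1, |c j - j * h| ≤ r := fun j hj => by
    have := hcnear ⟨j, by omega⟩
    rwa [hcF] at this
  have hgap : ∀ i < n + 1, h / 2 ≤ c (i + 1) - c i ∧ c (i + 1) - c i ≤ ρ := by
    intro i hi
    have a1 := abs_le.1 (hcnear' i hi.le)
    have a2 := abs_le.1 (hcnear' (i + 1) hi)
    push_cast at a2
    exact ⟨by linarith, by linarith⟩
  have key := interpolation_steep (c := c) (y := y) (M := n + 1) (f := f) (g := plMap (n, x, y))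
    (η := η) (δ := δ) (ρ := ρ) (κ := κ) n.succ_pos (fun i hi => by linarith [(hgap i hi).1])
    (by rw [← changePoint_zero n x, hcF]; rfl)
    (by rw [← changePoint_last n x, hcF]; rfl) hcI
    (fun t => by
      rw [plMap_apply]
      simp only [hcF]
      rw [Finset.sum_range (fun i => (y (i + 1) - y i) * ramp (c i) (c (i + 1)) t)]
      rfl)
    (fun i hi => (hgap i hi).2) hρδ (fun s t hst => hu1 s t (hst.trans hρ1))
    (fun i hi z hz => by
      have a1 := abs_lt.1 (hy' i (by omega))
      have a2 := abs_le.1 (hu2 (v i) z (by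
        rw [hvj i hi, hz, abs_sub_comm]
        exact (hcnear' i hi).trans hr1))
      exact abs_le.2 ⟨by linarith, by linarith⟩)
    hκη (fun i hi => by
      have : η * (h / 2) ≤ η * (c (i + 1) - c i) := mul_le_mul_of_nonneg_left (hgap i hi).1 hη.le
      linarith)
  exact ⟨(ContinuousMap.norm_le _ hη.le).2 key.1, key.2⟩

theorem ae_isSmoothlyDense_plMeasure :
    ∀ᵐ f ∂(Measure.infinitePi fun _ : ℕ => plMeasure), IsSmoothlyDense (range f) :=
  translationQuasiInvariant_plMeasure.ae_isSmoothlyDense approximatesSteeply_plMeasure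
    isTame_piecewiseAffine ae_mem_piecewiseAffine
    fun _ => exists_lipschitzWith_of_mem_piecewiseAffine

end

/-! ### Conclusion -/

theorem mainTheorem9 :
    ∃ R : SimpleGraph ℕ,
      IsGRSD R ∧ (∀ R' : SimpleGraph ℕ, IsGRSD R' → Nonempty (R' ≃g R)) ∧
      (∀ᵐ f ∂(Measure.infinitePi fun _ : ℕ => polyMeasure),
        LARGAlmostSurelyIso (Set.range f) R) ∧
      (∀ᵐ f ∂(Measure.infinitePi fun _ : ℕ => plMeasure),
        LARGAlmostSurelyIso (Set.range f) R) := by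
  -- Random polynomials also supply the smoothly dense set on which the model graph is built; its
  -- existence is what makes uniqueness meaningful.
  obtain ⟨f₀, hf₀⟩ := ae_isSmoothlyDense_polyMeasure.exists
  obtain ⟨R, hR, hR'⟩ := exists_isGRSD (Set.countable_range f₀) hf₀
  exact ⟨R, hR, hR',
    ae_isSmoothlyDense_polyMeasure.mono fun f hf => hR _ (Set.countable_range f) hf,
    ae_isSmoothlyDense_plMeasure.mono fun f hf => hR _ (Set.countable_range f) hf⟩
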